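/- Let $D\in\{2,7,11\}$ and let $\mathcal O$ be the ring of integers of $\mathbb Q(\sqrt{-D})$, that is $\mathcal O=\mathbb Z[\sqrt{-2}]$ for $D=2$ and $\mathcal O=\mathbb Z\big[\tfrac{1+\sqrt{-D}}{2}\big]$ for $D=7,11$. Let $$I_2=\{x+iy: |x|\le \tfrac12,\ |y|\le \tfrac1{\sqrt2}\},\qquad I_D=\Big\{x+iy: |x|\le\tfrac12,\ \big|y\pm \tfrac{x}{\sqrt D}\big|\le \tfrac{D+1}{4\sqrt D}\Big\}\quad (D=7,11),$$ and let $\widetilde I_D=I_D\setminus\bigcup_{\alpha\in A_D}(I_D+\alpha)$, where $A_2=\{1,\sqrt{-2}\}$ and $A_D=\{1,\tfrac{1\pm\sqrt{-D}}2\}$ for $D=7,11$. For $z\in\mathbb C$ let $[z]$ be the unique element of $\mathcal O$ with $z-[z]\in\widetilde I_D$. The Hurwitz map $\mathcal G: I_D\to I_D$ is given by $\mathcal G(0)=0$ and $\mathcal G(z)=\frac1z-\big[\frac1z\big]$ for $z\ne0$, and the period function is $$\Psi(z)=\frac{2}{\sqrt D}\,\operatorname{Im}\Big(\Big[\frac1z\Big]-\Big[\frac1{\mathcal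 G(z)}\Big]\Big),$$ which is defined for Lebesgue-almost every $z\in I_D$. Then there is exactly one $\mathcal G$-invariant probability measure $\mu=\mu_D$ on $I_D$ that is absolutely continuous with respect to Lebesgue measure, and there are real constants $C_D,C'_D$, depending only on $D$, with $C_D>0$, such that, as the real variable $t$ tends to $0$, $$\int_{I_D}\big(e^{it\Psi(z)}-1\big)\,d\mu(z)=C_D\,t^2\ln|t|+C_D'\,t^2+O\big(|t|^{5/2}\big).$$ -/

import Mathlib

open Complex MeasureTheory Filter Topology

noncomputable section

namespace Hurwitz

/-- The complex number `√(-D)`. -/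
def sqrtNeg (D : ℕ) : ℂ := (Real.sqrt D : ℂ) * I

/-- The ring of integers of `ℚ(√(-D))`, `D ∈ {2, 7, 11}`, as a subset of `ℂ`:
`ℤ[√(-2)]` for `D = 2` and `ℤ[(1 + √(-D))/2]` for `D = 7, 11`. -/
def integers (D : ℕ) : Set ℂ :=
  if D = 2 then {w | ∃ a b : ℤ, w = a + b * sqrtNeg D}
  else {w | ∃ a b : ℤ, w = a + b * ((1 + sqrtNeg D) / 2)}

/-- The closed fundamental domain `I_D`: a rectangle for `D = 2`, a hexagon for `D = 7, 11`. -/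
def domain (D : ℕ) : Set ℂ :=
  if D = 2 then {z | |z.re| ≤ 1 / 2 ∧ |z.im| ≤ 1 / Real.sqrt 2}
  else {z | |z.re| ≤ 1 / 2 ∧
    |z.im + z.re / Real.sqrt D| ≤ ((D : ℝ) + 1) / (4 * Real.sqrt D) ∧
    |z.im - z.re / Real.sqrt D| ≤ ((D : ℝ) + 1) / (4 * Real.sqrt D)}

/-- The translations whose images of `I_D` are removed from `I_D` to get a strict
fundamental domain. -/
def shifts (D : ℕ) : Set ℂ :=
  if D = 2 then {1, sqrtNeg D}
  else {1, (1 + sqrtNeg D) / 2, (1 - sqrtNeg D) / 2}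

/-- The strict fundamental domain `I_D \ ⋃ (I_D + α)`. -/
def strictDomain (D : ℕ) : Set ℂ :=
  domain D \ ⋃ α ∈ shifts D, (fun z => z + α) '' domain D

/-- The integer part `[z]`: the element `a` of the ring of integers with `z - a` in the strict
fundamental domain (it exists and is unique, see `existsUnique_intPart`). -/
def intPart (D : ℕ) (z : ℂ) : ℂ :=
  Classical.epsilon fun a : ℂ => a ∈ integers D ∧ z - a ∈ strictDomain D

/-- The Hurwitz map `𝒢(z) = 1/z - [1/z]`, `𝒢(0) = 0`. -/
def hurwitzMap (D : ℕ) (z : ℂ) : ℂ :=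
  if z = 0 then 0 else 1 / z - intPart D (1 / z)

/-- The period function `Ψ(z) = (2/√D) Im([1/z] - [1/𝒢(z)])`. -/
def period (D : ℕ) (z : ℂ) : ℝ :=
  2 / Real.sqrt D * (intPart D (1 / z) - intPart D (1 / hurwitzMap D z)).im

/-- `μ` is an invariant probability measure of the Hurwitz map on `I_D` that is absolutely
continuous with respect to the two-dimensional Lebesgue measure on `I_D`. -/
structure IsInvariantMeasure (D : ℕ) (μ : Measure ℂ) : Prop where
  isProbabilityMeasure : IsProbabilityMeasure μ
  absolutelyContinuous : μ ≪ volume.restrict (domain D)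
  measurePreserving : MeasurePreserving (hurwitzMap D) μ μ

lemma mem_domain_two (z : ℂ) : z ∈ domain 2 ↔
    |z.re| ≤ 1 / 2 ∧ |z.im / Real.sqrt 2| ≤ 1 / 2 := by
  have h2 : 0 < Real.sqrt 2 := by positivity
  have hs : Real.sqrt 2 * Real.sqrt 2 = 2 := Real.mul_self_sqrt (by norm_num)
  have hh : 1 / Real.sqrt 2 = Real.sqrt 2 / 2 := by
    rw [div_eq_div_iff h2.ne' two_ne_zero]; linarith
  show z ∈ (if (2 : ℕ) = 2 then _ else _ : Set ℂ) ↔ _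
  rw [if_pos rfl]
  show (|z.re| ≤ 1 / 2 ∧ |z.im| ≤ 1 / Real.sqrt 2) ↔ _
  rw [abs_div, abs_of_pos h2, div_le_iff₀ h2, hh, one_div_mul_eq_div]

lemma mem_domain_hex {D : ℕ} (hD : D = 7 ∨ D = 11) (z : ℂ) : z ∈ domain D ↔
    |z.re| ≤ 1 / 2 ∧ |D * (z.im / Real.sqrt D) + z.re| ≤ ((D : ℝ) + 1) / 4 ∧
      |D * (z.im / Real.sqrt D) - z.re| ≤ ((D : ℝ) + 1) / 4 := by
  have hD0 : (0 : ℝ) < D := by rcases hD with rfl | rfl <;> norm_num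
  have hq : 0 < Real.sqrt D := Real.sqrt_pos.2 hD0
  have hs : Real.sqrt D * Real.sqrt D = D := Real.mul_self_sqrt hD0.le
  have key : ∀ w c : ℝ, |w / Real.sqrt D| ≤ c / (4 * Real.sqrt D) ↔ |w| ≤ c / 4 := by
    intro w c
    rw [abs_div, abs_of_pos hq, ← div_div, div_le_div_iff_of_pos_right hq]
  have e0 : z.im * Real.sqrt D = D * (z.im / Real.sqrt D) := by
    rw [mul_div_assoc', eq_div_iff hq.ne', mul_assoc, hs, mul_comm]
  have e1 : z.im + z.re / Real.sqrt D = (D * (z.im / Real.sqrt D) + z.re) / Real.sqrt D := by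
    rw [← e0]; field_simp
  have e2 : z.im - z.re / Real.sqrt D = (D * (z.im / Real.sqrt D) - z.re) / Real.sqrt D := by
    rw [← e0]; field_simp
  unfold domain
  rw [if_neg (by rcases hD with rfl | rfl <;> norm_num)]
  show (|z.re| ≤ 1 / 2 ∧ |z.im + z.re / Real.sqrt D| ≤ ((D : ℝ) + 1) / (4 * Real.sqrt D) ∧
    |z.im - z.re / Real.sqrt D| ≤ ((D : ℝ) + 1) / (4 * Real.sqrt D)) ↔ _
  rw [e1, e2, key, key]

lemma mem_strictDomain {D : ℕ} (z : ℂ) : z ∈ strictDomain D ↔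
    z ∈ domain D ∧ ∀ α ∈ shifts D, z - α ∉ domain D := by
  simp only [strictDomain, Set.mem_sdiff, Set.mem_iUnion, Set.mem_image, ← eq_sub_iff_add_eq,
    exists_eq_right, exists_prop, not_exists, not_and]

lemma mem_strictDomain_two (z : ℂ) : z ∈ strictDomain 2 ↔
    (-(1 / 2) ≤ z.re ∧ z.re < 1 / 2) ∧
      (-(1 / 2) ≤ z.im / Real.sqrt 2 ∧ z.im / Real.sqrt 2 < 1 / 2) := by
  have h2 : Real.sqrt 2 ≠ 0 := by positivity
  have e1 : (z - 1).im / Real.sqrt 2 = z.im / Real.sqrt 2 := by simp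
  have e2 : (z - sqrtNeg 2).im / Real.sqrt 2 = z.im / Real.sqrt 2 - 1 := by
    simp [sqrtNeg, sub_div, h2]
  have e3 : (z - sqrtNeg 2).re = z.re := by simp [sqrtNeg]
  have e4 : (z - 1).re = z.re - 1 := by simp
  have es : shifts 2 = {1, sqrtNeg 2} := if_pos rfl
  rw [mem_strictDomain, es]
  simp only [Set.mem_insert_iff, Set.mem_singleton_iff, forall_eq_or_imp, forall_eq,
    mem_domain_two, e1, e2, e3, e4, abs_le]
  constructor
  · rintro ⟨⟨⟨a1, a2⟩, a3, a4⟩, b1, b2⟩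
    refine ⟨⟨a1, ?_⟩, a3, ?_⟩
    · by_contra h
      exact b1 ⟨⟨by linarith, by linarith⟩, a3, a4⟩
    · by_contra h
      exact b2 ⟨⟨a1, a2⟩, by linarith, by linarith⟩
  · rintro ⟨⟨a1, a2⟩, a3, a4⟩
    refine ⟨⟨⟨a1, a2.le⟩, a3, a4.le⟩, ?_, ?_⟩
    · rintro ⟨⟨c1, c2⟩, -⟩; linarith
    · rintro ⟨-, c1, c2⟩; linarith

lemma mem_strictDomain_hex {D : ℕ} (hD : D = 7 ∨ D = 11) (z : ℂ) : z ∈ strictDomain D ↔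
    (-(1 / 2) ≤ z.re ∧ z.re < 1 / 2) ∧
      (-(((D : ℝ) + 1) / 4) ≤ D * (z.im / Real.sqrt D) + z.re ∧
        D * (z.im / Real.sqrt D) + z.re < ((D : ℝ) + 1) / 4) ∧
      (-(((D : ℝ) + 1) / 4) < D * (z.im / Real.sqrt D) - z.re ∧
        D * (z.im / Real.sqrt D) - z.re ≤ ((D : ℝ) + 1) / 4) := by
  have hD0 : (7 : ℝ) ≤ D := by rcases hD with rfl | rfl <;> norm_num
  have hq : Real.sqrt D ≠ 0 := (Real.sqrt_pos.2 (by linarith)).ne'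
  have e1 : (z - 1).im / Real.sqrt D = z.im / Real.sqrt D := by simp
  have e2 : (z - (1 + sqrtNeg D) / 2).im / Real.sqrt D = z.im / Real.sqrt D - 1 / 2 := by
    simp [sqrtNeg, sub_div]; field_simp
  have e3 : (z - (1 + sqrtNeg D) / 2).re = z.re - 1 / 2 := by simp [sqrtNeg]
  have e4 : (z - 1).re = z.re - 1 := by simp
  have e5 : (z - (1 - sqrtNeg D) / 2).im / Real.sqrt D = z.im / Real.sqrt D + 1 / 2 := by
    simp [sqrtNeg]; field_simp; ring
  have e6 : (z - (1 - sqrtNeg D) / 2).re = z.re - 1 / 2 := by simp [sqrtNeg]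
  have es : shifts D = {1, (1 + sqrtNeg D) / 2, (1 - sqrtNeg D) / 2} :=
    if_neg (by rcases hD with rfl | rfl <;> norm_num)
  rw [mem_strictDomain, es]
  simp only [Set.mem_insert_iff, Set.mem_singleton_iff, forall_eq_or_imp, forall_eq,
    mem_domain_hex hD, e1, e2, e3, e4, e5, e6, abs_le]
  generalize z.im / Real.sqrt D = s
  generalize z.re = x
  generalize (D : ℝ) = d at *
  have hm1 : d * (s - 1 / 2) = d * s - d / 2 := by ring
  have hm2 : d * (s + 1 / 2) = d * s + d / 2 := by ring
  simp only [hm1, hm2]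
  generalize d * s = v
  constructor
  · rintro ⟨⟨⟨a1, a2⟩, ⟨a3, a4⟩, a5, a6⟩, b1, b2, b3⟩
    refine ⟨⟨a1, ?_⟩, ⟨a3, ?_⟩, ?_, a6⟩
    · by_contra h
      refine b1 ⟨⟨?_, ?_⟩, ⟨?_, ?_⟩, ?_, ?_⟩ <;> linarith
    · by_contra h
      refine b2 ⟨⟨?_, ?_⟩, ⟨?_, ?_⟩, ?_, ?_⟩ <;> linarith
    · by_contra h
      refine b3 ⟨⟨?_, ?_⟩, ⟨?_, ?_⟩, ?_, ?_⟩ <;> linarith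
  · rintro ⟨⟨a1, a2⟩, ⟨a3, a4⟩, a5, a6⟩
    refine ⟨⟨⟨a1, a2.le⟩, ⟨a3, a4.le⟩, a5.le, a6⟩, ?_, ?_, ?_⟩
    · rintro ⟨⟨c1, c2⟩, -⟩; linarith
    · rintro ⟨-, ⟨c1, c2⟩, -⟩; linarith
    · rintro ⟨-, -, c1, c2⟩; linarith

lemma existsUnique_intPart_two (z : ℂ) :
    ∃! a : ℂ, a ∈ integers 2 ∧ z - a ∈ strictDomain 2 := by
  have h2 : Real.sqrt 2 ≠ 0 := by positivity
  have ei : integers 2 = {w | ∃ a b : ℤ, w = a + b * sqrtNeg 2} := if_pos rfl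
  have ere : ∀ a b : ℤ, (z - (a + b * sqrtNeg 2)).re = z.re - a := by
    intro a b; simp [sqrtNeg]
  have eim : ∀ a b : ℤ, (z - (a + b * sqrtNeg 2)).im / Real.sqrt 2 = z.im / Real.sqrt 2 - b := by
    intro a b; simp [sqrtNeg, sub_div, h2]
  refine ⟨⌊z.re + 1 / 2⌋ + ⌊z.im / Real.sqrt 2 + 1 / 2⌋ * sqrtNeg 2, ⟨?_, ?_⟩, ?_⟩
  · rw [ei]; exact ⟨_, _, rfl⟩
  · rw [mem_strictDomain_two, ere, eim]
    have f1 := Int.floor_le (z.re + 1 / 2)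
    have f2 := Int.lt_floor_add_one (z.re + 1 / 2)
    have f3 := Int.floor_le (z.im / Real.sqrt 2 + 1 / 2)
    have f4 := Int.lt_floor_add_one (z.im / Real.sqrt 2 + 1 / 2)
    exact ⟨⟨by linarith, by linarith⟩, by linarith, by linarith⟩
  · rintro w ⟨hw, hz⟩
    rw [ei] at hw
    obtain ⟨a, b, rfl⟩ := hw
    rw [mem_strictDomain_two, ere, eim] at hz
    obtain ⟨⟨a1, a2⟩, a3, a4⟩ := hz
    have ha : ⌊z.re + 1 / 2⌋ = a := Int.floor_eq_iff.2 ⟨by linarith, by linarith⟩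
    have hb : ⌊z.im / Real.sqrt 2 + 1 / 2⌋ = b := Int.floor_eq_iff.2 ⟨by linarith, by linarith⟩
    rw [ha, hb]

lemma existsUnique_intPart_hex {D : ℕ} (hD : D = 7 ∨ D = 11) (z : ℂ) :
    ∃! a : ℂ, a ∈ integers D ∧ z - a ∈ strictDomain D := by
  have hD0 : (7 : ℝ) ≤ D := by rcases hD with rfl | rfl <;> norm_num
  have hq : Real.sqrt D ≠ 0 := (Real.sqrt_pos.2 (by linarith)).ne'
  have ei : integers D = {w | ∃ a b : ℤ, w = a + b * ((1 + sqrtNeg D) / 2)} :=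
    if_neg (by rcases hD with rfl | rfl <;> norm_num)
  have ere : ∀ a b : ℤ, (z - (a + b * ((1 + sqrtNeg D) / 2))).re = z.re - a - b / 2 := by
    intro a b; simp [sqrtNeg]; ring
  have eim : ∀ a b : ℤ, (z - (a + b * ((1 + sqrtNeg D) / 2))).im / Real.sqrt D
      = z.im / Real.sqrt D - b / 2 := by
    intro a b; simp [sqrtNeg, sub_div]; field_simp
  have hm : ∀ b : ℤ, (D : ℝ) * (z.im / Real.sqrt D - b / 2)
      = D * (z.im / Real.sqrt D) - D * b / 2 := by intro b; ring
  rw [ei]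
  apply existsUnique_of_exists_of_unique
  · suffices h : ∃ a b : ℤ, z - (a + b * ((1 + sqrtNeg D) / 2)) ∈ strictDomain D by
      obtain ⟨a, b, h⟩ := h
      exact ⟨_, ⟨a, b, rfl⟩, h⟩
    simp only [mem_strictDomain_hex hD, ere, eim]
    generalize z.im / Real.sqrt D = s
    generalize z.re = x
    obtain ⟨b, hb⟩ : ∃ b : ℤ, b = ⌊2 * s + 1 / 2⌋ := ⟨_, rfl⟩
    obtain ⟨a, ha⟩ : ∃ a : ℤ, a = ⌊x - b / 2 + 1 / 2⌋ := ⟨_, rfl⟩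
    have f1 := Int.floor_le (x - b / 2 + 1 / 2)
    have f2 := Int.lt_floor_add_one (x - b / 2 + 1 / 2)
    have f3 := Int.floor_le (2 * s + 1 / 2)
    have f4 := Int.lt_floor_add_one (2 * s + 1 / 2)
    rw [← ha] at f1 f2
    rw [← hb] at f3 f4
    by_cases c1 : ((D : ℝ) + 1) / 4 ≤ D * (s - b / 2) + (x - a - b / 2)
    · refine ⟨a, b + 1, ?_⟩
      push_cast
      rcases hD with rfl | rfl <;> push_cast at * <;>
        refine ⟨⟨?_, ?_⟩, ⟨?_, ?_⟩, ?_, ?_⟩ <;> linarith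
    by_cases c2 : ((D : ℝ) + 1) / 4 < D * (s - b / 2) - (x - a - b / 2)
    · refine ⟨a - 1, b + 1, ?_⟩
      push_cast
      rcases hD with rfl | rfl <;> push_cast at * <;>
        refine ⟨⟨?_, ?_⟩, ⟨?_, ?_⟩, ?_, ?_⟩ <;> linarith
    by_cases c3 : D * (s - b / 2) + (x - a - b / 2) < -(((D : ℝ) + 1) / 4)
    · refine ⟨a, b - 1, ?_⟩
      push_cast
      rcases hD with rfl | rfl <;> push_cast at * <;>
        refine ⟨⟨?_, ?_⟩, ⟨?_, ?_⟩, ?_, ?_⟩ <;> linarith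
    by_cases c4 : D * (s - b / 2) - (x - a - b / 2) ≤ -(((D : ℝ) + 1) / 4)
    · refine ⟨a + 1, b - 1, ?_⟩
      push_cast
      rcases hD with rfl | rfl <;> push_cast at * <;>
        refine ⟨⟨?_, ?_⟩, ⟨?_, ?_⟩, ?_, ?_⟩ <;> linarith
    · refine ⟨a, b, ?_⟩
      rcases hD with rfl | rfl <;> push_cast at * <;>
        refine ⟨⟨?_, ?_⟩, ⟨?_, ?_⟩, ?_, ?_⟩ <;> linarith
  · rintro _ _ ⟨⟨a, b, rfl⟩, h⟩ ⟨⟨a', b', rfl⟩, h'⟩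
    simp only [mem_strictDomain_hex hD, ere, eim] at h h'
    generalize z.im / Real.sqrt D = s at h h'
    generalize z.re = x at h h'
    obtain ⟨⟨p1, p2⟩, ⟨p3, p4⟩, p5, p6⟩ := h
    obtain ⟨⟨q1, q2⟩, ⟨q3, q4⟩, q5, q6⟩ := h'
    have b1 : b - b' < 2 := by
      have : ((b - b' : ℤ) : ℝ) < 2 := by
        push_cast
        rcases hD with rfl | rfl <;> push_cast at * <;> linarith
      exact_mod_cast this
    have b2 : -2 < b - b' := by
      have : (-2 : ℝ) < ((b - b' : ℤ) : ℝ) := by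
        push_cast
        rcases hD with rfl | rfl <;> push_cast at * <;> linarith
      exact_mod_cast this
    have c1 : 2 * (a - a') + (b - b') < 2 := by
      have : ((2 * (a - a') + (b - b') : ℤ) : ℝ) < 2 := by push_cast; linarith
      exact_mod_cast this
    have c2 : -2 < 2 * (a - a') + (b - b') := by
      have : (-2 : ℝ) < ((2 * (a - a') + (b - b') : ℤ) : ℝ) := by push_cast; linarith
      exact_mod_cast this
    obtain ⟨m, rfl⟩ : ∃ m, b = b' + m := ⟨b - b', by ring⟩
    obtain ⟨n, rfl⟩ : ∃ n, a = a' + n := ⟨a - a', by ring⟩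
    have hcase : (m = 0 ∧ n = 0) ∨ (m = 1 ∧ n = 0) ∨ (m = 1 ∧ n = -1) ∨
        (m = -1 ∧ n = 0) ∨ (m = -1 ∧ n = 1) := by omega
    rcases hcase with ⟨rfl, rfl⟩ | ⟨rfl, rfl⟩ | ⟨rfl, rfl⟩ | ⟨rfl, rfl⟩ | ⟨rfl, rfl⟩
    · simp
    all_goals
      exfalso
      rcases hD with rfl | rfl <;> push_cast at * <;> linarith

/-- Every complex number has exactly one integer part. -/
theorem existsUnique_intPart {D : ℕ} (hD : D = 2 ∨ D = 7 ∨ D = 11) (z : ℂ) :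
    ∃! a : ℂ, a ∈ integers D ∧ z - a ∈ strictDomain D := by
  rcases hD with rfl | hD
  · exact existsUnique_intPart_two z
  · exact existsUnique_intPart_hex hD z

/-- The defining property of the integer part. -/
theorem intPart_spec {D : ℕ} (hD : D = 2 ∨ D = 7 ∨ D = 11) (z : ℂ) :
    intPart D z ∈ integers D ∧ z - intPart D z ∈ strictDomain D :=
  Classical.epsilon_spec (existsUnique_intPart hD z).exists

end Hurwitz

end

/-! The inverse branches of `hurwitzMap` are z ↦ 1/(z+a) with a in the ring of integers, and they
contract because |y|² ≤ 9/11 on the domain. Many of them leave the domain in part, but only finitely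
many shapes occur. The circles and lines with integral coefficients and discriminant between 1 and 3
that meet the domain are finite in number, and their pullbacks by the branches that meet the domain
are again among them. They cut the domain into finitely many cells; on each cell a branch is defined
everywhere or nowhere, and it respects cells (`inverse_branch_mem`, `inverse_branch_sameCell`).

The transfer operator maps the cone of functions that are log-Lipschitz on cells strictly into
itself (`InCone.transfer`). Every open set eventually covers the domain (`covers_of_isOpen`); this
is the Euclidean algorithm run on a rational point of the set. Both facts give a Doeblin bound,
exponential convergence to a fixed density f bounded below (`exists_invariant_density`,
`exists_lower_bound`), and, by L¹ approximation, uniqueness of the invariant measure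
(`eq_densityMeasure`).

For the asymptotics, f is even and Ψ is odd almost everywhere, so the integral equals −∫(1 − cos
tΨ). Here Ψ = φ − φ∘𝒢, where φ is a multiple of the imaginary part of the first digit. The second
moment of φ diverges logarithmically, but φ·φ∘𝒢 is integrable with room to spare, so ∫(1 − cos tΨ)
is 2∫(1 − cos tφ) up to a t² term and O(|t|^{5/2}) (`exists_expansion_period`). In the same way the
digit may be replaced by 1/z, as the difference is bounded.

Near 0 the density is a function of the direction up to O(|z|), outside thin regions along the
tangent lines of the circles through 0. This error is integrable against |z|^{-5/2} and contributes
only to t² (`integrable_density_error`). For a directional density, polar coordinates lead to ∫ r(1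
− cos(τ/r)) dr = −½τ² log τ + cτ² + O(τ^{5/2}), the source of the logarithm
(`exists_directional_expansion`). Positivity of C comes from the lower bound for f. -/

noncomputable section

namespace Hurwitz

open scoped ComplexConjugate ENNReal

/-! ### The ring of integers as a lattice, and its fundamental domain. -/

section Lattice

variable {D : ℕ}

/-- A generator of the ring of integers over `ℤ`. -/
def generator (D : ℕ) : ℂ := if D = 2 then sqrtNeg D else (1 + sqrtNeg D) / 2

lemma sqrtNeg_sq (D : ℕ) : sqrtNeg D * sqrtNeg D = -D := by
  have h : ((Real.sqrt D : ℝ) : ℂ) * (Real.sqrt D : ℝ) = D := by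
    rw [← ofReal_mul, Real.mul_self_sqrt (Nat.cast_nonneg D)]; simp
  unfold sqrtNeg
  linear_combination I * I * h + (D : ℂ) * I_mul_I

lemma mem_integers_iff {w : ℂ} : w ∈ integers D ↔ ∃ a b : ℤ, w = a + b * generator D := by
  unfold integers generator
  split_ifs <;> rfl

/-- The lattice vectors whose bisectors bound the fundamental domain. -/
def faces (D : ℕ) : Set ℂ := {α | α ∈ shifts D ∨ -α ∈ shifts D}

lemma neg_mem_faces {α : ℂ} (h : α ∈ faces D) : -α ∈ faces D := by
  rcases h with h | h
  · right; simpa using h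
  · left; exact h

lemma finite_faces : (faces D).Finite := by
  have h : (shifts D).Finite := by unfold shifts; split_ifs <;> exact Set.toFinite _
  exact h.union (h.preimage neg_injective.injOn)

lemma strictDomain_subset_domain {z : ℂ} (h : z ∈ strictDomain D) : z ∈ domain D :=
  ((mem_strictDomain z).1 h).1

lemma generator_mul_self [hD : Fact (D = 2 ∨ D = 7 ∨ D = 11)] :
    ∃ t n : ℤ, 1 ≤ n ∧ generator D * generator D = t * generator D - n ∧
      normSq (generator D) = n ∧ 2 * (generator D).re = t ∧ 0 < (generator D).im := by
  have hs := sqrtNeg_sq D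
  have hD0 : (0 : ℝ) < D := by rcases hD.out with rfl | rfl | rfl <;> norm_num
  have hq : Real.sqrt D * Real.sqrt D = D := Real.mul_self_sqrt hD0.le
  have hq0 : 0 < Real.sqrt D := Real.sqrt_pos.2 hD0
  rcases hD.out with rfl | rfl | rfl
  · refine ⟨0, 2, by norm_num, ?_, ?_, ?_, ?_⟩
    · simp only [generator, if_true]; rw [hs]; simp
    · simp [generator, normSq_apply, sqrtNeg]
    · simp [generator, sqrtNeg]
    · simp [generator, sqrtNeg]
  · refine ⟨1, 2, by norm_num, ?_, ?_, ?_, ?_⟩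
    · simp only [generator]; norm_num; linear_combination hs / 4
    · simp [generator, normSq_apply, sqrtNeg]; norm_num at hq; linarith
    · simp [generator, sqrtNeg]
    · simp [generator, sqrtNeg]
  · refine ⟨1, 3, by norm_num, ?_, ?_, ?_, ?_⟩
    · simp only [generator]; norm_num; linear_combination hs / 4
    · simp [generator, normSq_apply, sqrtNeg]; norm_num at hq; linarith
    · simp [generator, sqrtNeg]
    · simp [generator, sqrtNeg]

variable [hD : Fact (D = 2 ∨ D = 7 ∨ D = 11)]

/-- The ring of integers as a subring of `ℂ`. -/
def intRing (D : ℕ) [hD : Fact (D = 2 ∨ D = 7 ∨ D = 11)] : Subring ℂ where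
  carrier := integers D
  mul_mem' := by
    intro x y hx hy
    obtain ⟨t, n, -, h, -⟩ := generator_mul_self (D := D)
    obtain ⟨a, b, rfl⟩ := mem_integers_iff.1 hx
    obtain ⟨c, d, rfl⟩ := mem_integers_iff.1 hy
    refine mem_integers_iff.2 ⟨a * c - b * d * n, a * d + b * c + b * d * t, ?_⟩
    push_cast
    linear_combination (b : ℂ) * d * h
  one_mem' := mem_integers_iff.2 ⟨1, 0, by simp⟩
  add_mem' := by
    intro x y hx hy
    obtain ⟨a, b, rfl⟩ := mem_integers_iff.1 hx
    obtain ⟨c, d, rfl⟩ := mem_integers_iff.1 hy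
    exact mem_integers_iff.2 ⟨a + c, b + d, by push_cast; ring⟩
  zero_mem' := mem_integers_iff.2 ⟨0, 0, by simp⟩
  neg_mem' := by
    intro x hx
    obtain ⟨a, b, rfl⟩ := mem_integers_iff.1 hx
    exact mem_integers_iff.2 ⟨-a, -b, by push_cast; ring⟩

lemma mem_intRing {w : ℂ} : w ∈ intRing D ↔ ∃ a b : ℤ, w = a + b * generator D :=
  mem_integers_iff

lemma intRing_tr {w : ℂ} (hw : w ∈ intRing D) : ∃ k : ℤ, 2 * w.re = k := by
  obtain ⟨t, n, -, -, -, h, -⟩ := generator_mul_self (D := D)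
  obtain ⟨a, b, rfl⟩ := mem_intRing.1 hw
  refine ⟨2 * a + b * t, ?_⟩
  push_cast
  rw [← h]
  simp
  ring

lemma intRing_normSq {w : ℂ} (hw : w ∈ intRing D) : ∃ k : ℕ, normSq w = k := by
  obtain ⟨t, n, -, -, h1, h, -⟩ := generator_mul_self (D := D)
  obtain ⟨a, b, rfl⟩ := mem_intRing.1 hw
  have e : normSq (a + b * generator D) = ((a * a + a * b * t + b * b * n : ℤ) : ℝ) := by
    push_cast
    rw [← h, ← h1, normSq_apply, normSq_apply]
    simp
    ring
  have h0 : (0 : ℤ) ≤ a * a + a * b * t + b * b * n := by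
    have := normSq_nonneg (a + b * generator D)
    rw [e] at this
    exact_mod_cast this
  refine ⟨(a * a + a * b * t + b * b * n).toNat, ?_⟩
  rw [e]
  exact_mod_cast (Int.toNat_of_nonneg h0).symm

lemma conj_mem_intRing {w : ℂ} (hw : w ∈ intRing D) : conj w ∈ intRing D := by
  obtain ⟨k, hk⟩ := intRing_tr hw
  have : conj w = k - w := by
    apply Complex.ext <;> simp
    linarith
  rw [this]
  exact sub_mem (intCast_mem _ k) hw

lemma one_le_norm_of_mem_intRing {w : ℂ} (hw : w ∈ intRing D) (h0 : w ≠ 0) : 1 ≤ ‖w‖ := by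
  obtain ⟨k, hk⟩ := intRing_normSq hw
  have h1 : 0 < normSq w := normSq_pos.2 h0
  rw [hk] at h1
  have h2 : (1 : ℝ) ≤ k := by exact_mod_cast (Nat.cast_pos.1 h1)
  rw [normSq_eq_norm_sq] at hk
  by_contra h
  have := norm_nonneg w
  nlinarith

/-- Integer coordinates on the ring of integers. -/
def intRingEquiv (D : ℕ) [hD : Fact (D = 2 ∨ D = 7 ∨ D = 11)] : ℤ × ℤ ≃ intRing D :=
  Equiv.ofBijective (fun p => ⟨p.1 + p.2 * generator D, mem_intRing.2 ⟨_, _, rfl⟩⟩) <| by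
    obtain ⟨t, n, -, -, h1, h, him⟩ := generator_mul_self (D := D)
    constructor
    · rintro ⟨a, b⟩ ⟨c, d⟩ hab
      have h := congrArg Subtype.val hab
      simp only at h
      have hi := congrArg Complex.im h
      have hr := congrArg Complex.re h
      simp at hi hr
      rcases hi with rfl | hi
      · simpa using hr
      · exact absurd hi him.ne'
    · rintro ⟨w, hw⟩
      obtain ⟨a, b, rfl⟩ := mem_intRing.1 hw
      exact ⟨(a, b), rfl⟩

instance : Countable (intRing D) := (intRingEquiv D).symm.injective.countable

/-- This linear comparison reduces sums over the ring to the Eisenstein-type sums over pairs of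
integers. -/
lemma exists_coord_bound : ∃ c : ℝ, 0 < c ∧ ∀ p : ℤ × ℤ,
    ‖![p.1, p.2]‖ ≤ c * ‖(intRingEquiv D p : ℂ)‖ := by
  obtain ⟨t, n, -, -, h1, h, him⟩ := generator_mul_self (D := D)
  set g := generator D
  refine ⟨1 + (1 + |g.re|) / g.im, by positivity, fun p => ?_⟩
  have hval : (intRingEquiv D p : ℂ) = p.1 + p.2 * g := rfl
  rw [hval]
  set w : ℂ := p.1 + p.2 * g with hw
  have hb : |(p.2 : ℝ)| * g.im ≤ ‖w‖ := by
    have := abs_im_le_norm w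
    rwa [hw, show ((p.1 : ℂ) + p.2 * g).im = p.2 * g.im by simp, abs_mul, abs_of_pos him,
      ← hw] at this
  have hb' : |(p.2 : ℝ)| ≤ ‖w‖ / g.im := (le_div_iff₀ him).2 hb
  have ha : |(p.1 : ℝ)| ≤ ‖w‖ + |(p.2 : ℝ)| * |g.re| := by
    have h1 := abs_re_le_norm w
    have h2 : (p.1 : ℝ) = w.re - p.2 * g.re := by simp [hw]
    rw [h2, ← abs_mul]
    exact (abs_sub _ _).trans (by gcongr)
  have h0 := norm_nonneg w
  have hg : 0 ≤ |g.re| := abs_nonneg _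
  have h3 : |(p.2 : ℝ)| * |g.re| ≤ ‖w‖ / g.im * |g.re| := by gcongr
  have e : (1 + (1 + |g.re|) / g.im) * ‖w‖ = ‖w‖ + ‖w‖ / g.im + ‖w‖ / g.im * |g.re| := by
    field_simp
    ring
  have h4 : 0 ≤ ‖w‖ / g.im := by positivity
  have h5 : 0 ≤ ‖w‖ / g.im * |g.re| := by positivity
  have hnn : 0 ≤ (1 + (1 + |g.re|) / g.im) * ‖w‖ := by rw [e]; linarith
  refine (pi_norm_le_iff_of_nonneg hnn).2 fun i => ?_
  fin_cases i <;> simp [Int.norm_eq_abs] <;> rw [e] <;> linarith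

lemma summable_intRing_rpow {r : ℝ} (hr : 2 < r) :
    Summable fun a : intRing D => ‖(a : ℂ)‖ ^ (-r) := by
  rw [← (intRingEquiv D).summable_iff]
  obtain ⟨c, hc, h⟩ := exists_coord_bound (D := D)
  have hs := EisensteinSeries.summable_one_div_norm_rpow hr
  have hs' := (finTwoArrowEquiv ℤ).symm.summable_iff.2 hs
  refine Summable.of_nonneg_of_le (fun p => Real.rpow_nonneg (norm_nonneg _) _) (fun p => ?_) (hs'.mul_left (c ^ r))
  have hp := h p
  simp only [Function.comp_apply, finTwoArrowEquiv_symm_apply]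
  rcases eq_or_ne p 0 with rfl | hp0
  · have : (intRingEquiv D 0 : ℂ) = 0 := by simp [intRingEquiv]
    -- The term of the zero element is harmless: `0 ^ (-r)` is 0 by convention.
    rw [this, norm_zero, Real.zero_rpow (by linarith)]
    positivity
  have hpos : 0 < ‖![p.1, p.2]‖ := by
    rw [norm_pos_iff]
    intro h0
    apply hp0
    have h1 := congrFun h0 0
    have h2 := congrFun h0 1
    simp at h1 h2
    exact Prod.ext h1 h2
  have hw : 0 < ‖(intRingEquiv D p : ℂ)‖ := by
    by_contra hn
    have := mul_nonpos_of_nonneg_of_nonpos hc.le (not_lt.1 hn)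
    linarith
  rw [Real.rpow_neg hw.le, Real.rpow_neg hpos.le, ← div_eq_mul_inv,
    le_div_iff₀ (Real.rpow_pos_of_pos hpos r), inv_mul_le_iff₀ (Real.rpow_pos_of_pos hw r),
    ← Real.mul_rpow hw.le hc.le]
  refine Real.rpow_le_rpow hpos.le ?_ (by linarith)
  linarith

/-- The terms of the convergent series of ‖a‖⁻³ tend to 0 along the cofinite filter, so only
finitely many exceed a given positive level. -/
lemma finite_intRing_norm_le (r : ℝ) : {a : ℂ | a ∈ intRing D ∧ ‖a‖ ≤ r}.Finite := by
  have hs := (summable_intRing_rpow (D := D) (r := 3) (by norm_num)).tendsto_cofinite_zero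
  have hr : (0 : ℝ) < (|r| + 1) ^ (-3 : ℝ) := by positivity
  have hf := hs.eventually (gt_mem_nhds hr)
  rw [Filter.eventually_cofinite] at hf
  refine ((hf.image Subtype.val).union (Set.finite_singleton 0)).subset ?_
  rintro a ⟨ha, har⟩
  by_cases h0 : a = 0
  · right; exact h0
  · left
    refine ⟨⟨a, ha⟩, ?_, rfl⟩
    simp only [Set.mem_ofPred_eq, not_lt]
    exact Real.rpow_le_rpow_of_nonpos (norm_pos_iff.2 h0)
      (har.trans (by linarith [le_abs_self r])) (by norm_num)

lemma faces_subset {α : ℂ} (h : α ∈ faces D) : α ∈ intRing D := by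
  suffices H : ∀ α ∈ shifts D, α ∈ intRing D by
    rcases h with h | h
    · exact H _ h
    · simpa using neg_mem (H _ h)
  intro α hα
  rcases hD.out with rfl | hD'
  · rw [shifts, if_pos rfl] at hα
    rcases hα with rfl | rfl
    · exact one_mem _
    · exact mem_intRing.2 ⟨0, 1, by simp [generator]⟩
  · have h2 : D ≠ 2 := by rcases hD' with rfl | rfl <;> norm_num
    rw [shifts, if_neg h2] at hα
    rcases hα with rfl | rfl | rfl
    · exact one_mem _
    · exact mem_intRing.2 ⟨0, 1, by simp [generator, h2]⟩
    · exact mem_intRing.2 ⟨1, -1, by simp [generator, h2]; ring⟩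

lemma faces_normSq {α : ℂ} (h : α ∈ faces D) :
    ∃ n : ℕ, normSq α = n ∧ 1 ≤ n ∧ n ≤ 3 := by
  suffices H : ∀ α ∈ shifts D, ∃ n : ℕ, normSq α = n ∧ 1 ≤ n ∧ n ≤ 3 by
    rcases h with h | h
    · exact H _ h
    · simpa using H _ h
  intro α hα
  rcases hD.out with rfl | rfl | rfl <;> simp only [shifts] at hα <;> norm_num at hα
  · rcases hα with rfl | rfl
    · exact ⟨1, by simp, by norm_num⟩
    · exact ⟨2, by simp [sqrtNeg], by norm_num⟩
  · have h7 : Real.sqrt 7 * Real.sqrt 7 = 7 := Real.mul_self_sqrt (by norm_num)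
    rcases hα with rfl | rfl | rfl
    · exact ⟨1, by simp, by norm_num⟩
    · exact ⟨2, by simp [sqrtNeg, normSq_apply]; linarith, by norm_num⟩
    · exact ⟨2, by simp [sqrtNeg, normSq_apply]; linarith, by norm_num⟩
  · have h7 : Real.sqrt 11 * Real.sqrt 11 = 11 := Real.mul_self_sqrt (by norm_num)
    rcases hα with rfl | rfl | rfl
    · exact ⟨1, by simp, by norm_num⟩
    · exact ⟨3, by simp [sqrtNeg, normSq_apply]; linarith, by norm_num⟩
    · exact ⟨3, by simp [sqrtNeg, normSq_apply]; linarith, by norm_num⟩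

/-- Each inequality says that z is no farther from 0 than from α, so the domain is a Dirichlet cell
of the lattice. This description covers the rectangle and the hexagons at once. -/
lemma mem_domain_iff {z : ℂ} :
    z ∈ domain D ↔ ∀ α ∈ faces D, 2 * (conj α * z).re ≤ normSq α := by
  have key : (∀ α ∈ faces D, 2 * (conj α * z).re ≤ normSq α) ↔
      ∀ α ∈ shifts D, |2 * (conj α * z).re| ≤ normSq α := by
    constructor
    · intro h α hα
      rw [abs_le']
      refine ⟨h α (Or.inl hα), ?_⟩
      have := h (-α) (Or.inr (by simpa using hα))
      rw [map_neg, neg_mul, neg_re, normSq_neg] at this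
      linarith
    · rintro h α (hα | hα)
      · exact (le_abs_self _).trans (h α hα)
      · have := (neg_le_abs _).trans (h _ hα)
        rw [map_neg, neg_mul, neg_re, normSq_neg] at this
        linarith
  have hD0 : (0 : ℝ) < D := by rcases hD.out with rfl | rfl | rfl <;> norm_num
  have hq : Real.sqrt D * Real.sqrt D = D := Real.mul_self_sqrt hD0.le
  have hq0 : 0 < Real.sqrt D := Real.sqrt_pos.2 hD0
  obtain ⟨s, hs⟩ : ∃ s, z.im / Real.sqrt D = s := ⟨_, rfl⟩
  have hs' : z.im = s * Real.sqrt D := by rw [← hs]; field_simp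
  have e1 : (2 * (conj (1 : ℂ) * z).re) = 2 * z.re := by simp
  rw [key]
  rcases hD.out with rfl | hD'
  · have es : shifts 2 = {1, sqrtNeg 2} := if_pos rfl
    have e2 : 2 * (conj (sqrtNeg 2) * z).re = 4 * s := by
      push_cast at hs' hq
      simp [sqrtNeg, hs']; linear_combination 2 * s * hq
    rw [es, mem_domain_two]
    push_cast at hs
    rw [hs]
    simp only [Set.mem_insert_iff, Set.mem_singleton_iff, forall_eq_or_imp, forall_eq, e1, e2]
    have n2 : normSq (sqrtNeg 2) = 2 := by simp [sqrtNeg]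
    rw [n2, normSq_one]
    simp only [abs_le]
    constructor
    · rintro ⟨⟨a, b⟩, c, d⟩
      exact ⟨⟨by linarith, by linarith⟩, by linarith, by linarith⟩
    · rintro ⟨⟨a, b⟩, c, d⟩
      exact ⟨⟨by linarith, by linarith⟩, by linarith, by linarith⟩
  · have es : shifts D = {1, (1 + sqrtNeg D) / 2, (1 - sqrtNeg D) / 2} :=
      if_neg (by rcases hD' with rfl | rfl <;> norm_num)
    have e2 : 2 * (conj ((1 + sqrtNeg D) / 2) * z).re = D * s + z.re := by
      have c2 : conj ((1 + sqrtNeg D) / 2) = (1 - sqrtNeg D) / 2 := by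
        rw [map_div₀, Complex.conj_ofNat]; simp [sqrtNeg, sub_eq_add_neg]
      rw [c2]
      simp [sqrtNeg, hs']; linear_combination s * hq
    have e3 : 2 * (conj ((1 - sqrtNeg D) / 2) * z).re = -(D * s - z.re) := by
      have c2 : conj ((1 - sqrtNeg D) / 2) = (1 + sqrtNeg D) / 2 := by
        rw [map_div₀, Complex.conj_ofNat]; simp [sqrtNeg, sub_eq_add_neg]
      rw [c2]
      simp [sqrtNeg, hs']; linear_combination -s * hq
    have n2 : normSq ((1 + sqrtNeg D) / 2) = (D + 1) / 4 := by
      simp [sqrtNeg, normSq_apply]; linarith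
    have n3 : normSq ((1 - sqrtNeg D) / 2) = (D + 1) / 4 := by
      simp [sqrtNeg, normSq_apply]; linarith
    rw [es, mem_domain_hex hD', hs]
    simp only [Set.mem_insert_iff, Set.mem_singleton_iff, forall_eq_or_imp, forall_eq, e2, e3,
      n2, n3, abs_neg, e1, normSq_one]
    have : |2 * z.re| ≤ 1 ↔ |z.re| ≤ 1 / 2 := by
      rw [abs_mul, abs_two]; constructor <;> intro <;> linarith
    rw [this]

/-- The worst case is the vertex 3i/√11 for D = 11; the maxima for D = 2 and D = 7 are 3/4 and 4/7.
The constants 20, 40 and 44 below are adapted to the ratio 9/11. -/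
lemma normSq_le_of_mem_domain {z : ℂ} (hz : z ∈ domain D) : normSq z ≤ 9 / 11 := by
  have hD0 : (0 : ℝ) < D := by rcases hD.out with rfl | rfl | rfl <;> norm_num
  have hq : Real.sqrt D * Real.sqrt D = D := Real.mul_self_sqrt hD0.le
  have hq0 : 0 < Real.sqrt D := Real.sqrt_pos.2 hD0
  obtain ⟨s, hs⟩ : ∃ s, z.im / Real.sqrt D = s := ⟨_, rfl⟩
  have hs' : z.im = s * Real.sqrt D := by rw [← hs]; field_simp
  have e : normSq z = z.re * z.re + D * (s * s) := by
    rw [normSq_apply, hs']; linear_combination s * s * hq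
  rw [e]
  rcases hD.out with rfl | hD'
  · rw [mem_domain_two] at hz
    push_cast at hs
    rw [hs] at hz
    obtain ⟨h1, h2⟩ := hz
    have := abs_le.1 h1
    have := abs_le.1 h2
    push_cast
    nlinarith
  · rw [mem_domain_hex hD', hs] at hz
    obtain ⟨h1, h2, h3⟩ := hz
    have k1 : |z.re| * |z.re| = z.re * z.re := abs_mul_abs_self _
    have k2 : |s| * |s| = s * s := abs_mul_abs_self _
    have k3 : (D : ℝ) * |s| + |z.re| ≤ (D + 1) / 4 := by
      have := abs_le.1 h2
      have := abs_le.1 h3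
      rcases abs_cases s with ⟨a, -⟩ | ⟨a, -⟩ <;> rcases abs_cases z.re with ⟨b, -⟩ | ⟨b, -⟩ <;>
        rw [a, b] <;> linarith
    rw [← k1, ← k2]
    have p1 := abs_nonneg s
    have p2 := abs_nonneg z.re
    generalize |s| = u at *
    generalize |z.re| = x at *
    rcases hD' with rfl | rfl <;> push_cast at * <;> nlinarith

lemma mem_strictDomain_of_lt {z : ℂ} (h : ∀ α ∈ faces D, 2 * (conj α * z).re < normSq α) :
    z ∈ strictDomain D := by
  refine (mem_strictDomain z).2 ⟨mem_domain_iff.2 fun α hα => (h α hα).le, fun α hα hz => ?_⟩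
  have h1 := h α (Or.inl hα)
  have h2 := mem_domain_iff.1 hz (-α) (Or.inr (by simpa using hα))
  have h3 : (conj (-α) * (z - α)).re = -(conj α * z).re + normSq α := by
    simp [normSq_apply]; ring
  rw [h3, normSq_neg] at h2
  linarith

lemma isClosed_domain : IsClosed (domain D) := by
  have : domain D = ⋂ α ∈ faces D, {z | 2 * (conj α * z).re ≤ normSq α} := by
    ext z; simp [mem_domain_iff]
  rw [this]
  exact isClosed_biInter fun α _ => isClosed_le (by fun_prop) (by fun_prop)

lemma convex_domain : Convex ℝ (domain D) := by
  intro x hx y hy a b ha hb hab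
  rw [mem_domain_iff] at *
  intro α hα
  have h1 := hx α hα
  have h2 := hy α hα
  have e : (conj α * (a • x + b • y)).re = a * (conj α * x).re + b * (conj α * y).re := by
    simp; ring
  rw [e]
  have : normSq α = a * normSq α + b * normSq α := by rw [← add_mul, hab, one_mul]
  rw [this]
  nlinarith

lemma neg_mem_domain {z : ℂ} (hz : z ∈ domain D) : -z ∈ domain D := by
  rw [mem_domain_iff] at *
  intro α hα
  have := hz _ (neg_mem_faces hα)
  simpa using this

lemma norm_le_of_mem_domain {z : ℂ} (hz : z ∈ domain D) : ‖z‖ ≤ 10 / 11 := by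
  have h := normSq_le_of_mem_domain hz
  rw [normSq_eq_norm_sq] at h
  nlinarith [norm_nonneg z]

lemma intPart_mem (z : ℂ) : intPart D z ∈ intRing D := (intPart_spec hD.out z).1

lemma sub_intPart_mem (z : ℂ) : z - intPart D z ∈ strictDomain D := (intPart_spec hD.out z).2

lemma intPart_eq {z a : ℂ} (ha : a ∈ intRing D) (h : z - a ∈ strictDomain D) :
    intPart D z = a :=
  (existsUnique_intPart hD.out z).unique (intPart_spec hD.out z) ⟨ha, h⟩

end Lattice

/-! ### The finite family of circles and lines, and the cells that they cut out. -/

section Cells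

variable {D : ℕ}

/-- The Hermitian form `A|z|² + 2 Re(Bz) + C`, whose zero set is a circle or a line. -/
def form (c : ℤ × ℂ × ℤ) (z : ℂ) : ℝ := c.1 * normSq z + 2 * (c.2.1 * z).re + c.2.2

/-- The integral forms of discriminant at most `3` with leading coefficient at most `20`. -/
def boundedForms (D : ℕ) : Set (ℤ × ℂ × ℤ) :=
  {c | c.2.1 ∈ integers D ∧ 1 ≤ normSq c.2.1 - c.1 * c.2.2 ∧ normSq c.2.1 - c.1 * c.2.2 ≤ 3 ∧
    |(c.1 : ℝ)| ≤ 20}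

/-- The bounded forms whose zero set meets the fundamental domain. -/
def forms (D : ℕ) : Set (ℤ × ℂ × ℤ) := {c | c ∈ boundedForms D ∧ ∃ z ∈ domain D, form c z = 0}

/-- The points of the fundamental domain that avoid all zero sets of forms. -/
def regular (D : ℕ) : Set ℂ := {z | z ∈ domain D ∧ ∀ c ∈ forms D, form c z ≠ 0}

/-- Two points are in the same cell if no form separates them. -/
def SameCell (D : ℕ) (z z' : ℂ) : Prop := ∀ c ∈ forms D, 0 < form c z ↔ 0 < form c z'

/-- The pullback of a form under `z ↦ 1 / (z + a)`. -/
def pullback (c : ℤ × ℂ × ℤ) (a : ℂ) : ℂ := c.2.2 * conj a + conj c.2.1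

lemma continuous_form (c : ℤ × ℂ × ℤ) : Continuous (form c) := by
  unfold form
  exact ((continuous_const.mul continuous_normSq).add (by fun_prop)).add continuous_const

lemma SameCell.refl (z : ℂ) : SameCell D z z := fun _ _ => Iff.rfl

lemma SameCell.symm {z z' : ℂ} (h : SameCell D z z') : SameCell D z' z :=
  fun c hc => (h c hc).symm

lemma SameCell.trans {z z' z'' : ℂ} (h : SameCell D z z') (h' : SameCell D z' z'') :
    SameCell D z z'' :=
  fun c hc => (h c hc).trans (h' c hc)

lemma regular_subset {z : ℂ} (hz : z ∈ regular D) : z ∈ domain D := hz.1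

lemma volume_form_zero {c : ℤ × ℂ × ℤ} (h : 1 ≤ normSq c.2.1 - c.1 * c.2.2) :
    volume {z | form c z = 0} = 0 := by
  obtain ⟨A, B, C⟩ := c
  simp only [form] at *
  by_cases hA : A = 0
  · subst hA
    have hB : B ≠ 0 := by rintro rfl; norm_num at h
    let s : AffineSubspace ℝ ℂ :=
      { carrier := {z | ((0 : ℤ) : ℝ) * normSq z + 2 * (B * z).re + C = 0}
        smul_vsub_vadd_mem' := by
          intro k x y z hx hy hz
          simp at *
          linear_combination k * hx - k * hy + hz }
    have hs : s ≠ ⊤ := by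
      intro hs
      -- The form takes the value 2 at this point, so its zero set is not the whole plane.
      have h1 : ((1 - (C : ℝ) / 2 : ℝ) : ℂ) / B ∈ s := by rw [hs]; trivial
      have h2 : ((0 : ℤ) : ℝ) * normSq (((1 - (C : ℝ) / 2 : ℝ) : ℂ) / B)
        + 2 * (B * (((1 - (C : ℝ) / 2 : ℝ) : ℂ) / B)).re + C = 0 := h1
      rw [mul_div_cancel₀ _ hB, ofReal_re] at h2
      simp at h2
      linarith
    exact Measure.addHaar_affineSubspace volume s hs
  · refine measure_mono_null ?_ (Measure.addHaar_sphere volume (-conj B / A : ℂ)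
      (Real.sqrt ((normSq B - A * C) / A ^ 2)))
    intro z hz
    have hz : A * normSq z + 2 * (B * z).re + C = 0 := hz
    have hA' : (A : ℝ) ≠ 0 := by exact_mod_cast hA
    rw [mem_sphere_iff_norm, eq_comm, Real.sqrt_eq_iff_mul_self_eq _ (norm_nonneg _),
      Complex.norm_mul_self_eq_normSq]
    · have e : z - -conj B / (A : ℂ) = (A * z + conj B) / A := by
        have : (A : ℂ) ≠ 0 := by exact_mod_cast hA
        field_simp; ring
      rw [e, normSq_div, normSq_intCast, ← sq]
      congr 1
      simp [normSq_apply] at *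
      linear_combination -(A : ℝ) * hz
    · exact div_nonneg (by linarith) (by positivity)

/-- Multiplication by |z+a|² clears denominators. Inversion exchanges the outer coefficients, so the
old constant term becomes the leading coefficient. -/
lemma form_inv (c : ℤ × ℂ × ℤ) {z a : ℂ} (h : z + a ≠ 0) {k : ℤ}
    (hk : (k : ℝ) = c.2.2 * normSq a + 2 * (conj c.2.1 * a).re + c.1) :
    form c (z + a)⁻¹ = form (c.2.2, pullback c a, k) z / normSq (z + a) := by
  have h0 : normSq (z + a) ≠ 0 := by rwa [Ne, normSq_eq_zero]
  unfold form pullback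
  rw [eq_div_iff h0, normSq_inv]
  have e : (c.2.1 * (z + a)⁻¹).re * normSq (z + a) = (c.2.1 * conj (z + a)).re := by
    rw [Complex.inv_def, ← mul_assoc, re_mul_ofReal]
    field_simp
  simp only [hk]
  have e2 : (c.1 * (normSq (z + a))⁻¹ + 2 * (c.2.1 * (z + a)⁻¹).re + c.2.2) * normSq (z + a)
      = c.1 + 2 * (c.2.1 * conj (z + a)).re + c.2.2 * normSq (z + a) := by
    rw [← e]; field_simp
  rw [e2]
  simp [normSq_apply]
  ring

/-- The discriminant is minus the determinant of a Hermitian matrix, and z ↦ 1/(z+a) acts on such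
matrices through a matrix of determinant −1. -/
lemma disc_pullback (c : ℤ × ℂ × ℤ) {a : ℂ} {k : ℤ}
    (hk : (k : ℝ) = c.2.2 * normSq a + 2 * (conj c.2.1 * a).re + c.1) :
    normSq (pullback c a) - c.2.2 * k = normSq c.2.1 - c.1 * c.2.2 := by
  rw [hk]
  unfold pullback
  simp [normSq_apply]
  ring

variable [hD : Fact (D = 2 ∨ D = 7 ∨ D = 11)]

lemma exists_pullback_const {c : ℤ × ℂ × ℤ} (hc : c.2.1 ∈ integers D) {a : ℂ}
    (ha : a ∈ intRing D) :
    ∃ k : ℤ, (k : ℝ) = c.2.2 * normSq a + 2 * (conj c.2.1 * a).re + c.1 := by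
  obtain ⟨n, hn⟩ := intRing_normSq ha
  obtain ⟨l, hl⟩ := intRing_tr (mul_mem (conj_mem_intRing (D := D) hc) ha)
  exact ⟨c.2.2 * n + l + c.1, by push_cast; rw [hn, hl]⟩

/-- At a zero z of the form, β = B + A z̄ satisfies |β|² = |B|² − AC ≤ 3, and both B and C are
recovered from A, β and z. The threshold 20 reproduces itself: 20·9/11 + 2·1.6 < 20. Hence pulling
back, which makes C the leading coefficient, stays within `boundedForms`. -/
lemma abs_coeff_le {c : ℤ × ℂ × ℤ} (hc : c ∈ boundedForms D) {z : ℂ} (hz : z ∈ domain D)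
    (h0 : form c z = 0) : |(c.2.2 : ℝ)| ≤ 20 ∧ ‖c.2.1‖ ≤ 22 := by
  obtain ⟨A, B, C⟩ := c
  obtain ⟨-, -, h3, hA⟩ := hc
  simp only [form] at *
  set β : ℂ := B + A * conj z with hβ
  have hb : normSq β = normSq B - A * C := by
    simp [hβ, normSq_apply] at *
    linear_combination (A : ℝ) * h0
  have hC : (C : ℝ) = A * normSq z - 2 * (β * z).re := by
    simp [hβ, normSq_apply] at *
    linear_combination h0
  have hz1 := normSq_le_of_mem_domain hz
  have hz2 := norm_le_of_mem_domain hz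
  have hz3 := normSq_nonneg z
  have hb3 : ‖β‖ ^ 2 ≤ 3 := by rw [← normSq_eq_norm_sq, hb]; exact h3
  have hb0 := norm_nonneg β
  have hb2 : ‖β‖ ≤ 2 := by nlinarith
  -- √(3 · 9/11) < 1.6.
  have hβz : |(β * z).re| ≤ 1.6 := by
    refine (abs_re_le_norm _).trans ?_
    have : ‖β * z‖ ^ 2 ≤ 3 * (9 / 11) := by
      rw [norm_mul, mul_pow, ← normSq_eq_norm_sq z]
      gcongr
    nlinarith [norm_nonneg (β * z)]
  constructor
  · rw [hC]
    have : |A * normSq z| ≤ 20 * (9 / 11) := by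
      rw [abs_mul, abs_of_nonneg hz3]; gcongr
    calc |A * normSq z - 2 * (β * z).re| ≤ |A * normSq z| + |2 * (β * z).re| := abs_sub _ _
      _ ≤ 20 * (9 / 11) + 2 * 1.6 := by
        rw [abs_mul 2, abs_two]; gcongr
      _ ≤ 20 := by norm_num
  · have hB : B = β - A * conj z := by rw [hβ]; ring
    rw [hB]
    calc ‖β - A * conj z‖ ≤ ‖β‖ + ‖(A : ℂ) * conj z‖ := norm_sub_le _ _
      _ ≤ 2 + 20 * 1 := by
        rw [norm_mul, norm_conj, norm_intCast]
        gcongr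
        linarith
      _ = 22 := by norm_num

lemma finite_forms : (forms D).Finite := by
  have h20 : {k : ℤ | |(k : ℝ)| ≤ 20}.Finite := by
    refine (Set.finite_Icc (-20 : ℤ) 20).subset fun k hk => ?_
    have hk : |(k : ℝ)| ≤ 20 := hk
    rw [abs_le] at hk
    exact ⟨by exact_mod_cast hk.1, by exact_mod_cast hk.2⟩
  refine (h20.prod ((finite_intRing_norm_le (D := D) 22).prod h20)).subset ?_
  rintro c ⟨hc, z, hz, h0⟩
  obtain ⟨h1, h2⟩ := abs_coeff_le hc hz h0
  exact ⟨hc.2.2.2, ⟨hc.1, h2⟩, h1⟩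

/-- A bounded form outside `forms` has no zero on the convex domain, hence a constant sign there.
This is needed because the zero set of a pullback may miss the domain. -/
lemma pos_iff_of_sameCell {c : ℤ × ℂ × ℤ} (hc : c ∈ boundedForms D) {z z' : ℂ}
    (hz : z ∈ domain D) (hz' : z' ∈ domain D) (h : SameCell D z z') :
    0 < form c z ↔ 0 < form c z' := by
  by_cases hm : c ∈ forms D
  · exact h c hm
  have hne : ∀ x ∈ domain D, form c x ≠ 0 := fun x hx h0 => hm ⟨hc, x, hx, h0⟩
  have hcon : IsPreconnected (domain D) := convex_domain.isPreconnected
  have key : ∀ x ∈ domain D, ∀ y ∈ domain D, 0 < form c x → 0 < form c y := by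
    intro x hx y hy hpos
    by_contra hn
    obtain ⟨w, hw, hw0⟩ := hcon.intermediate_value hy hx (continuous_form c).continuousOn
      (Set.mem_Icc.2 ⟨not_lt.1 hn, hpos.le⟩)
    exact hne w hw hw0
  exact ⟨key z hz z' hz', key z' hz' z hz⟩

/-- The form bounding the half-plane that contains the fundamental domain. -/
lemma exists_face_form {α : ℂ} (hα : α ∈ faces D) :
    ∃ n : ℤ, (0, -conj α, n) ∈ boundedForms D ∧ |(n : ℝ)| ≤ 20 ∧
      ∀ z, form (0, -conj α, n) z = normSq α - 2 * (conj α * z).re := by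
  obtain ⟨n, hn, h1, h3⟩ := faces_normSq hα
  refine ⟨n, ⟨neg_mem (conj_mem_intRing (faces_subset hα)), ?_, ?_, ?_⟩, ?_, fun z => ?_⟩
  · simp [hn, h1]
  · simp [hn]; exact_mod_cast h3
  · simp
  · simp; exact_mod_cast h3.trans (by norm_num)
  · simp [form, hn]; ring

lemma lt_of_mem_regular {z : ℂ} (hz : z ∈ regular D) {α : ℂ} (hα : α ∈ faces D) :
    2 * (conj α * z).re < normSq α := by
  obtain ⟨n, hn, -, h⟩ := exists_face_form hα
  have h1 := mem_domain_iff.1 hz.1 α hα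
  refine lt_of_le_of_ne h1 fun he => ?_
  have h0 : form (0, -conj α, n) z = 0 := by rw [h, he, sub_self]
  exact hz.2 _ ⟨hn, z, hz.1, h0⟩ h0

lemma regular_subset_strictDomain {z : ℂ} (hz : z ∈ regular D) : z ∈ strictDomain D :=
  mem_strictDomain_of_lt fun _ hα => lt_of_mem_regular hz hα

/-- The line Re z = 0 through the origin belongs to the family, with discriminant 1. -/
lemma regular_ne_zero {z : ℂ} (hz : z ∈ regular D) : z ≠ 0 := by
  rintro rfl
  have h0 : form (0, 1, 0) 0 = 0 := by simp [form]
  refine hz.2 (0, 1, 0) ⟨⟨(one_mem (intRing D) : _), ?_, ?_, ?_⟩, 0, hz.1, h0⟩ h0 <;> norm_num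

lemma add_ne_zero_of_mem_regular {z a : ℂ} (hz : z ∈ regular D) (ha : a ∈ intRing D) :
    z + a ≠ 0 := by
  intro h
  have h1 : z ∈ intRing D := by
    rw [eq_neg_of_add_eq_zero_left h]; exact neg_mem ha
  have := one_le_norm_of_mem_intRing h1 (regular_ne_zero hz)
  have := norm_le_of_mem_domain hz.1
  linarith

lemma isOpen_regular : IsOpen (regular D) := by
  have : regular D = (⋂ α ∈ faces D, {z | 2 * (conj α * z).re < normSq α}) ∩
      ⋂ c ∈ forms D, {z | form c z ≠ 0} := by
    ext z
    simp only [Set.mem_inter_iff, Set.mem_iInter, Set.mem_ofPred_eq]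
    constructor
    · exact fun hz => ⟨fun α hα => lt_of_mem_regular hz hα, hz.2⟩
    · exact fun hz => ⟨mem_domain_iff.2 fun α hα => (hz.1 α hα).le, hz.2⟩
  rw [this]
  refine IsOpen.inter ?_ ?_
  · exact finite_faces.isOpen_biInter fun α _ => isOpen_lt (by fun_prop) (by fun_prop)
  · exact finite_forms.isOpen_biInter fun c _ =>
      isOpen_ne_fun (continuous_form c) continuous_const

lemma volume_domain_diff_regular : volume (domain D \ regular D) = 0 := by
  refine measure_mono_null (t := ⋃ c ∈ forms D, {z | form c z = 0}) ?_ ?_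
  · rintro z ⟨hz, hn⟩
    by_contra h
    simp only [Set.mem_iUnion, Set.mem_ofPred_eq, not_exists] at h
    exact hn ⟨hz, fun c hc => h c hc⟩
  · exact (measure_biUnion_null_iff finite_forms.countable).2 fun c hc =>
      volume_form_zero hc.1.2.1

lemma isOpen_cell (z : ℂ) : IsOpen {z' | z' ∈ regular D ∧ SameCell D z z'} := by
  have : {z' | z' ∈ regular D ∧ SameCell D z z'} = regular D ∩
      ⋂ c ∈ forms D, {z' | if 0 < form c z then 0 < form c z' else form c z' < 0} := by
    ext z'
    simp only [Set.mem_inter_iff, Set.mem_iInter, Set.mem_ofPred_eq]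
    refine and_congr_right fun hz' => forall₂_congr fun c hc => ?_
    have hne := hz'.2 c hc
    split_ifs with h
    · exact ⟨fun H => H.1 h, fun H => ⟨fun _ => H, fun _ => h⟩⟩
    · constructor
      · intro H
        exact lt_of_le_of_ne (not_lt.1 fun H' => h (H.2 H')) hne
      · intro H
        exact ⟨fun H' => absurd H' h, fun H' => absurd H' H.not_gt⟩
  rw [this]
  refine isOpen_regular.inter (finite_forms.isOpen_biInter fun c _ => ?_)
  split_ifs
  · exact isOpen_lt continuous_const (continuous_form c)
  · exact isOpen_lt (continuous_form c) continuous_const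

/-- A cell is determined by the subset of the finite set `forms` that is positive on it. -/
lemma exists_finite_cells : ∃ T : Set ℂ, T.Finite ∧ T ⊆ regular D ∧
    ∀ z ∈ regular D, ∃ z' ∈ T, SameCell D z' z := by
  let f : ℂ → Set (ℤ × ℂ × ℤ) := fun z => {c | c ∈ forms D ∧ 0 < form c z}
  have hfin : (f '' regular D).Finite := by
    refine (finite_forms (D := D)).finite_subsets.subset ?_
    rintro _ ⟨z, -, rfl⟩
    exact fun c hc => hc.1
  obtain ⟨T, hT, hb⟩ := (Set.surjOn_image f (regular D)).exists_bijOn_subset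
  refine ⟨T, hb.finite_iff_finite.2 hfin, hT, fun z hz => ?_⟩
  obtain ⟨z', hz', he⟩ := hb.surjOn (Set.mem_image_of_mem f hz)
  refine ⟨z', hz', fun c hc => ?_⟩
  have := Set.ext_iff.1 he c
  exact ⟨fun h => (this.1 ⟨hc, h⟩).2, fun h => (this.2 ⟨hc, h⟩).2⟩

/-- Cells are respected by the inverse branches `z ↦ 1 / (z + a)`. -/
lemma inverse_branch_mem {z z' a : ℂ} (hz : z ∈ regular D) (hz' : z' ∈ regular D)
    (h : SameCell D z z') (ha : a ∈ intRing D) (hy : (z + a)⁻¹ ∈ domain D) :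
    (z' + a)⁻¹ ∈ domain D := by
  have h0 := add_ne_zero_of_mem_regular hz ha
  have h0' := add_ne_zero_of_mem_regular hz' ha
  rw [mem_domain_iff]
  intro α hα
  obtain ⟨n, hn, hn20, hf⟩ := exists_face_form hα
  obtain ⟨k, hk⟩ := exists_pullback_const hn.1 ha
  -- The leading coefficient of the pulled-back bisector is n, the norm of a face vector, so it is
  -- within the bound.
  have hb : (n, pullback (0, -conj α, n) a, k) ∈ boundedForms D := by
    have hd := disc_pullback _ hk
    refine ⟨?_, ?_, ?_, hn20⟩
    · exact (intRing D).add_mem (mul_mem (intCast_mem (intRing D) _) (conj_mem_intRing ha)) (conj_mem_intRing hn.1)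
    · exact hd.symm ▸ hn.2.1
    · exact hd.symm ▸ hn.2.2.1
  have e := form_inv _ h0 hk
  have e' := form_inv _ h0' hk
  have hq : 0 < normSq (z + a) := normSq_pos.2 h0
  have hq' : 0 < normSq (z' + a) := normSq_pos.2 h0'
  have h1 : 0 ≤ form (0, -conj α, n) (z + a)⁻¹ := by
    rw [hf]; linarith [mem_domain_iff.1 hy α hα]
  rw [e, le_div_iff₀ hq, zero_mul] at h1
  -- Regularity of z excludes equality, and a strict sign carries over to the whole cell.
  have h2 : 0 < form (n, pullback (0, -conj α, n) a, k) z :=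
    lt_of_le_of_ne h1 fun he => hz.2 _ ⟨hb, z, hz.1, he.symm⟩ he.symm
  have h3 := (pos_iff_of_sameCell hb hz.1 hz'.1 h).1 h2
  have h4 := div_pos h3 hq'
  rw [← e', hf] at h4
  linarith

/-- The new leading coefficient is the constant term of c, which is bounded because the zero set of
c meets the domain. -/
lemma pullback_mem_boundedForms {c : ℤ × ℂ × ℤ} (hc : c ∈ forms D) {a : ℂ}
    (ha : a ∈ intRing D) {k : ℤ}
    (hk : (k : ℝ) = c.2.2 * normSq a + 2 * (conj c.2.1 * a).re + c.1) :
    (c.2.2, pullback c a, k) ∈ boundedForms D := by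
  obtain ⟨hb, w, hw, hw0⟩ := hc
  have hd := disc_pullback _ hk
  refine ⟨?_, ?_, ?_, (abs_coeff_le hb hw hw0).1⟩
  · exact (intRing D).add_mem (mul_mem (intCast_mem (intRing D) _) (conj_mem_intRing ha)) (conj_mem_intRing hb.1)
  · exact hd.symm ▸ hb.2.1
  · exact hd.symm ▸ hb.2.2.1

lemma inverse_branch_regular {z a : ℂ} (hz : z ∈ regular D) (ha : a ∈ intRing D)
    (hy : (z + a)⁻¹ ∈ domain D) : (z + a)⁻¹ ∈ regular D := by
  have h0 := add_ne_zero_of_mem_regular hz ha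
  refine ⟨hy, fun c hc he => ?_⟩
  obtain ⟨k, hk⟩ := exists_pullback_const hc.1.1 ha
  have hb := pullback_mem_boundedForms hc ha hk
  rw [form_inv c h0 hk, div_eq_zero_iff, normSq_eq_zero] at he
  have he := he.resolve_right h0
  exact hz.2 _ ⟨hb, z, hz.1, he⟩ he

lemma inverse_branch_sameCell {z z' a : ℂ} (hz : z ∈ regular D) (hz' : z' ∈ regular D)
    (h : SameCell D z z') (ha : a ∈ intRing D) : SameCell D (z + a)⁻¹ (z' + a)⁻¹ := by
  intro c hc
  have h0 := add_ne_zero_of_mem_regular hz ha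
  have h0' := add_ne_zero_of_mem_regular hz' ha
  obtain ⟨k, hk⟩ := exists_pullback_const hc.1.1 ha
  have hb := pullback_mem_boundedForms hc ha hk
  rw [form_inv c h0 hk, form_inv c h0' hk, div_pos_iff_of_pos_right (normSq_pos.2 h0),
    div_pos_iff_of_pos_right (normSq_pos.2 h0')]
  exact pos_iff_of_sameCell hb hz.1 hz'.1 h

end Cells

/-! ### The transfer operator, its invariant cone, and the change of variables. -/

section TransferOperator

variable {D : ℕ}

/-- The weighted function `‖y‖⁴ f(y)` on the fundamental domain, extended by zero. -/
def weighted (D : ℕ) (f : ℂ → ℝ) : ℂ → ℝ := (domain D).indicator fun y => ‖y‖ ^ 4 * f y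

/-- The `ℝ≥0∞`-valued version of `weighted`. -/
def eweighted (D : ℕ) (F : ℂ → ℝ≥0∞) : ℂ → ℝ≥0∞ :=
  (domain D).indicator fun y => ENNReal.ofReal (‖y‖ ^ 4) * F y

/-- The cone of nonnegative functions that are log-Lipschitz on the cells. -/
structure InCone (D : ℕ) (K : ℝ) (f : ℂ → ℝ) : Prop where
  nonneg : ∀ z ∈ regular D, 0 ≤ f z
  le_exp : ∀ z ∈ regular D, ∀ z' ∈ regular D, SameCell D z z' →
    f z ≤ Real.exp (K * ‖z - z'‖) * f z'

lemma InCone.mono {K K' : ℝ} {f : ℂ → ℝ} (hf : InCone D K f) (h : K ≤ K') : InCone D K' f :=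
  ⟨hf.nonneg, fun z hz z' hz' hc => (hf.le_exp z hz z' hz' hc).trans (by
    have := hf.nonneg z' hz'
    gcongr)⟩

lemma inCone_const (D : ℕ) {K c : ℝ} (hK : 0 ≤ K) (hc : 0 ≤ c) : InCone D K fun _ => c :=
  ⟨fun _ _ => hc, fun z _ z' _ _ => le_mul_of_one_le_left hc (Real.one_le_exp (by positivity))⟩

lemma InCone.const_mul {K c : ℝ} {f : ℂ → ℝ} (hf : InCone D K f) (hc : 0 ≤ c) :
    InCone D K fun z => c * f z :=
  ⟨fun z hz => mul_nonneg hc (hf.nonneg z hz), fun z hz z' hz' h => by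
    have := hf.le_exp z hz z' hz' h
    calc c * f z ≤ c * (Real.exp (K * ‖z - z'‖) * f z') := by gcongr
      _ = _ := by ring⟩

variable [hD : Fact (D = 2 ∨ D = 7 ∨ D = 11)]

/-- The transfer operator of the Hurwitz map. -/
def transfer (D : ℕ) [hD : Fact (D = 2 ∨ D = 7 ∨ D = 11)] (f : ℂ → ℝ) (z : ℂ) : ℝ :=
  ∑' a : intRing D, weighted D f (z + a)⁻¹

lemma norm_sub_le_of_mem_domain {z z' : ℂ} (hz : z ∈ domain D) (hz' : z' ∈ domain D) :
    ‖z - z'‖ ≤ 2 := by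
  have h1 := norm_le_of_mem_domain hz
  have h2 := norm_le_of_mem_domain hz'
  exact (norm_sub_le _ _).trans (by linarith)

/-- If 1/(z+a) lies in the domain then |z+a| ≥ 1, so |a| ≤ |z+a| + 1 and 1 + |a| ≤ 3|z+a|. The
fourth power gives the factor 81 in `decay`. -/
lemma norm_inverse_branch_le {z a : ℂ} (hz : z ∈ domain D) (hy : (z + a)⁻¹ ∈ domain D) :
    ‖(z + a)⁻¹‖ ≤ 3 / (1 + ‖a‖) := by
  have hz1 := norm_le_of_mem_domain hz
  have hy1 := norm_le_of_mem_domain hy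
  rw [norm_inv] at *
  rcases (norm_nonneg (z + a)).eq_or_lt with h | h
  · rw [← h, inv_zero]; positivity
  have h1 : 1 ≤ ‖z + a‖ := by
    by_contra hn
    have := (one_le_inv₀ h).2 (not_le.1 hn).le
    linarith
  have h2 : ‖a‖ ≤ ‖z + a‖ + 1 := by
    have : ‖a‖ ≤ ‖z + a‖ + ‖z‖ := by
      simpa using norm_sub_le (z + a) z
    linarith
  rw [inv_eq_one_div, div_le_div_iff₀ h (by positivity)]
  linarith

lemma summable_decay {r : ℝ} (hr : 2 < r) :
    Summable fun a : intRing D => (1 + ‖(a : ℂ)‖) ^ (-r) := by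
  have h0 : Summable fun a : intRing D => if a = 0 then (1 : ℝ) else 0 :=
    (hasSum_ite_eq (0 : intRing D) (1 : ℝ)).summable
  refine Summable.of_nonneg_of_le (fun a => by positivity) (fun a => ?_)
    ((summable_intRing_rpow hr).add h0)
  split_ifs with h
  · subst h
    have : (0 : ℝ) ≤ ‖((0 : intRing D) : ℂ)‖ ^ (-r) := Real.rpow_nonneg (norm_nonneg _) _
    simp only [ZeroMemClass.coe_zero, norm_zero, add_zero, Real.one_rpow] at *
    linarith
  · rw [add_zero]
    have : 0 < ‖(a : ℂ)‖ := norm_pos_iff.2 (by simpa using h)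
    exact Real.rpow_le_rpow_of_nonpos this (by linarith) (by linarith)

/-- The uniform bound for the weights of the transfer operator. -/
def decay (a : ℂ) : ℝ := 81 * (1 + ‖a‖) ^ (-4 : ℝ)

omit hD in
lemma decay_nonneg (a : ℂ) : 0 ≤ decay a := by unfold decay; positivity

lemma summable_decay_four : Summable fun a : intRing D => decay (a : ℂ) :=
  (summable_decay (by norm_num)).mul_left _

lemma norm_pow_four_le {z a : ℂ} (hz : z ∈ domain D) (hy : (z + a)⁻¹ ∈ domain D) :
    ‖(z + a)⁻¹‖ ^ 4 ≤ decay a := by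
  have h := norm_inverse_branch_le hz hy
  have h0 : 0 < 1 + ‖a‖ := by positivity
  have e : decay a = (3 / (1 + ‖a‖)) ^ 4 := by
    rw [decay, Real.rpow_neg h0.le, div_pow]
    norm_cast
  rw [e]
  gcongr

lemma abs_weighted_le {f : ℂ → ℝ} {M : ℝ} (hM : 0 ≤ M) (hf : ∀ z ∈ regular D, |f z| ≤ M) {z a : ℂ}
    (hz : z ∈ regular D) (ha : a ∈ intRing D) : |weighted D f (z + a)⁻¹| ≤ M * decay a := by
  by_cases hy : (z + a)⁻¹ ∈ domain D
  · rw [weighted, Set.indicator_of_mem hy, abs_mul, abs_of_nonneg (by positivity), mul_comm]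
    have h1 := norm_pow_four_le hz.1 hy
    have h2 := hf _ (inverse_branch_regular hz ha hy)
    gcongr
  · rw [weighted, Set.indicator_of_notMem hy, abs_zero]
    exact mul_nonneg hM (decay_nonneg a)

lemma summable_weighted {f : ℂ → ℝ} {M : ℝ} (hf : ∀ z ∈ regular D, |f z| ≤ M) {z : ℂ}
    (hz : z ∈ regular D) : Summable fun a : intRing D => weighted D f (z + a)⁻¹ :=
  have hM : 0 ≤ M := (abs_nonneg _).trans (hf z hz)
  Summable.of_norm_bounded (summable_decay_four.mul_left M) fun a =>
    abs_weighted_le hM hf hz a.2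

/-- The total weight bound. -/
def decaySum (D : ℕ) [hD : Fact (D = 2 ∨ D = 7 ∨ D = 11)] : ℝ := ∑' a : intRing D, decay (a : ℂ)

lemma abs_transfer_le {f : ℂ → ℝ} {M : ℝ} (hf : ∀ z ∈ regular D, |f z| ≤ M) {z : ℂ}
    (hz : z ∈ regular D) : |transfer D f z| ≤ M * decaySum D := by
  have hM : 0 ≤ M := (abs_nonneg _).trans (hf z hz)
  rw [transfer, decaySum, ← tsum_mul_left]
  exact tsum_of_norm_bounded (f := fun a : intRing D => weighted D f (z + a)⁻¹)
    (summable_decay_four.mul_left M).hasSum fun a => abs_weighted_le hM hf hz a.2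

lemma weighted_congr {f g : ℂ → ℝ} (h : ∀ z ∈ regular D, f z = g z) {z a : ℂ}
    (hz : z ∈ regular D) (ha : a ∈ intRing D) :
    weighted D f (z + a)⁻¹ = weighted D g (z + a)⁻¹ := by
  by_cases hy : (z + a)⁻¹ ∈ domain D
  · simp only [weighted, Set.indicator_of_mem hy]
    rw [h _ (inverse_branch_regular hz ha hy)]
  · simp only [weighted, Set.indicator_of_notMem hy]

lemma transfer_congr {f g : ℂ → ℝ} (h : ∀ z ∈ regular D, f z = g z) {z : ℂ}
    (hz : z ∈ regular D) : transfer D f z = transfer D g z :=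
  tsum_congr fun a => weighted_congr h hz a.2

lemma transfer_sub {f g : ℂ → ℝ} {M M' : ℝ} (hf : ∀ z ∈ regular D, |f z| ≤ M)
    (hg : ∀ z ∈ regular D, |g z| ≤ M') {z : ℂ} (hz : z ∈ regular D) :
    transfer D (fun z => f z - g z) z = transfer D f z - transfer D g z := by
  rw [transfer, transfer, transfer, ← (summable_weighted hf hz).tsum_sub (summable_weighted hg hz)]
  refine tsum_congr fun a => ?_
  by_cases hy : (z + (a : ℂ))⁻¹ ∈ domain D
  · simp only [weighted, Set.indicator_of_mem hy]; ring
  · simp only [weighted, Set.indicator_of_notMem hy, sub_zero]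

lemma transfer_const_mul (c : ℝ) (f : ℂ → ℝ) (z : ℂ) :
    transfer D (fun z => c * f z) z = c * transfer D f z := by
  rw [transfer, transfer, ← tsum_mul_left]
  refine tsum_congr fun a => ?_
  by_cases hy : (z + (a : ℂ))⁻¹ ∈ domain D
  · simp only [weighted, Set.indicator_of_mem hy]; ring
  · simp only [weighted, Set.indicator_of_notMem hy, mul_zero]

omit hD in
lemma weighted_nonneg {f : ℂ → ℝ} {y : ℂ} (h : y ∈ domain D → 0 ≤ f y) : 0 ≤ weighted D f y :=
  Set.indicator_apply_nonneg fun hy => mul_nonneg (by positivity) (h hy)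

lemma weighted_branch_nonneg {f : ℂ → ℝ} (h : ∀ z ∈ regular D, 0 ≤ f z) {z a : ℂ}
    (hz : z ∈ regular D) (ha : a ∈ intRing D) : 0 ≤ weighted D f (z + a)⁻¹ :=
  weighted_nonneg fun hy => h _ (inverse_branch_regular hz ha hy)

lemma transfer_nonneg {f : ℂ → ℝ} (h : ∀ z ∈ regular D, 0 ≤ f z) {z : ℂ}
    (hz : z ∈ regular D) : 0 ≤ transfer D f z :=
  tsum_nonneg fun a => weighted_branch_nonneg h hz a.2

lemma transfer_mono {f g : ℂ → ℝ} {M M' : ℝ} (hf : ∀ z ∈ regular D, |f z| ≤ M)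
    (hg : ∀ z ∈ regular D, |g z| ≤ M') (h : ∀ z ∈ regular D, f z ≤ g z) {z : ℂ}
    (hz : z ∈ regular D) : transfer D f z ≤ transfer D g z := by
  have := transfer_nonneg (f := fun z => g z - f z) (fun z hz => sub_nonneg.2 (h z hz)) hz
  rw [transfer_sub hg hf hz] at this
  linarith

lemma weighted_le_transfer {f : ℂ → ℝ} {M : ℝ} (hf : ∀ z ∈ regular D, |f z| ≤ M)
    (h : ∀ z ∈ regular D, 0 ≤ f z) {z : ℂ}
    (hz : z ∈ regular D) (a : intRing D) : weighted D f (z + a)⁻¹ ≤ transfer D f z :=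
  (summable_weighted hf hz).le_tsum a fun b _ => weighted_branch_nonneg h hz b.2

/-- One sample point per cell controls f, as two points of the domain are at distance at most 2; the
sum over samples serves as a common bound. -/
lemma exists_bound_of_inCone {K : ℝ} (hK : 0 ≤ K) {f : ℂ → ℝ} (hf : InCone D K f) :
    ∃ M, ∀ z ∈ regular D, |f z| ≤ M := by
  obtain ⟨T, hT, hTr, hc⟩ := exists_finite_cells (D := D)
  refine ⟨∑ w ∈ hT.toFinset, Real.exp (K * 2) * f w, fun z hz => ?_⟩
  obtain ⟨w, hw, hs⟩ := hc z hz
  rw [abs_of_nonneg (hf.nonneg z hz)]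
  have hpos : ∀ w ∈ hT.toFinset, 0 ≤ Real.exp (K * 2) * f w := fun w hw =>
    mul_nonneg (Real.exp_pos _).le (hf.nonneg w (hTr (hT.mem_toFinset.1 hw)))
  refine le_trans ?_ (Finset.single_le_sum hpos (hT.mem_toFinset.2 hw))
  refine (hf.le_exp z hz w (hTr hw) hs.symm).trans ?_
  have := hf.nonneg w (hTr hw)
  have := norm_sub_le_of_mem_domain hz.1 (hTr hw).1
  gcongr

/-- The transfer operator maps the cone strictly into itself. -/
lemma InCone.transfer {f : ℂ → ℝ} (hf : InCone D 44 f) : InCone D 40 (transfer D f) := by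
  obtain ⟨M, hM⟩ := exists_bound_of_inCone (by norm_num) hf
  refine ⟨fun z hz => transfer_nonneg hf.nonneg hz, fun z hz z' hz' h => ?_⟩
  rw [Hurwitz.transfer, Hurwitz.transfer, ← tsum_mul_left]
  refine (summable_weighted hM hz).tsum_le_tsum (fun a => ?_)
    ((summable_weighted hM hz').mul_left _)
  by_cases hy : (z + (a : ℂ))⁻¹ ∈ domain D
  · have hy' := inverse_branch_mem hz hz' h a.2 hy
    have hr := inverse_branch_regular hz a.2 hy
    have hr' := inverse_branch_regular hz' a.2 hy'
    have hs := inverse_branch_sameCell hz hz' h a.2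
    have h0 := add_ne_zero_of_mem_regular hz a.2
    have h0' := add_ne_zero_of_mem_regular hz' a.2
    simp only [weighted, Set.indicator_of_mem hy, Set.indicator_of_mem hy']
    have hl := hf.le_exp _ hr _ hr' hs
    have hn := normSq_le_of_mem_domain hy
    have hn' := normSq_le_of_mem_domain hy'
    rw [normSq_eq_norm_sq] at hn hn'
    set y := (z + (a : ℂ))⁻¹ with hydef
    set y' := (z' + (a : ℂ))⁻¹ with hydef'
    have hd : ‖y - y'‖ = ‖z - z'‖ * (‖y‖ * ‖y'‖) := by
      have : y - y' = -((z - z') * (y * y')) := by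
        rw [hydef, hydef']; field_simp; ring
      rw [this, norm_neg, norm_mul, norm_mul]
    -- The product is at most the mean of the squares; by the identity above, this is the
    -- contraction ratio of the branch.
    have hyy : ‖y‖ * ‖y'‖ ≤ 9 / 11 := by nlinarith [sq_nonneg (‖y‖ - ‖y'‖)]
    have hd' : ‖y - y'‖ ≤ 9 / 11 * ‖z - z'‖ := by
      rw [hd, mul_comm]; gcongr
    have hyn : ‖y‖ ≤ Real.exp ‖z - z'‖ * ‖y'‖ := by
      -- This is 1/y' − 1/y = z' − z, multiplied by y y'.
      have e1 : y = y' * (1 + y * (z' - z)) := by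
        rw [hydef, hydef']; field_simp; ring
      have h1 : ‖y‖ ≤ 1 := (norm_le_of_mem_domain hr.1).trans (by norm_num)
      calc ‖y‖ = ‖y'‖ * ‖1 + y * (z' - z)‖ := by rw [← norm_mul, ← e1]
        _ ≤ ‖y'‖ * (1 + 1 * ‖z - z'‖) := by
          gcongr
          refine (norm_add_le _ _).trans ?_
          rw [norm_one, norm_mul, norm_sub_rev]
          gcongr
        _ ≤ ‖y'‖ * Real.exp ‖z - z'‖ := by
          gcongr
          linarith [Real.add_one_le_exp ‖z - z'‖]
        _ = _ := mul_comm _ _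
    have hf0 := hf.nonneg _ hr'
    have hf1 := hf.nonneg _ hr
    calc ‖y‖ ^ 4 * f y ≤ (Real.exp ‖z - z'‖ * ‖y'‖) ^ 4 *
          (Real.exp (44 * ‖y - y'‖) * f y') := by gcongr
      _ ≤ (Real.exp ‖z - z'‖ * ‖y'‖) ^ 4 *
          (Real.exp (36 * ‖z - z'‖) * f y') := by
        -- 44 · 9/11 = 36; the fourth power of the norm adds 4, which makes 40.
        have : 44 * ‖y - y'‖ ≤ 36 * ‖z - z'‖ := by linarith
        gcongr
      _ = Real.exp (40 * ‖z - z'‖) * (‖y'‖ ^ 4 * f y') := by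
        rw [mul_pow, ← Real.exp_nat_mul,
          show 40 * ‖z - z'‖ = ((4 : ℕ) : ℝ) * ‖z - z'‖ + 36 * ‖z - z'‖ by push_cast; ring,
          Real.exp_add]
        ring
  · rw [weighted, Set.indicator_of_notMem hy]
    exact mul_nonneg (Real.exp_pos _).le (weighted_branch_nonneg hf.nonneg hz' a.2)

lemma measurableSet_domain : MeasurableSet (domain D) := isClosed_domain.measurableSet

omit hD in
lemma finite_shifts : (shifts D).Finite := by unfold shifts; split_ifs <;> exact Set.toFinite _

lemma measurableSet_strictDomain : MeasurableSet (strictDomain D) := by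
  have : strictDomain D = domain D ∩ ⋂ α ∈ shifts D, {z | z - α ∈ domain D}ᶜ := by
    ext z
    simp [mem_strictDomain]
  rw [this]
  refine measurableSet_domain.inter (finite_shifts.measurableSet_biInter fun α _ => ?_)
  exact ((measurable_id.sub_const α) measurableSet_domain).compl

lemma measurableSet_regular : MeasurableSet (regular D) := isOpen_regular.measurableSet

lemma regular_ae_eq_domain : regular D =ᵐ[volume] domain D := by
  refine ae_eq_set.2 ⟨?_, volume_domain_diff_regular⟩
  rw [Set.sdiff_eq_empty.2 fun z hz => regular_subset hz]
  exact measure_empty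

lemma strictDomain_ae_eq_regular : strictDomain D =ᵐ[volume] regular D := by
  refine ae_eq_set.2 ⟨measure_mono_null ?_ (volume_domain_diff_regular (D := D)), ?_⟩
  · exact Set.sdiff_subset_sdiff_left fun z hz => strictDomain_subset_domain hz
  · rw [Set.sdiff_eq_empty.2 fun z hz => regular_subset_strictDomain hz]
    exact measure_empty

/-- The translates of the strict domain tile the plane: only the tile of `intPart D w` contains w.
The regular set differs from the strict domain by a null set. -/
lemma lintegral_eq_tiles (G : ℂ → ℝ≥0∞) (hG : Measurable G) :
    ∫⁻ w, G w = ∫⁻ z in regular D, ∑' a : intRing D, G (z + a) := by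
  rw [← setLIntegral_congr strictDomain_ae_eq_regular]
  have h1 : ∀ w, G w = ∑' a : intRing D, (strictDomain D).indicator (fun z => G (z + a)) (w - a) := by
    intro w
    rw [tsum_eq_single (⟨intPart D w, intPart_mem w⟩ : intRing D)]
    · rw [Set.indicator_of_mem (sub_intPart_mem w)]; simp
    · intro b hb
      refine Set.indicator_of_notMem (fun hm => hb ?_) _
      exact Subtype.ext (intPart_eq b.2 hm).symm
  have hm : ∀ a : intRing D, Measurable ((strictDomain D).indicator fun z => G (z + a)) := fun a =>
    (hG.comp (measurable_add_const _)).indicator measurableSet_strictDomain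
  calc ∫⁻ w, G w = ∫⁻ w, ∑' a : intRing D,
        (strictDomain D).indicator (fun z => G (z + a)) (w - a) := by simp_rw [← h1]
    _ = ∑' a : intRing D, ∫⁻ w, (strictDomain D).indicator (fun z => G (z + a)) (w - a) :=
      lintegral_tsum fun a => ((hm a).comp (measurable_sub_const _)).aemeasurable
    _ = ∑' a : intRing D, ∫⁻ w, (strictDomain D).indicator (fun z => G (z + a)) w :=
      tsum_congr fun a => lintegral_sub_right_eq_self _ _
    _ = ∑' a : intRing D, ∫⁻ w in strictDomain D, G (w + a) :=
      tsum_congr fun a => lintegral_indicator measurableSet_strictDomain _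
    _ = _ := (lintegral_tsum fun a => (hG.comp (measurable_add_const _)).aemeasurable).symm

omit hD in
lemma det_smul_one (c : ℂ) : (c • (1 : ℂ →L[ℝ] ℂ)).det = normSq c := by
  rw [ContinuousLinearMap.det, ← LinearMap.det_toMatrix Complex.basisOneI, Matrix.det_fin_two]
  simp [LinearMap.toMatrix_apply, Complex.normSq_apply]

lemma measurable_eweighted {F : ℂ → ℝ≥0∞} (hF : Measurable F) : Measurable (eweighted D F) :=
  Measurable.indicator (by fun_prop) measurableSet_domain

/-- The substitution z = 1/w has Jacobian |w|⁻⁴, which is the weight ‖w⁻¹‖⁴. At w = 0 both sides are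
consistent, since the inverse is 0 by convention and the weight vanishes. -/
lemma lintegral_inversion (F : ℂ → ℝ≥0∞) :
    ∫⁻ z in domain D, F z = ∫⁻ w, eweighted D F w⁻¹ := by
  set s : Set ℂ := {w | w ≠ 0 ∧ w⁻¹ ∈ domain D} with hs
  have hsm : MeasurableSet s :=
    (measurableSet_singleton (0 : ℂ)).compl.inter (measurable_inv measurableSet_domain)
  have himg : (fun w : ℂ => w⁻¹) '' s = domain D \ {0} := by
    ext z
    constructor
    · rintro ⟨w, hw, rfl⟩
      exact ⟨hw.2, by simpa using hw.1⟩
    · rintro ⟨hz, h0⟩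
      exact ⟨z⁻¹, ⟨by simpa using h0, by simpa using hz⟩, inv_inv z⟩
  have h := lintegral_image_eq_lintegral_abs_det_fderiv_mul volume hsm
    (fun w hw => ((hasDerivAt_inv hw.1).complexToReal_fderiv).hasFDerivWithinAt)
    (inv_injective.injOn) F
  have hae : (domain D \ {0} : Set ℂ) =ᵐ[volume] domain D :=
    sdiff_null_ae_eq_self (measure_singleton 0)
  rw [← setLIntegral_congr hae, ← himg, h, ← lintegral_indicator hsm]
  refine lintegral_congr fun w => ?_
  by_cases hw : w ∈ s
  · rw [Set.indicator_of_mem hw, eweighted, Set.indicator_of_mem hw.2, det_smul_one,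
      abs_of_nonneg (normSq_nonneg _)]
    congr 2
    rw [normSq_eq_norm_sq, norm_neg, norm_inv, norm_inv, norm_pow]
    ring
  · rw [Set.indicator_of_notMem hw, eweighted]
    by_cases hd : w⁻¹ ∈ domain D
    · have : w = 0 := by
        by_contra h0; exact hw ⟨h0, hd⟩
      subst this
      rw [Set.indicator_of_mem hd]
      simp
    · rw [Set.indicator_of_notMem hd]

/-- The change of variables formula of the transfer operator. -/
lemma lintegral_transfer {F : ℂ → ℝ≥0∞} (hF : Measurable F) :
    ∫⁻ z in regular D, F z =
      ∫⁻ z in regular D, ∑' a : intRing D, eweighted D F (z + a)⁻¹ := by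
  rw [setLIntegral_congr regular_ae_eq_domain, lintegral_inversion,
    lintegral_eq_tiles (D := D) (fun w => eweighted D F w⁻¹)
      ((measurable_eweighted hF).comp measurable_inv)]

lemma hurwitzMap_inverse_branch {z a : ℂ} (hz : z ∈ regular D) (ha : a ∈ intRing D) :
    hurwitzMap D (z + a)⁻¹ = z ∧ intPart D (1 / (z + a)⁻¹) = a := by
  have h0 := add_ne_zero_of_mem_regular hz ha
  have h1 : intPart D (1 / (z + a)⁻¹) = a := by
    refine intPart_eq ha ?_
    rw [one_div, inv_inv, add_sub_cancel_right]
    exact regular_subset_strictDomain hz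
  refine ⟨?_, h1⟩
  rw [hurwitzMap, if_neg (inv_ne_zero h0), h1, one_div, inv_inv, add_sub_cancel_right]

/-- Cells are open in the plane, and on a cell the log-Lipschitz bound squeezes f between two
continuous functions. -/
lemma InCone.continuousOn {K : ℝ} {f : ℂ → ℝ} (hf : InCone D K f) :
    ContinuousOn f (regular D) := by
  intro z hz
  refine ContinuousAt.continuousWithinAt ?_
  have hev : ∀ᶠ z' in 𝓝 z, z' ∈ regular D ∧ SameCell D z z' :=
    (isOpen_cell z).mem_nhds ⟨hz, SameCell.refl z⟩
  have h1 : Tendsto (fun z' => Real.exp (K * ‖z' - z‖) * f z) (𝓝 z) (𝓝 (f z)) := by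
    have : Continuous fun z' => Real.exp (K * ‖z' - z‖) * f z := by fun_prop
    simpa using this.tendsto z
  have h2 : Tendsto (fun z' => Real.exp (-(K * ‖z' - z‖)) * f z) (𝓝 z) (𝓝 (f z)) := by
    have : Continuous fun z' => Real.exp (-(K * ‖z' - z‖)) * f z := by fun_prop
    simpa using this.tendsto z
  refine tendsto_of_tendsto_of_tendsto_of_le_of_le' h2 h1 ?_ ?_
  · filter_upwards [hev] with z' hz'
    have := hf.le_exp z hz z' hz'.1 hz'.2
    rw [Real.exp_neg, inv_mul_le_iff₀ (Real.exp_pos _), norm_sub_rev]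
    exact this
  · filter_upwards [hev] with z' hz'
    exact hf.le_exp z' hz'.1 z hz hz'.2.symm

lemma InCone.measurable_indicator {K : ℝ} {f : ℂ → ℝ} (hf : InCone D K f) :
    Measurable ((regular D).indicator f) := by
  classical
  rw [← Set.piecewise_eq_indicator]
  exact hf.continuousOn.measurable_piecewise continuousOn_const measurableSet_regular

lemma volume_regular_lt_top : volume (regular D) < ∞ := by
  refine (measure_mono (t := Metric.closedBall 0 1) fun z hz => ?_).trans_lt
    measure_closedBall_lt_top
  rw [mem_closedBall_zero_iff]
  exact (norm_le_of_mem_domain hz.1).trans (by norm_num)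

lemma InCone.integrableOn {K : ℝ} (hK : 0 ≤ K) {f : ℂ → ℝ} (hf : InCone D K f) :
    IntegrableOn f (regular D) := by
  obtain ⟨M, hM⟩ := exists_bound_of_inCone hK hf
  have : IsFiniteMeasure (volume.restrict (regular D)) :=
    ⟨by simpa using volume_regular_lt_top⟩
  refine Integrable.of_bound (hf.continuousOn.aestronglyMeasurable measurableSet_regular) M ?_
  filter_upwards [ae_restrict_mem measurableSet_regular] with z hz using hM z hz

/-- The measure with a given density on the regular set. -/
def densityMeasure (D : ℕ) (f : ℂ → ℝ) : Measure ℂ :=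
  (volume.restrict (regular D)).withDensity fun z => ENNReal.ofReal ((regular D).indicator f z)

lemma lintegral_densityMeasure {K : ℝ} {f : ℂ → ℝ} (hf : InCone D K f) {H : ℂ → ℝ≥0∞}
    (hH : Measurable H) :
    ∫⁻ z, H z ∂(densityMeasure D f) = ∫⁻ z in regular D, ENNReal.ofReal (f z) * H z := by
  rw [densityMeasure, lintegral_withDensity_eq_lintegral_mul _
    hf.measurable_indicator.ennreal_ofReal hH]
  refine setLIntegral_congr_fun measurableSet_regular fun z hz => ?_
  simp [Set.indicator_of_mem hz]

/-- Integrals against a density, in terms of the inverse branches. -/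
lemma lintegral_densityMeasure_branches {K : ℝ} {f : ℂ → ℝ} (hf : InCone D K f) {H : ℂ → ℝ≥0∞}
    (hH : Measurable H) :
    ∫⁻ z, H z ∂(densityMeasure D f) = ∫⁻ z in regular D, ∑' a : intRing D,
      ENNReal.ofReal (weighted D f (z + a)⁻¹) * H (z + a)⁻¹ := by
  rw [densityMeasure, lintegral_withDensity_eq_lintegral_mul _
    hf.measurable_indicator.ennreal_ofReal hH, lintegral_transfer
    (hf.measurable_indicator.ennreal_ofReal.mul hH)]
  refine setLIntegral_congr_fun measurableSet_regular fun z hz => tsum_congr fun a => ?_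
  by_cases hy : (z + (a : ℂ))⁻¹ ∈ domain D
  · have hr := inverse_branch_regular hz a.2 hy
    simp only [eweighted, weighted, Set.indicator_of_mem hy, Pi.mul_apply,
      Set.indicator_of_mem hr]
    rw [ENNReal.ofReal_mul (by positivity), mul_assoc]
  · simp [eweighted, weighted, Set.indicator_of_notMem hy]

lemma ofReal_transfer {f : ℂ → ℝ} (hf : InCone D 44 f) {z : ℂ} (hz : z ∈ regular D) :
    ∑' a : intRing D, ENNReal.ofReal (weighted D f (z + a)⁻¹) =
      ENNReal.ofReal (transfer D f z) := by
  obtain ⟨M, hM⟩ := exists_bound_of_inCone (by norm_num) hf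
  rw [transfer, ENNReal.ofReal_tsum_of_nonneg
    (fun a => weighted_branch_nonneg hf.nonneg hz a.2) (summable_weighted hM hz)]

/-- On every inverse branch `hurwitzMap` returns the base point, so H factors out of the sum over
branches and leaves the transfer of f. -/
lemma lintegral_comp_hurwitzMap {f : ℂ → ℝ} (hf : InCone D 44 f) {H : ℂ → ℝ≥0∞}
    (hH : Measurable H) (hG : Measurable (hurwitzMap D)) :
    ∫⁻ z, H (hurwitzMap D z) ∂(densityMeasure D f) =
      ∫⁻ z, H z ∂(densityMeasure D (transfer D f)) := by
  rw [lintegral_densityMeasure_branches hf (H := fun z => H (hurwitzMap D z)) (hH.comp hG), lintegral_densityMeasure hf.transfer hH]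
  refine setLIntegral_congr_fun measurableSet_regular fun z hz => ?_
  simp only [fun a : intRing D => (hurwitzMap_inverse_branch hz a.2).1]
  rw [ENNReal.tsum_mul_right, ofReal_transfer hf hz]

lemma measurable_intPart : Measurable (intPart D) := by
  classical
  intro s _
  have : intPart D ⁻¹' s = ⋃ a : intRing D, 
      if (a : ℂ) ∈ s then {z : ℂ | z - a ∈ strictDomain D} else ∅ := by
    ext z
    simp only [Set.mem_preimage, Set.mem_iUnion]
    constructor
    · intro h
      refine ⟨⟨_, intPart_mem z⟩, ?_⟩
      rw [if_pos h]
      exact sub_intPart_mem z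
    · rintro ⟨a, ha⟩
      split_ifs at ha with h
      · rwa [intPart_eq a.2 ha]
      · exact ha.elim
  rw [this]
  refine MeasurableSet.iUnion fun a => ?_
  split_ifs
  · exact (measurable_sub_const _) measurableSet_strictDomain
  · exact MeasurableSet.empty

lemma measurable_hurwitzMap : Measurable (hurwitzMap D) := by
  have h := measurable_intPart (D := D)
  unfold hurwitzMap
  refine Measurable.ite (measurableSet_singleton (0 : ℂ)) measurable_const ?_
  have : Measurable fun z : ℂ => 1 / z := measurable_const.div measurable_id
  exact this.sub (h.comp this)

end TransferOperator

/-! ### Topological exactness: open sets spread over the whole domain. -/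

section Covering

variable {D : ℕ} [hD : Fact (D = 2 ∨ D = 7 ∨ D = 11)]

lemma InCone.iterate {f : ℂ → ℝ} (hf : InCone D 44 f) (n : ℕ) :
    InCone D 44 ((Hurwitz.transfer D)^[n] f) := by
  induction n with
  | zero => exact hf
  | succ n ih =>
    rw [Function.iterate_succ_apply']
    exact ih.transfer.mono (by norm_num)

lemma iterate_transfer_const_mul (c : ℝ) (f : ℂ → ℝ) (n : ℕ) :
    (transfer D)^[n] (fun z => c * f z) = fun z => c * (transfer D)^[n] f z := by
  induction n generalizing f with
  | zero => rfl
  | succ n ih =>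
    rw [Function.iterate_succ_apply, Function.iterate_succ_apply, ← ih]
    congr 1
    funext z
    exact transfer_const_mul c f z

/-- Functions that are at least `1` on `V` become bounded below after iterating the transfer
operator. -/
def Covers (D : ℕ) [hD : Fact (D = 2 ∨ D = 7 ∨ D = 11)] (V : Set ℂ) : Prop :=
  ∃ n : ℕ, ∃ ε > 0, ∀ f, InCone D 44 f → (∀ z ∈ V, z ∈ regular D → 1 ≤ f z) →
    ∀ z ∈ regular D, ε ≤ (transfer D)^[n] f z

lemma mem_domain_of_norm_le {z : ℂ} (hz : ‖z‖ ≤ 1 / 2) : z ∈ domain D := by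
  rw [mem_domain_iff]
  intro α hα
  obtain ⟨n, hn, h1, -⟩ := faces_normSq hα
  have h2 : 1 ≤ ‖α‖ ^ 2 := by
    rw [← normSq_eq_norm_sq, hn]; exact_mod_cast h1
  have h3 : 1 ≤ ‖α‖ := by nlinarith [norm_nonneg α]
  have h4 : (conj α * z).re ≤ ‖α‖ * ‖z‖ := by
    refine (re_le_norm _).trans ?_
    rw [norm_mul, norm_conj]
  rw [normSq_eq_norm_sq]
  nlinarith [norm_nonneg z]

lemma inv_pow_le_norm_inverse_branch {z a : ℂ} (hz : z ∈ regular D) (ha : a ∈ intRing D) :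
    ((1 + ‖a‖) ^ 4)⁻¹ ≤ ‖(z + a)⁻¹‖ ^ 4 := by
  have h0 := norm_pos_iff.2 (add_ne_zero_of_mem_regular hz ha)
  have h1 : ‖z + a‖ ≤ 1 + ‖a‖ :=
    (norm_add_le _ _).trans (by linarith [norm_le_of_mem_domain hz.1])
  rw [norm_inv, inv_pow]
  gcongr

lemma exists_transfer_one_ge : ∃ c > 0, ∀ z ∈ regular D, c ≤ transfer D (fun _ => 1) z := by
  have h4 : (4 : ℂ) ∈ intRing D := by exact_mod_cast natCast_mem (intRing D) 4
  refine ⟨((1 + ‖(4 : ℂ)‖) ^ 4)⁻¹, by positivity, fun z hz => ?_⟩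
  have h0 := norm_pos_iff.2 (add_ne_zero_of_mem_regular hz h4)
  -- The branch of digit 4 is defined on the whole domain: |z+4| ≥ 4 − 10/11 > 2, so its image lies
  -- in the disc of radius 1/2.
  have hd : (z + 4)⁻¹ ∈ domain D := by
    apply mem_domain_of_norm_le
    have h1 := norm_le_of_mem_domain hz.1
    have h2 : ‖(4 : ℂ)‖ ≤ ‖z + 4‖ + ‖z‖ := by simpa using norm_sub_le (z + 4) z
    rw [Complex.norm_ofNat] at h2
    rw [norm_inv, inv_le_comm₀ h0 (by norm_num)]
    norm_num; linarith
  have h1 := weighted_le_transfer (D := D) (f := fun _ => 1) (M := 1) (by simp) (by simp) hz ⟨4, h4⟩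
  refine le_trans ?_ h1
  simp only [weighted, Set.indicator_of_mem hd, mul_one]
  exact inv_pow_le_norm_inverse_branch hz h4

lemma Covers.eventually {V : Set ℂ} (h : Covers D V) : ∃ n : ℕ, ∀ m ≥ n, ∃ ε > 0,
    ∀ f, InCone D 44 f → (∀ z ∈ V, z ∈ regular D → 1 ≤ f z) →
    ∀ z ∈ regular D, ε ≤ (transfer D)^[m] f z := by
  obtain ⟨n, ε, hε, h⟩ := h
  refine ⟨n, fun m hm => ?_⟩
  induction m, hm using Nat.le_induction with
  | base => exact ⟨ε, hε, h⟩
  | succ m _ ih =>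
    obtain ⟨δ, hδ, ih⟩ := ih
    obtain ⟨c, hc, hc1⟩ := exists_transfer_one_ge (D := D)
    refine ⟨δ * c, by positivity, fun f hf hV z hz => ?_⟩
    rw [Function.iterate_succ_apply']
    obtain ⟨M, hM⟩ := exists_bound_of_inCone (by norm_num) (hf.iterate m)
    have h1 := transfer_mono (f := fun _ => δ * 1) (M := |δ * 1|) (fun _ _ => le_rfl) hM
      (fun z hz => by rw [mul_one]; exact ih f hf hV z hz) hz
    rw [transfer_const_mul δ (fun _ => 1) z] at h1
    refine le_trans ?_ h1
    have := hc1 z hz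
    gcongr

/-- The filter `𝓝[>] 0 ×ˢ 𝓝 u` describes small cones at a base point about the direction u; being
such a cone is an open condition on u. -/
lemma eventually_tangent {P : ℝ × ℂ → Prop} {u : ℂ} (h : ∀ᶠ x in 𝓝[>] (0 : ℝ) ×ˢ 𝓝 u, P x) :
    ∀ᶠ u' in 𝓝 u, ∀ᶠ x in 𝓝[>] (0 : ℝ) ×ˢ 𝓝 u', P x := by
  obtain ⟨pa, ha, pb, hb, hab⟩ := eventually_prod_iff.1 h
  filter_upwards [eventually_eventually_nhds.2 hb] with u' hu'
  exact eventually_prod_iff.2 ⟨pa, ha, pb, hu', hab⟩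

lemma norm_sub_intPart_le (z : ℂ) : ‖z - intPart D z‖ ≤ 1 :=
  (norm_le_of_mem_domain (strictDomain_subset_domain (sub_intPart_mem z))).trans (by norm_num)

/-- Inversion turns a small cone at 0 into a cone near infinity, which contains arbitrarily large
discs and therefore a whole translate of the domain by a ring element. -/
lemma exists_full_branch {V : Set ℂ} {u : ℂ}
    (h : ∀ᶠ x in 𝓝[>] (0 : ℝ) ×ˢ 𝓝 u, (x.1 * x.2 : ℂ) ∈ V) :
    ∃ a ∈ intRing D, ∀ z ∈ domain D, (z + a)⁻¹ ∈ V := by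
  -- Inverting the direction requires u ≠ 0, which a small perturbation provides.
  obtain ⟨u, hu0, h⟩ : ∃ u : ℂ, u ≠ 0 ∧ ∀ᶠ x in 𝓝[>] (0 : ℝ) ×ˢ 𝓝 u, (x.1 * x.2 : ℂ) ∈ V := by
    have hd : Dense ({0}ᶜ : Set ℂ) := dense_compl_singleton 0
    obtain ⟨u', hu', h0⟩ := hd.inter_nhds_nonempty (eventually_tangent h)
    exact ⟨u', hu', h0⟩
  obtain ⟨pa, ha, pb, hb, hab⟩ := eventually_prod_iff.1 h
  have hinv : Tendsto (fun w : ℂ => w⁻¹) (𝓝 u⁻¹) (𝓝 u) := by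
    simpa using tendsto_inv₀ (inv_ne_zero hu0)
  obtain ⟨η, hη, hη'⟩ := Metric.eventually_nhds_iff.1 (hinv.eventually hb)
  have h1 : Tendsto (fun n : ℕ => ((n : ℝ) + 1)⁻¹) atTop (𝓝[>] 0) := by
    refine tendsto_nhdsWithin_iff.2 ⟨?_, Eventually.of_forall fun n => ?_⟩
    · simpa using tendsto_one_div_add_atTop_nhds_zero_nat (𝕜 := ℝ)
    · exact Set.mem_Ioi.2 (by positivity)
  have h2 : ∀ᶠ n : ℕ in atTop, ((n : ℝ) + 1)⁻¹ < η / 2 := by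
    have := tendsto_nhdsWithin_iff.1 h1
    exact this.1.eventually (gt_mem_nhds (by positivity))
  obtain ⟨n, hn1, hn2⟩ := ((h1.eventually ha).and h2).exists
  have hn0 : (0 : ℝ) < n + 1 := by positivity
  have hnc : ((n : ℂ) + 1) ≠ 0 := by exact_mod_cast hn0.ne'
  -- The digit is (n+1)/u rounded to the ring, so (z+a)/(n+1) is within 2/(n+1) of 1/u.
  refine ⟨intPart D ((n + 1) * u⁻¹), intPart_mem _, fun z hz => ?_⟩
  set a := intPart D ((n + 1) * u⁻¹)
  have hb1 : ‖z + a - (n + 1) * u⁻¹‖ ≤ 2 := by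
    have e : z + a - (n + 1) * u⁻¹ = z - ((n + 1) * u⁻¹ - a) := by ring
    rw [e]
    refine (norm_sub_le _ _).trans ?_
    have := norm_sub_intPart_le (D := D) ((n + 1) * u⁻¹)
    have := norm_le_of_mem_domain hz
    linarith
  have hw : dist ((z + a) / (n + 1)) u⁻¹ < η := by
    rw [dist_eq_norm]
    have e : (z + a) / (n + 1) - u⁻¹ = (z + a - (n + 1) * u⁻¹) * (n + 1 : ℂ)⁻¹ := by
      field_simp
    rw [e, norm_mul, norm_inv]
    have e2 : ‖((n : ℂ) + 1)‖ = n + 1 := by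
      have : ((n : ℂ) + 1) = ((n + 1 : ℝ) : ℂ) := by push_cast; rfl
      rw [this, norm_real, Real.norm_eq_abs, abs_of_pos hn0]
    rw [e2]
    have : 0 < ((n : ℝ) + 1)⁻¹ := by positivity
    calc ‖z + a - (n + 1) * u⁻¹‖ * ((n : ℝ) + 1)⁻¹ ≤ 2 * ((n : ℝ) + 1)⁻¹ := by gcongr
      _ < η := by linarith
  have := hab hn1 (hη' hw)
  convert this using 1
  push_cast
  rw [inv_div]
  field_simp

lemma covers_of_full_branch {V : Set ℂ} (hV : V ⊆ domain D) {a : ℂ} (ha : a ∈ intRing D)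
    (h : ∀ z ∈ domain D, (z + a)⁻¹ ∈ V) : Covers D V := by
  refine ⟨1, ((1 + ‖a‖) ^ 4)⁻¹, by positivity, fun f hf hf1 z hz => ?_⟩
  obtain ⟨M, hM⟩ := exists_bound_of_inCone (by norm_num) hf
  have h1 := weighted_le_transfer hM hf.nonneg hz ⟨a, ha⟩
  have hy := h z hz.1
  simp only [weighted, Set.indicator_of_mem (hV hy)] at h1
  have h2 := hf1 _ hy (inverse_branch_regular hz ha (hV hy))
  calc ((1 + ‖a‖) ^ 4)⁻¹ ≤ ‖(z + a)⁻¹‖ ^ 4 * 1 := by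
        rw [mul_one]; exact inv_pow_le_norm_inverse_branch hz ha
    _ ≤ ‖(z + a)⁻¹‖ ^ 4 * f (z + a)⁻¹ := by gcongr
    _ ≤ _ := h1

/-- One step of the transfer operator moves a lower bound on V to the points that the branch sends
into V. The loss is at most (1+|a|)⁻⁴, which the factor `c` restores. -/
lemma covers_of_branch {V : Set ℂ} (hV : V ⊆ domain D) {a : ℂ} (ha : a ∈ intRing D)
    (h : Covers D {z | z ∈ domain D ∧ (z + a)⁻¹ ∈ V}) : Covers D V := by
  obtain ⟨n, ε, hε, h⟩ := h
  set c : ℝ := (1 + ‖a‖) ^ 4 with hc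
  have hc0 : 0 < c := by positivity
  refine ⟨n + 1, c⁻¹ * ε, by positivity, fun f hf hf1 z hz => ?_⟩
  have h2 := h _ ((hf.transfer.const_mul hc0.le).mono (by norm_num)) ?_ z hz
  · rw [iterate_transfer_const_mul, ← Function.iterate_succ_apply] at h2
    rwa [inv_mul_le_iff₀ hc0]
  · rintro w ⟨-, hw⟩ hwr
    obtain ⟨M, hM⟩ := exists_bound_of_inCone (by norm_num) hf
    have h1 := weighted_le_transfer hM hf.nonneg hwr ⟨a, ha⟩
    simp only [weighted, Set.indicator_of_mem (hV hw)] at h1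
    have h2 := hf1 _ hw (inverse_branch_regular hwr ha (hV hw))
    rw [← inv_le_iff_one_le_mul₀' hc0]
    calc c⁻¹ ≤ ‖(w + a)⁻¹‖ ^ 4 * 1 := by
          rw [mul_one]; exact inv_pow_le_norm_inverse_branch hwr ha
      _ ≤ ‖(w + a)⁻¹‖ ^ 4 * f (w + a)⁻¹ := by gcongr
      _ ≤ _ := h1

lemma tendsto_tangent (z u : ℂ) :
    Tendsto (fun x : ℝ × ℂ => z + x.1 * x.2) (𝓝[>] (0 : ℝ) ×ˢ 𝓝 u) (𝓝 z) := by
  have h : Continuous fun x : ℝ × ℂ => z + x.1 * x.2 := by fun_prop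
  have h1 := h.tendsto (0, u)
  rw [nhds_prod_eq] at h1
  simp only [ofReal_zero, zero_mul, add_zero] at h1
  exact h1.mono_left (prod_mono nhdsWithin_le_nhds le_rfl)

/-- The vector −v z² is the image of v under the derivative of inversion at 1/z. Directions parallel
to a face bisector fill finitely many lines, so the others are dense. -/
lemma exists_generic_direction {u z : ℂ} (hz0 : z ≠ 0) (hz : ‖z‖ ≤ 1) {P : ℂ → Prop}
    (hP : ∀ᶠ u' in 𝓝 u, P u') :
    ∃ v, P (-(v * z ^ 2)) ∧ ∀ α ∈ faces D, (conj α * v).re ≠ 0 := by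
  have hae : ∀ᵐ u' : ℂ, ∀ α ∈ faces D, (conj α * (-u' / z ^ 2)).re ≠ 0 := by
    rw [ae_ball_iff finite_faces.countable]
    intro α hα
    have h1 : 1 ≤ normSq (-conj α / z ^ 2) - ((0 : ℤ) : ℝ) * ((0 : ℤ) : ℝ) := by
      obtain ⟨n, hn, hn1, -⟩ := faces_normSq hα
      have : normSq z ≤ 1 := by rw [normSq_eq_norm_sq]; exact pow_le_one₀ (norm_nonneg _) hz
      have h0 := normSq_pos.2 hz0
      rw [normSq_div, normSq_neg, normSq_conj, hn, map_pow, Int.cast_zero, zero_mul, sub_zero,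
        one_le_div (by positivity)]
      exact (pow_le_one₀ h0.le this).trans (by exact_mod_cast hn1)
    have h2 := volume_form_zero (c := (0, -conj α / z ^ 2, 0)) h1
    rw [ae_iff, ← h2]
    congr 1
    ext u'
    have e : conj α * (-u' / z ^ 2) = -conj α / z ^ 2 * u' := by ring
    rw [Set.mem_ofPred_eq, Set.mem_ofPred_eq, e, not_not, form]
    simp only [Int.cast_zero, zero_mul, zero_add, add_zero]
    constructor <;> intro h <;> linarith
  obtain ⟨u', hu', h⟩ := (Measure.dense_of_ae hae).inter_nhds_nonempty hP
  refine ⟨-u' / z ^ 2, ?_, hu'⟩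
  have : -(-u' / z ^ 2 * z ^ 2) = u' := by field_simp
  rwa [this]

/-- The segment p + s v with 0 < s < 1 meets finitely many tiles, so some tile is met for
arbitrarily small s. As v is parallel to no face, the inequalities that are tight at p − a become
strict along v, and a whole cone about v stays in the tile. -/
lemma exists_tile {p v : ℂ} (hv : ∀ α ∈ faces D, (conj α * v).re ≠ 0) :
    ∃ a ∈ intRing D, ∀ᶠ x in 𝓝[>] (0 : ℝ) ×ˢ 𝓝 v, (p - a) + x.1 * x.2 ∈ domain D := by
  obtain ⟨a, ha, hfr⟩ : ∃ a ∈ intRing D, ∃ᶠ s : ℝ in 𝓝[>] 0, (p - a) + s * v ∈ domain D := by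
    by_contra! hcon
    have hfin := finite_intRing_norm_le (D := D) (‖p‖ + ‖v‖ + 1)
    have h1 : ∀ᶠ s : ℝ in 𝓝[>] 0, ∀ a ∈ {a : ℂ | a ∈ intRing D ∧ ‖a‖ ≤ ‖p‖ + ‖v‖ + 1},
        ¬ (p - a) + s * v ∈ domain D :=
      (eventually_all_finite hfin).2 fun a ha => hcon a ha.1
    have h2 : ∀ᶠ s : ℝ in 𝓝[>] 0, s ∈ Set.Ioo (0 : ℝ) 1 := Ioo_mem_nhdsGT one_pos
    obtain ⟨s, hs, hs0, hs1⟩ := (h1.and h2).exists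
    refine hs (intPart D (p + s * v)) ⟨intPart_mem _, ?_⟩ ?_
    · have e : intPart D (p + s * v) = (p + s * v) - (p + s * v - intPart D (p + s * v)) := by ring
      rw [e]
      refine (norm_sub_le _ _).trans (add_le_add ((norm_add_le _ _).trans ?_)
        (norm_sub_intPart_le _))
      rw [norm_mul, norm_real, Real.norm_eq_abs, abs_of_pos hs0]
      have := mul_le_of_le_one_left (norm_nonneg v) hs1.le
      linarith
    · convert strictDomain_subset_domain (sub_intPart_mem (D := D) (p + s * v)) using 1
      ring
  have hz1 : p - a ∈ domain D := by
    refine isClosed_domain.mem_of_frequently_of_tendsto hfr ?_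
    have h : Continuous fun s : ℝ => (p - a) + s * v := by fun_prop
    have h1 := h.tendsto 0
    simp only [ofReal_zero, zero_mul, add_zero] at h1
    exact h1.mono_left nhdsWithin_le_nhds
  refine ⟨a, ha, ?_⟩
  have : ∀ α ∈ faces D, ∀ᶠ x : ℝ × ℂ in 𝓝[>] (0 : ℝ) ×ˢ 𝓝 v,
      2 * (conj α * ((p - a) + x.1 * x.2)).re ≤ normSq α := by
    intro α hα
    rcases (mem_domain_iff.1 hz1 α hα).lt_or_eq with h | h
    · have ho : IsOpen {w : ℂ | 2 * (conj α * w).re < normSq α} :=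
        isOpen_lt (by fun_prop) (by fun_prop)
      filter_upwards [(tendsto_tangent (p - a) v).eventually (ho.mem_nhds h)] with x hx
      exact le_of_lt hx
    -- A tight inequality that still holds at some s > 0 forces this real part to be at most 0, and
    -- genericity excludes 0.
    · have hneg : (conj α * v).re < 0 := by
        have hpos : ∀ᶠ s : ℝ in 𝓝[>] 0, 0 < s := eventually_mem_nhdsWithin
        obtain ⟨s, hs, hs0⟩ := (hfr.and_eventually hpos).exists
        have h1 := mem_domain_iff.1 hs α hα
        have e : (conj α * ((p - a) + s * v)).re = (conj α * (p - a)).re + s * (conj α * v).re := by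
          rw [mul_add, mul_left_comm, add_re, re_ofReal_mul]
        rw [e] at h1
        refine lt_of_le_of_ne ?_ (hv α hα)
        by_contra hn
        have := mul_pos hs0 (not_le.1 hn)
        linarith
      have ho : IsOpen {w : ℂ | (conj α * w).re < 0} := isOpen_lt (by fun_prop) (by fun_prop)
      have h1 : ∀ᶠ x : ℝ × ℂ in 𝓝[>] (0 : ℝ) ×ˢ 𝓝 v, x.1 ∈ Set.Ioi (0 : ℝ) :=
        tendsto_fst.eventually eventually_mem_nhdsWithin
      have h2 : ∀ᶠ x : ℝ × ℂ in 𝓝[>] (0 : ℝ) ×ˢ 𝓝 v, (conj α * x.2).re < 0 :=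
        tendsto_snd.eventually (ho.mem_nhds hneg)
      filter_upwards [h1, h2] with x hx1 hx2
      have e : (conj α * ((p - a) + x.1 * x.2)).re
          = (conj α * (p - a)).re + x.1 * (conj α * x.2).re := by
        rw [mul_add, mul_left_comm, add_re, re_ofReal_mul]
      rw [e]
      have := mul_neg_of_pos_of_neg hx1 hx2
      linarith
  filter_upwards [(eventually_all_finite finite_faces).2 this] with x hx
  exact mem_domain_iff.2 hx

lemma tendsto_tangent_inv {z v : ℂ} (hz : z ≠ 0) :
    ∀ᶠ x in 𝓝[>] (0 : ℝ) ×ˢ 𝓝 v, (1 + x.1 * x.2 * z : ℂ) ≠ 0 ∧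
      (z⁻¹ + x.1 * x.2)⁻¹ = z + x.1 * (-(x.2 * z ^ 2) / (1 + x.1 * x.2 * z)) := by
  have h1 : Tendsto (fun x : ℝ × ℂ => 1 + x.1 * x.2 * z) (𝓝[>] (0 : ℝ) ×ˢ 𝓝 v) (𝓝 1) := by
    have h : Continuous fun x : ℝ × ℂ => 1 + x.1 * x.2 * z := by fun_prop
    have h1 := h.tendsto (0, v)
    rw [nhds_prod_eq] at h1
    simp only [ofReal_zero, zero_mul, add_zero] at h1
    exact h1.mono_left (prod_mono nhdsWithin_le_nhds le_rfl)
  filter_upwards [h1.eventually_ne one_ne_zero] with x hx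
  refine ⟨hx, ?_⟩
  have e : z⁻¹ + x.1 * x.2 = (1 + x.1 * x.2 * z) / z := by field_simp
  rw [e, inv_div, eq_comm, eq_div_iff hx, add_mul, mul_div_assoc', div_mul_cancel₀ _ hx]
  ring

/-- Euclidean descent: following a branch backwards sends p/q to (q − a p)/p, and |p|² < |q|²
because p/q lies in the domain. The descent stops at 0, where `exists_full_branch` applies. A cone
is carried along instead of a neighbourhood since the rational point may fall on the boundary of a
tile. -/
lemma covers_of_tangent (N : ℕ) : ∀ p ∈ intRing D, ∀ q ∈ intRing D, q ≠ 0 → normSq q = N →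
    ∀ V ⊆ domain D, ∀ u : ℂ, (∀ᶠ x in 𝓝[>] (0 : ℝ) ×ˢ 𝓝 u, p / q + x.1 * x.2 ∈ V) →
      Covers D V := by
  induction N using Nat.strong_induction_on with
  | _ N ih =>
  intro p hp q hq hq0 hN V hV u hu
  by_cases hp0 : p = 0
  · subst hp0
    simp only [zero_div, zero_add] at hu
    obtain ⟨a, ha, h⟩ := exists_full_branch (D := D) hu
    exact covers_of_full_branch hV ha h
  set z := p / q with hz
  have hz0 : z ≠ 0 := div_ne_zero hp0 hq0
  have hzd : z ∈ domain D :=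
    isClosed_domain.mem_of_tendsto (tendsto_tangent z u) (hu.mono fun x hx => hV hx)
  have hz1 := norm_le_of_mem_domain hzd
  obtain ⟨v, hv, hgen⟩ := exists_generic_direction (D := D) hz0 (by linarith)
    (eventually_tangent hu)
  obtain ⟨a, ha, hev⟩ := exists_tile (D := D) (p := z⁻¹) hgen
  refine covers_of_branch hV ha ?_
  obtain ⟨k, hk⟩ := intRing_normSq hp
  have hlt : k < N := by
    have h1 : normSq p < normSq q := by
      have : p = z * q := by rw [hz]; field_simp
      rw [this, map_mul]
      have h2 := normSq_pos.2 hq0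
      have h3 := normSq_le_of_mem_domain hzd
      nlinarith
    rw [hk, hN] at h1
    exact_mod_cast h1
  refine ih k hlt (q - a * p) (sub_mem hq (mul_mem ha hp)) p hp hp0 hk _ (fun w hw => hw.1) v ?_
  have e1 : (q - a * p) / p = z⁻¹ - a := by rw [hz]; field_simp
  rw [e1]
  have hinv := tendsto_tangent_inv (v := v) hz0
  have htend : Tendsto (fun x : ℝ × ℂ => (x.1, -(x.2 * z ^ 2) / (1 + x.1 * x.2 * z)))
      (𝓝[>] (0 : ℝ) ×ˢ 𝓝 v) (𝓝[>] (0 : ℝ) ×ˢ 𝓝 (-(v * z ^ 2))) := by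
    refine tendsto_fst.prodMk ?_
    have h : ContinuousAt (fun x : ℝ × ℂ => -(x.2 * z ^ 2) / (1 + x.1 * x.2 * z)) (0, v) := by
      refine ContinuousAt.div (by fun_prop) (by fun_prop) (by simp)
    have h1 := h.tendsto
    rw [nhds_prod_eq] at h1
    simp only [ofReal_zero, zero_mul, add_zero, div_one] at h1
    exact h1.mono_left (prod_mono nhdsWithin_le_nhds le_rfl)
  filter_upwards [hev, hinv, htend.eventually hv] with x hx1 hx2 hx3
  refine ⟨hx1, ?_⟩
  have e2 : z⁻¹ - a + x.1 * x.2 + a = z⁻¹ + x.1 * x.2 := by ring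
  rw [e2, hx2.2]
  exact hx3

/-- Every open subset of the fundamental domain is eventually mapped onto the whole domain. -/
theorem covers_of_isOpen {V : Set ℂ} (hV : V ⊆ domain D) (ho : IsOpen V) (hne : V.Nonempty) :
    Covers D V := by
  obtain ⟨z, hz⟩ := hne
  obtain ⟨ε, hε, hball⟩ := Metric.isOpen_iff.1 ho z hz
  obtain ⟨n, hn⟩ := exists_nat_one_div_lt hε
  have hn0 : (0 : ℝ) < n + 1 := by positivity
  -- With the natural number n + 1 as denominator, rounding z q in the ring gives a quotient within
  -- 1/(n+1) of z.
  set q : ℂ := ((n + 1 : ℕ) : ℂ) with hq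
  have hq0 : q ≠ 0 := by rw [hq]; exact_mod_cast (Nat.succ_ne_zero n)
  have hqn : ‖q‖ = n + 1 := by rw [hq, norm_natCast]; push_cast; rfl
  have hqr : q ∈ intRing D := natCast_mem _ _
  obtain ⟨k, hk⟩ := intRing_normSq hqr
  have hmem : intPart D (z * q) / q ∈ V := by
    apply hball
    rw [Metric.mem_ball, dist_comm, dist_eq_norm]
    have e : z - intPart D (z * q) / q = (z * q - intPart D (z * q)) / q := by field_simp
    rw [e, norm_div, hqn]
    exact (div_le_div_of_nonneg_right (norm_sub_intPart_le _) hn0.le).trans_lt hn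
  exact covers_of_tangent k _ (intPart_mem _) q hqr hq0 hk V hV 1
    ((tendsto_tangent _ 1).eventually (ho.mem_nhds hmem))

end Covering

/-! ### Doeblin bound and exponential contraction. -/

section Contraction

variable {D : ℕ} [hD : Fact (D = 2 ∨ D = 7 ∨ D = 11)]

/-- The integral over the fundamental domain. -/
def mass (D : ℕ) (f : ℂ → ℝ) : ℝ := ∫ z in regular D, f z

lemma InCone.mass_nonneg {K : ℝ} {f : ℂ → ℝ}
    (hf : InCone D K f) : 0 ≤ mass D f :=
  setIntegral_nonneg measurableSet_regular hf.nonneg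

lemma volume_regular_pos : 0 < volume (regular D) := by
  rw [measure_congr regular_ae_eq_domain]
  refine lt_of_lt_of_le (Metric.measure_ball_pos volume (0 : ℂ) (r := 1 / 2) (by norm_num))
    (measure_mono fun z hz => ?_)
  rw [mem_ball_zero_iff] at hz
  exact mem_domain_of_norm_le hz.le

lemma volume_real_regular_pos : 0 < volume.real (regular D) :=
  ENNReal.toReal_pos volume_regular_pos.ne' volume_regular_lt_top.ne

omit hD in
lemma mass_const (c : ℝ) : mass D (fun _ => c) = volume.real (regular D) * c := by
  rw [mass, setIntegral_const, smul_eq_mul]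

lemma ofReal_setIntegral {K : ℝ} (hK : 0 ≤ K) {f : ℂ → ℝ} (hf : InCone D K f) {E : Set ℂ}
    (hE : MeasurableSet E) :
    ENNReal.ofReal (∫ z in regular D ∩ E, f z) = densityMeasure D f E := by
  have h1 := lintegral_densityMeasure hf (H := E.indicator 1) (measurable_one.indicator hE)
  rw [lintegral_indicator_one hE] at h1
  rw [h1, ofReal_integral_eq_lintegral_ofReal ((hf.integrableOn hK).mono_set Set.inter_subset_left)
    ((ae_restrict_iff' (measurableSet_regular.inter hE)).2 (ae_of_all _ fun z hz =>
      hf.nonneg z hz.1)), Set.inter_comm, ← Measure.restrict_restrict hE, ← lintegral_indicator hE]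
  refine lintegral_congr fun z => ?_
  by_cases hz : z ∈ E <;> simp [hz]

omit hD in
lemma densityMeasure_congr {f g : ℂ → ℝ} (h : ∀ z ∈ regular D, f z = g z) :
    densityMeasure D f = densityMeasure D g := by
  rw [densityMeasure, densityMeasure, Set.indicator_congr h]

lemma densityMeasure_preimage {f : ℂ → ℝ} (hf : InCone D 44 f) {E : Set ℂ}
    (hE : MeasurableSet E) :
    densityMeasure D f (hurwitzMap D ⁻¹' E) = densityMeasure D (transfer D f) E := by
  have h := lintegral_comp_hurwitzMap hf (H := E.indicator 1) (measurable_one.indicator hE)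
    measurable_hurwitzMap
  rw [lintegral_indicator_one hE] at h
  rw [← h, ← lintegral_indicator_one (measurable_hurwitzMap hE)]
  rfl

lemma densityMeasure_preimage_iterate {f : ℂ → ℝ} (hf : InCone D 44 f) {E : Set ℂ}
    (hE : MeasurableSet E) (n : ℕ) :
    densityMeasure D f ((hurwitzMap D)^[n] ⁻¹' E) = densityMeasure D ((transfer D)^[n] f) E := by
  induction n generalizing f with
  | zero => rfl
  | succ n ih =>
    rw [Function.iterate_succ, Set.preimage_comp, Function.iterate_succ_apply,
      densityMeasure_preimage hf (measurable_hurwitzMap.iterate n hE),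
      ih (hf.transfer.mono (by norm_num))]

lemma setIntegral_preimage_iterate {f : ℂ → ℝ} (hf : InCone D 44 f) {E : Set ℂ}
    (hE : MeasurableSet E) (n : ℕ) :
    ∫ z in regular D ∩ (hurwitzMap D)^[n] ⁻¹' E, f z =
      ∫ z in regular D ∩ E, (transfer D)^[n] f z := by
  have h1 := ofReal_setIntegral (by norm_num) hf ((measurable_hurwitzMap (D := D)).iterate n hE)
  have h2 := ofReal_setIntegral (by norm_num) (hf.iterate n) hE
  rw [densityMeasure_preimage_iterate hf hE, ← h2] at h1
  have hn : ∀ {g : ℂ → ℝ} {A : Set ℂ}, InCone D 44 g → MeasurableSet A →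
      0 ≤ ∫ z in regular D ∩ A, g z := fun hg hA =>
    setIntegral_nonneg (measurableSet_regular.inter hA) fun z hz => hg.nonneg z hz.1
  rwa [ENNReal.ofReal_eq_ofReal_iff (hn hf ((measurable_hurwitzMap (D := D)).iterate n hE))
    (hn (hf.iterate n) hE)] at h1

lemma mass_iterate {f : ℂ → ℝ} (hf : InCone D 44 f) (n : ℕ) :
    mass D ((transfer D)^[n] f) = mass D f := by
  have := setIntegral_preimage_iterate hf MeasurableSet.univ n
  simpa [mass] using this.symm

/-- A uniform Doeblin lower bound. -/
lemma exists_doeblin : ∃ n : ℕ, 1 ≤ n ∧ ∃ ε > 0, ∀ f, InCone D 44 f → ∀ w ∈ regular D,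
    ∀ z ∈ regular D, ε * f w ≤ (transfer D)^[n] f z := by
  obtain ⟨T, hT, hTr, hc⟩ := exists_finite_cells (D := D)
  have hcov : ∀ w ∈ T, ∃ n : ℕ, ∀ m ≥ n, ∃ ε > 0, ∀ f, InCone D 44 f →
      (∀ z ∈ {z' | z' ∈ regular D ∧ SameCell D w z'}, z ∈ regular D → 1 ≤ f z) →
      ∀ z ∈ regular D, ε ≤ (transfer D)^[m] f z := fun w hw =>
    (covers_of_isOpen (fun z hz => hz.1.1) (isOpen_cell w)
      ⟨w, hTr hw, SameCell.refl w⟩).eventually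
  have h1 : ∀ᶠ m : ℕ in atTop, ∀ w ∈ T, ∃ ε > 0, ∀ f, InCone D 44 f →
      (∀ z ∈ {z' | z' ∈ regular D ∧ SameCell D w z'}, z ∈ regular D → 1 ≤ f z) →
      ∀ z ∈ regular D, ε ≤ (transfer D)^[m] f z := by
    rw [eventually_all_finite hT]
    intro w hw
    obtain ⟨n, hn⟩ := hcov w hw
    filter_upwards [eventually_ge_atTop n] with m hm using hn m hm
  obtain ⟨n, hn, hn1⟩ := (h1.and (eventually_ge_atTop 1)).exists
  have h2 : ∀ᶠ ε : ℝ in 𝓝[>] 0, ∀ w ∈ T, ∀ f, InCone D 44 f →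
      (∀ z ∈ {z' | z' ∈ regular D ∧ SameCell D w z'}, z ∈ regular D → 1 ≤ f z) →
      ∀ z ∈ regular D, ε ≤ (transfer D)^[n] f z := by
    rw [eventually_all_finite hT]
    intro w hw
    obtain ⟨ε, hε, h⟩ := hn w hw
    filter_upwards [Ioc_mem_nhdsGT hε] with ε' hε' f hf hf1 z hz
    exact hε'.2.trans (h f hf hf1 z hz)
  obtain ⟨ε, hε, hε0⟩ := (h2.and eventually_mem_nhdsWithin).exists
  have hε0 : 0 < ε := hε0
  -- Within a cell f varies by a factor at most exp(44 · 2).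
  refine ⟨n, hn1, ε * Real.exp (-88), by positivity, fun f hf w hw z hz => ?_⟩
  rcases (hf.nonneg w hw).eq_or_lt with h0 | h0
  · rw [← h0, mul_zero]; exact (hf.iterate n).nonneg z hz
  obtain ⟨w', hw', hs⟩ := hc w hw
  have hpos : 0 < Real.exp (-88) * f w := by positivity
  have h3 := hε w' hw' _ (hf.const_mul (inv_pos.2 hpos).le) (fun x hx _ => ?_) z hz
  · rw [iterate_transfer_const_mul, le_inv_mul_iff₀ hpos] at h3
    linarith
  · rw [le_inv_mul_iff₀ hpos, mul_one, Real.exp_neg, inv_mul_le_iff₀ (Real.exp_pos _)]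
    refine (hf.le_exp w hw x hx.1 (hs.symm.trans hx.2)).trans ?_
    have := norm_sub_le_of_mem_domain hw.1 hx.1.1
    have := hf.nonneg x hx.1
    gcongr
    linarith

/-- Integrating the Doeblin inequality over w gives the lower bound; integrating over z, with
conservation of mass, gives the upper bound. -/
lemma exists_doeblin_mass : ∃ n : ℕ, 1 ≤ n ∧ ∃ δ > 0, ∃ B > 0, ∀ f, InCone D 44 f →
    (∀ z ∈ regular D, δ * mass D f ≤ (transfer D)^[n] f z) ∧
      ∀ z ∈ regular D, f z ≤ B * mass D f := by
  obtain ⟨n, hn, ε, hε, h⟩ := exists_doeblin (D := D)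
  have hv := volume_real_regular_pos (D := D)
  have hfin : volume (regular D) ≠ ∞ := volume_regular_lt_top.ne
  refine ⟨n, hn, ε / volume.real (regular D), by positivity, 1 / (ε * volume.real (regular D)),
    by positivity, fun f hf => ⟨fun z hz => ?_, fun w hw => ?_⟩⟩
  · have h1 : ε * mass D f ≤ volume.real (regular D) * (transfer D)^[n] f z := by
      rw [← mass_const, mass, mass, ← integral_const_mul]
      refine setIntegral_mono_on ((hf.integrableOn (by norm_num)).const_mul ε)
        (integrableOn_const hfin) measurableSet_regular fun w hw => h f hf w hw z hz
    rw [div_mul_eq_mul_div, div_le_iff₀ hv]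
    linarith
  · have h1 : volume.real (regular D) * (ε * f w) ≤ mass D f := by
      rw [← mass_const, ← mass_iterate hf n, mass, mass]
      refine setIntegral_mono_on (integrableOn_const hfin)
        ((hf.iterate n).integrableOn (by norm_num)) measurableSet_regular
        fun z hz => h f hf w hw z hz
    rw [one_div, le_inv_mul_iff₀ (by positivity)]
    linarith

lemma iterate_transfer_sub {f g : ℂ → ℝ} (hf : InCone D 44 f) (hg : InCone D 44 g) (n : ℕ) :
    ∀ z ∈ regular D, (transfer D)^[n] (fun z => f z - g z) z =
      (transfer D)^[n] f z - (transfer D)^[n] g z := by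
  induction n with
  | zero => exact fun _ _ => rfl
  | succ n ih =>
    intro z hz
    obtain ⟨M, hM⟩ := exists_bound_of_inCone (by norm_num) (hf.iterate n)
    obtain ⟨M', hM'⟩ := exists_bound_of_inCone (by norm_num) (hg.iterate n)
    rw [Function.iterate_succ_apply', Function.iterate_succ_apply', Function.iterate_succ_apply',
      transfer_congr ih hz, transfer_sub hM hM' hz]

-- The gap between 40 and 44 pays for the subtraction: by convexity e^{40d} ≤ (10/11)e^{44d} + 1/11,
-- so an eleventh of a lower bound can be removed without leaving the larger cone.
omit hD in
lemma InCone.sub_const {f : ℂ → ℝ} {b : ℝ} (hf : InCone D 40 f) (hb : 0 ≤ b)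
    (h : ∀ z ∈ regular D, b ≤ f z) : InCone D 44 fun z => f z - b / 11 := by
  refine ⟨fun z hz => by have := h z hz; linarith, fun z hz z' hz' hs => ?_⟩
  have h1 := hf.le_exp z hz z' hz' hs
  have h2 := h z' hz'
  set d := ‖z - z'‖
  have hconv : Real.exp (40 * d) ≤ 10 / 11 * Real.exp (44 * d) + 1 / 11 := by
    have := convexOn_exp.2 (Set.mem_univ (44 * d)) (Set.mem_univ 0) 
      (show (0 : ℝ) ≤ 10 / 11 by norm_num) (show (0 : ℝ) ≤ 1 / 11 by norm_num) (by norm_num)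
    simp only [smul_eq_mul, mul_zero, add_zero, Real.exp_zero, mul_one] at this
    rwa [show (10 / 11 : ℝ) * (44 * d) = 40 * d by ring] at this
  have h3 : 1 ≤ Real.exp (44 * d) := Real.one_le_exp (by positivity)
  nlinarith [mul_le_mul_of_nonneg_right hconv (hb.trans h2)]

/-- Exponential contraction of the iterates of the transfer operator. -/
lemma exists_contraction : ∃ n : ℕ, ∃ B > 0, ∃ r : ℝ, 0 ≤ r ∧ r < 1 ∧ ∀ k : ℕ, ∀ f g,
    InCone D 44 f → InCone D 44 g → mass D f = mass D g → ∀ z ∈ regular D,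
      |(transfer D)^[n * k] f z - (transfer D)^[n * k] g z| ≤ B * r ^ k * mass D f := by
  obtain ⟨n, hn, δ, hδ, B, hB, h⟩ := exists_doeblin_mass (D := D)
  have hv := volume_real_regular_pos (D := D)
  -- Each round of n steps removes a constant that depends only on the mass. For f and g of equal
  -- mass the constants cancel in the difference, while the mass of the remainders shrinks by a
  -- fixed factor.
  have hstep : ∀ f, InCone D 44 f →
      InCone D 44 (fun z => (transfer D)^[n] f z - δ * mass D f / 11) ∧
      mass D (fun z => (transfer D)^[n] f z - δ * mass D f / 11) =
        (1 - δ * volume.real (regular D) / 11) * mass D f := by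
    intro f hf
    have h40 : InCone D 40 ((transfer D)^[n] f) := by
      obtain ⟨m, rfl⟩ := Nat.exists_eq_add_of_le' hn
      rw [Function.iterate_succ_apply']
      exact (hf.iterate m).transfer
    refine ⟨h40.sub_const (mul_nonneg hδ.le hf.mass_nonneg) (h f hf).1, ?_⟩
    have h1 := mass_iterate hf n
    rw [mass] at h1
    rw [mass, integral_sub ((hf.iterate n).integrableOn (by norm_num))
      (integrableOn_const volume_regular_lt_top.ne), h1, setIntegral_const, smul_eq_mul]
    ring
  refine ⟨n, B, hB, 1 - δ * volume.real (regular D) / 11, ?_, ?_, ?_⟩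
  · have h1 := hstep (fun _ => 1) (inCone_const D (by norm_num) zero_le_one)
    have h2 := h1.1.mass_nonneg
    rw [h1.2, mass_const, mul_one] at h2
    exact nonneg_of_mul_nonneg_left h2 hv
  · have : 0 < δ * volume.real (regular D) / 11 := by positivity
    linarith
  · intro k
    induction k with
    | zero =>
      intro f g hf hg hm z hz
      have h1 := (h f hf).2 z hz
      have h2 := (h g hg).2 z hz
      have h3 := hf.nonneg z hz
      have h4 := hg.nonneg z hz
      rw [← hm] at h2
      simp only [mul_zero, Function.iterate_zero, id, pow_zero, mul_one]
      rw [abs_le]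
      constructor <;> linarith
    | succ k ih =>
      intro f g hf hg hm z hz
      obtain ⟨hf1, hf2⟩ := hstep f hf
      obtain ⟨hg1, hg2⟩ := hstep g hg
      have h1 := ih _ _ hf1 hg1 (by rw [hf2, hg2, hm]) z hz
      have hc : InCone D 44 fun _ => δ * mass D f / 11 :=
        inCone_const D (by norm_num) (by have := hf.mass_nonneg; positivity)
      rw [← hm] at h1
      rw [iterate_transfer_sub (hf.iterate n) hc _ z hz,
        iterate_transfer_sub (hg.iterate n) hc _ z hz, sub_sub_sub_cancel_right, hf2,
        ← Function.iterate_add_apply, ← Function.iterate_add_apply] at h1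
      rw [Nat.mul_succ, pow_succ]
      linarith

end Contraction

/-! ### The invariant density, and uniqueness of the invariant measure. -/

section InvariantDensity

open scoped ContDiff

variable {D : ℕ} [hD : Fact (D = 2 ∨ D = 7 ∨ D = 11)]

omit hD in
lemma inCone_of_tendsto {K : ℝ} {u : ℕ → ℂ → ℝ} {f : ℂ → ℝ} (hu : ∀ k, InCone D K (u k))
    (h : ∀ z ∈ regular D, Tendsto (fun k => u k z) atTop (𝓝 (f z))) : InCone D K f :=
  ⟨fun z hz => ge_of_tendsto' (h z hz) fun k => (hu k).nonneg z hz,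
    fun z hz z' hz' hs => le_of_tendsto_of_tendsto' (h z hz) ((h z' hz').const_mul _)
      fun k => (hu k).le_exp z hz z' hz' hs⟩

lemma tendsto_setIntegral_of_le {u : ℕ → ℂ → ℝ} {f : ℂ → ℝ} {b : ℕ → ℝ}
    (hu : ∀ k, IntegrableOn (u k) (regular D)) (hf : IntegrableOn f (regular D))
    (hb : Tendsto b atTop (𝓝 0)) (h : ∀ k, ∀ z ∈ regular D, |u k z - f z| ≤ b k) (E : Set ℂ) :
    Tendsto (fun k => ∫ z in regular D ∩ E, u k z) atTop (𝓝 (∫ z in regular D ∩ E, f z)) := by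
  rw [tendsto_iff_norm_sub_tendsto_zero]
  have hlim : Tendsto (fun k => b k * volume.real (regular D ∩ E)) atTop (𝓝 0) := by
    simpa using hb.mul_const (volume.real (regular D ∩ E))
  refine squeeze_zero (fun _ => norm_nonneg _) (fun k => ?_) hlim
  rw [← integral_sub ((hu k).mono_set Set.inter_subset_left) (hf.mono_set Set.inter_subset_left)]
  refine norm_setIntegral_le_of_norm_le_const
    ((measure_mono Set.inter_subset_left).trans_lt volume_regular_lt_top) fun z hz => h k z hz.1

/-- The invariant density, with exponential convergence towards it. -/
theorem exists_invariant_density : ∃ f, InCone D 44 f ∧ mass D f = 1 ∧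
    (∀ z ∈ regular D, transfer D f z = f z) ∧
    ∃ n : ℕ, ∃ b : ℕ → ℝ, Tendsto b atTop (𝓝 0) ∧ ∀ g, InCone D 44 g → mass D g = 1 →
      ∀ k, ∀ z ∈ regular D, |(transfer D)^[n * k] g z - f z| ≤ b k := by
  obtain ⟨n, B, hB, r, hr0, hr1, hcon⟩ := exists_contraction (D := D)
  have hv := volume_real_regular_pos (D := D)
  set g₀ : ℂ → ℝ := fun _ => (volume.real (regular D))⁻¹ with hg₀
  have hc₀ : InCone D 44 g₀ := inCone_const D (by norm_num) (inv_pos.2 hv).le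
  have hm₀ : mass D g₀ = 1 := by rw [hg₀, mass_const, mul_inv_cancel₀ hv.ne']
  set u : ℕ → ℂ → ℝ := fun k => (transfer D)^[n * k] g₀ with hu
  -- Consecutive terms are the images of g₀ and of its n-th transfer, which have equal mass, so
  -- contraction makes the sequence geometrically Cauchy.
  have hdist : ∀ z ∈ regular D, ∀ k, dist (u k z) (u (k + 1) z) ≤ B * r ^ k := by
    intro z hz k
    have h1 := hcon k g₀ _ hc₀ (hc₀.iterate n) (mass_iterate hc₀ n).symm z hz
    rw [hm₀, mul_one, ← Function.iterate_add_apply] at h1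
    rw [Real.dist_eq]
    exact h1
  choose! f hf using fun z (hz : z ∈ regular D) =>
    cauchySeq_tendsto_of_complete (cauchySeq_of_le_geometric r B hr1 (hdist z hz))
  have hcf : InCone D 44 f := inCone_of_tendsto (fun k => hc₀.iterate (n * k)) hf
  have hrk : Tendsto (fun k : ℕ => r ^ k) atTop (𝓝 0) := tendsto_pow_atTop_nhds_zero_of_lt_one hr0 hr1
  have hb0 : Tendsto (fun k : ℕ => B * r ^ k / (1 - r)) atTop (𝓝 0) := by
    simpa using (hrk.const_mul B).div_const (1 - r)
  have huf : ∀ k, ∀ z ∈ regular D, |u k z - f z| ≤ B * r ^ k / (1 - r) := fun k z hz => by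
    have := dist_le_of_le_geometric_of_tendsto r B hr1 (hdist z hz) (hf z hz) k
    rwa [Real.dist_eq] at this
  have hmf : mass D f = 1 := by
    have h1 := tendsto_setIntegral_of_le (fun k => (hc₀.iterate (n * k)).integrableOn (by norm_num))
      (hcf.integrableOn (by norm_num)) hb0 huf Set.univ
    simp only [Set.inter_univ] at h1
    refine tendsto_nhds_unique h1 ?_
    have : ∀ k, ∫ z in regular D, (transfer D)^[n * k] g₀ z = 1 := fun k => by
      rw [← hm₀, ← mass_iterate hc₀ (n * k), mass]
    simp only [this, tendsto_const_nhds]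
  have hconv : ∀ g, InCone D 44 g → mass D g = 1 → ∀ k, ∀ z ∈ regular D,
      |(transfer D)^[n * k] g z - f z| ≤ B * r ^ k + B * r ^ k / (1 - r) := by
    intro g hg hm k z hz
    have h1 := hcon k g g₀ hg hc₀ (by rw [hm, hm₀]) z hz
    rw [hm, mul_one] at h1
    have h2 := huf k z hz
    exact (abs_sub_le _ _ _).trans (add_le_add h1 h2)
  have hb1 : Tendsto (fun k : ℕ => B * r ^ k + B * r ^ k / (1 - r)) atTop (𝓝 0) := by
    simpa using (hrk.const_mul B).add hb0
  refine ⟨f, hcf, hmf, fun z hz => ?_, n, _, hb1, hconv⟩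
  -- Convergence is known along multiples of n only. The iterates of the transfer of f tend to f by
  -- contraction, and to the transfer of f by continuity of the operator, so f is fixed.
  have hcLf : InCone D 44 (transfer D f) := hcf.transfer.mono (by norm_num)
  have hmLf : mass D (transfer D f) = 1 := by rw [← hmf]; exact mass_iterate hcf 1
  obtain ⟨M, hM⟩ := exists_bound_of_inCone (by norm_num) hcf
  have l1 : Tendsto (fun k => (transfer D)^[n * k] (transfer D f) z) atTop (𝓝 (f z)) := by
    rw [tendsto_iff_norm_sub_tendsto_zero]
    exact squeeze_zero (fun _ => norm_nonneg _) (fun k => hconv _ hcLf hmLf k z hz) hb1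
  have l2 : Tendsto (fun k => (transfer D)^[n * k] (transfer D f) z) atTop
      (𝓝 (transfer D f z)) := by
    rw [tendsto_iff_norm_sub_tendsto_zero]
    have h0 : Tendsto (fun k : ℕ => (B * r ^ k + B * r ^ k / (1 - r)) * decaySum D) atTop (𝓝 0) := by
      simpa using hb1.mul_const (decaySum D)
    refine squeeze_zero (fun _ => norm_nonneg _) (fun k => ?_) h0
    obtain ⟨M', hM'⟩ := exists_bound_of_inCone (by norm_num) (hcf.iterate (n * k))
    rw [← Function.iterate_succ_apply, Function.iterate_succ_apply', ← transfer_sub hM' hM hz]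
    exact abs_transfer_le (fun w hw => hconv f hcf hmf k w hw) hz
  exact tendsto_nhds_unique l2 l1

-- After the shift all values are at least Λ, so an increment Λ‖z − w‖ is a relative change of at
-- most ‖z − w‖.
omit hD in
lemma lipschitz_add_const_inCone {g : ℂ → ℝ} {b Λ : ℝ} (hb : ∀ z, |g z| ≤ b) (hΛ0 : 0 ≤ Λ)
    (hΛ : ∀ z w, |g z - g w| ≤ Λ * ‖z - w‖) : InCone D 44 fun z => g z + (b + Λ) := by
  refine ⟨fun z _ => ?_, fun z _ z' _ _ => ?_⟩
  · linarith [(abs_le.1 (hb z)).1]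
  · have h1 := (abs_le.1 (hΛ z z')).2
    have h2 := (abs_le.1 (hb z')).1
    have h3 : 1 + 44 * ‖z - z'‖ ≤ Real.exp (44 * ‖z - z'‖) := by
      linarith [Real.add_one_le_exp (44 * ‖z - z'‖)]
    have h0 := norm_nonneg (z - z')
    calc g z + (b + Λ) ≤ (1 + 44 * ‖z - z'‖) * (g z' + (b + Λ)) := by nlinarith
      _ ≤ _ := by
        gcongr
        linarith

lemma isProbabilityMeasure_densityMeasure {f : ℂ → ℝ} (hf : InCone D 44 f) (hm : mass D f = 1) :
    IsProbabilityMeasure (densityMeasure D f) := by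
  constructor
  rw [← ofReal_setIntegral (by norm_num) hf MeasurableSet.univ, Set.inter_univ]
  have : ∫ z in regular D, f z = 1 := hm
  rw [this, ENNReal.ofReal_one]

lemma restrict_regular : (volume.restrict (regular D) : Measure ℂ) = volume.restrict (domain D) :=
  Measure.restrict_congr_set regular_ae_eq_domain

lemma isInvariantMeasure_densityMeasure {f : ℂ → ℝ} (hf : InCone D 44 f) (hm : mass D f = 1)
    (hL : ∀ z ∈ regular D, transfer D f z = f z) : IsInvariantMeasure D (densityMeasure D f) := by
  refine ⟨isProbabilityMeasure_densityMeasure hf hm, ?_, measurable_hurwitzMap, ?_⟩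
  · rw [← restrict_regular]
    exact withDensity_absolutelyContinuous _ _
  · ext E hE
    rw [Measure.map_apply measurable_hurwitzMap hE, densityMeasure_preimage hf hE,
      densityMeasure_congr hL]

/-- This is mixing: the preimages of E become independent of a cone density. Mass 0 is separate
because normalisation is then impossible. -/
lemma tendsto_setIntegral_lipschitz {f : ℂ → ℝ} (hf : InCone D 44 f) {n : ℕ} {b : ℕ → ℝ}
    (hb : Tendsto b atTop (𝓝 0)) (h : ∀ g, InCone D 44 g → mass D g = 1 →
      ∀ k, ∀ z ∈ regular D, |(transfer D)^[n * k] g z - f z| ≤ b k) {E : Set ℂ}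
    (hE : MeasurableSet E) {g : ℂ → ℝ} (hg : InCone D 44 g) :
    Tendsto (fun k => ∫ z in regular D ∩ (hurwitzMap D)^[n * k] ⁻¹' E, g z) atTop
      (𝓝 (mass D g * ∫ z in regular D ∩ E, f z)) := by
  simp only [fun k => setIntegral_preimage_iterate hg hE (n * k)]
  have key : ∀ g, InCone D 44 g → mass D g = 1 →
      Tendsto (fun k => ∫ z in regular D ∩ E, (transfer D)^[n * k] g z) atTop
        (𝓝 (∫ z in regular D ∩ E, f z)) := fun g hg hm =>
    tendsto_setIntegral_of_le (fun k => (hg.iterate (n * k)).integrableOn (by norm_num))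
      (hf.integrableOn (by norm_num)) hb (h g hg hm) E
  rcases hg.mass_nonneg.eq_or_lt with h0 | h0
  · have hz : ∀ k, ∫ z in regular D ∩ E, (transfer D)^[n * k] g z = 0 := by
      intro k
      refine le_antisymm ?_ (setIntegral_nonneg (measurableSet_regular.inter hE)
        fun z hz => (hg.iterate (n * k)).nonneg z hz.1)
      rw [h0, ← mass_iterate hg (n * k), mass]
      refine setIntegral_mono_set ((hg.iterate (n * k)).integrableOn (by norm_num)) ?_
        (Set.inter_subset_left.eventuallyLE)
      exact (ae_restrict_iff' measurableSet_regular).2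
        (ae_of_all _ fun z hz => (hg.iterate (n * k)).nonneg z hz)
    rw [← h0, zero_mul]
    simp only [hz, tendsto_const_nhds]
  · have h1 := key _ (hg.const_mul (inv_pos.2 h0).le) (by
      rw [mass, integral_const_mul]; exact inv_mul_cancel₀ h0.ne')
    have h2 := h1.const_mul (mass D g)
    simp only [iterate_transfer_const_mul, integral_const_mul, mul_inv_cancel_left₀ h0.ne'] at h2
    exact h2

/-- Uniqueness of the absolutely continuous invariant probability measure. -/
lemma eq_densityMeasure {f : ℂ → ℝ} (hf : InCone D 44 f) (hm : mass D f = 1)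
    {n : ℕ} {b : ℕ → ℝ}
    (hb : Tendsto b atTop (𝓝 0)) (h : ∀ g, InCone D 44 g → mass D g = 1 →
      ∀ k, ∀ z ∈ regular D, |(transfer D)^[n * k] g z - f z| ≤ b k) {ν : Measure ℂ}
    (hν : IsInvariantMeasure D ν) : ν = densityMeasure D f := by
  have := hν.isProbabilityMeasure
  have := isProbabilityMeasure_densityMeasure hf hm
  have hfinr : IsFiniteMeasure (volume.restrict (regular D)) :=
    ⟨by simpa using volume_regular_lt_top⟩
  have hac : ν ≪ volume.restrict (regular D) := by
    rw [restrict_regular]; exact hν.absolutelyContinuous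
  set ρ : ℂ → ℝ := fun z => (ν.rnDeriv (volume.restrict (regular D)) z).toReal with hρ
  have hρi : Integrable ρ (volume.restrict (regular D)) := Measure.integrable_toReal_rnDeriv
  have hνE : ∀ A, MeasurableSet A → ν.real A = ∫ z in regular D ∩ A, ρ z := by
    intro A hA
    rw [← Measure.setIntegral_toReal_rnDeriv hac A, Measure.restrict_restrict hA, Set.inter_comm]
  ext E hE
  rw [← ENNReal.toReal_eq_toReal_iff' (measure_ne_top _ _) (measure_ne_top _ _)]
  have hfE : (densityMeasure D f E).toReal = ∫ z in regular D ∩ E, f z := by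
    rw [← ofReal_setIntegral (by norm_num) hf hE, ENNReal.toReal_ofReal]
    exact setIntegral_nonneg (measurableSet_regular.inter hE) fun z hz => hf.nonneg z hz.1
  rw [hfE]
  set x := ∫ z in regular D ∩ E, f z with hx
  have hx1 : |x| ≤ 1 := by
    rw [← hfE, abs_of_nonneg ENNReal.toReal_nonneg]
    exact measureReal_le_one
  refine eq_of_forall_dist_le fun ε hε => ?_
  -- The density of ν is merely integrable, so it is replaced by a smooth compactly supported
  -- function that is close to it in L¹.
  obtain ⟨g, hgc, hgs, hge⟩ := (memLp_one_iff_integrable.2 hρi).exist_eLpNorm_sub_le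
    ENNReal.one_ne_top le_rfl (half_pos hε)
  have hgcont : Continuous g := hgs.continuous
  have hgi : Integrable g (volume.restrict (regular D)) :=
    memLp_one_iff_integrable.1 (hgcont.memLp_of_hasCompactSupport hgc)
  have hint : ∫ z in regular D, |ρ z - g z| ≤ ε / 2 := by
    rw [eLpNorm_one_eq_lintegral_enorm] at hge
    have h1 := integral_norm_eq_lintegral_enorm (hρi.sub hgi).1
    simp only [Pi.sub_apply, Real.norm_eq_abs] at h1
    rw [h1]
    exact ENNReal.toReal_le_of_le_ofReal (by positivity) hge
  have hdiff : ∀ A, MeasurableSet A → |ν.real A - ∫ z in regular D ∩ A, g z| ≤ ε / 2 := by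
    intro A hA
    have i1 : IntegrableOn ρ (regular D ∩ A) := IntegrableOn.mono_set hρi Set.inter_subset_left
    have i2 : IntegrableOn g (regular D ∩ A) := IntegrableOn.mono_set hgi Set.inter_subset_left
    rw [hνE A hA, ← integral_sub i1 i2]
    refine (abs_integral_le_integral_abs).trans (le_trans ?_ hint)
    exact setIntegral_mono_set (hρi.sub hgi).abs (ae_of_all _ fun _ => abs_nonneg _)
      (Set.inter_subset_left.eventuallyLE)
  obtain ⟨c, hc⟩ := hgc.exists_bound_of_continuous hgcont
  obtain ⟨Λ, hΛ⟩ := hgs.lipschitzWith_of_hasCompactSupport hgc (by simp)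
  have hcone : InCone D 44 fun z => g z + (c + Λ) :=
    lipschitz_add_const_inCone hc Λ.2 fun z w => by
      have := hΛ.dist_le_mul z w
      rwa [Real.dist_eq, dist_eq_norm] at this
  have hconst : InCone D 44 fun _ : ℂ => c + (Λ : ℝ) :=
    inCone_const D (by norm_num) (add_nonneg ((norm_nonneg _).trans (hc 0)) Λ.2)
  -- A signed Lipschitz function is the difference of two cone members, and mixing applies to each
  -- of them.
  have hlim := (tendsto_setIntegral_lipschitz hf hb h hE hcone).sub
    (tendsto_setIntegral_lipschitz hf hb h hE hconst)
  rw [← hx, ← sub_mul] at hlim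
  have hmass : mass D (fun z => g z + (c + Λ)) - mass D (fun _ => c + (Λ : ℝ)) =
      ∫ z in regular D, g z := by
    rw [mass, mass, integral_add hgi (integrableOn_const volume_regular_lt_top.ne)]
    ring
  have hmeas : ∀ k, MeasurableSet ((hurwitzMap D)^[n * k] ⁻¹' E) := fun k =>
    (measurable_hurwitzMap (D := D)).iterate _ hE
  have hseq : ∀ k, (∫ z in regular D ∩ (hurwitzMap D)^[n * k] ⁻¹' E, (g z + (c + Λ))) -
      ∫ z in regular D ∩ (hurwitzMap D)^[n * k] ⁻¹' E, (c + (Λ : ℝ)) =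
      ∫ z in regular D ∩ (hurwitzMap D)^[n * k] ⁻¹' E, g z := by
    intro k
    rw [integral_add (IntegrableOn.mono_set hgi Set.inter_subset_left) (integrableOn_const
      ((measure_mono Set.inter_subset_left).trans_lt volume_regular_lt_top).ne)]
    ring
  rw [hmass] at hlim
  simp only [hseq] at hlim
  -- Invariance keeps the ν-measure of the preimages constant while mixing sends the integrals of g
  -- to (∫ g)·x.
  have hinv : ∀ k, ν.real ((hurwitzMap D)^[n * k] ⁻¹' E) = ν.real E := fun k =>
    (hν.measurePreserving.iterate (n * k)).measureReal_preimage hE.nullMeasurableSet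
  have h1 : |ν.real E - (∫ z in regular D, g z) * x| ≤ ε / 2 := by
    refine le_of_tendsto ((tendsto_const_nhds.sub hlim).abs) (Eventually.of_forall fun k => ?_)
    rw [← hinv k]
    exact hdiff _ (hmeas k)
  have h2 : |1 - ∫ z in regular D, g z| ≤ ε / 2 := by
    have := hdiff Set.univ MeasurableSet.univ
    simpa using this
  rw [Real.dist_eq]
  calc |ν.real E - x| = |(ν.real E - (∫ z in regular D, g z) * x) -
        (1 - ∫ z in regular D, g z) * x| := by ring_nf
    _ ≤ |ν.real E - (∫ z in regular D, g z) * x| + |(1 - ∫ z in regular D, g z) * x| :=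
      abs_sub _ _
    _ ≤ ε / 2 + ε / 2 * 1 := by
      rw [abs_mul]
      gcongr
    _ = ε := by ring

end InvariantDensity

/-! ### The symmetry z ↦ −z, and moments of the digits. -/

section Symmetry

variable {D : ℕ} [hD : Fact (D = 2 ∨ D = 7 ∨ D = 11)]

lemma neg_mem_domain_iff {z : ℂ} : -z ∈ domain D ↔ z ∈ domain D :=
  ⟨fun h => by simpa using neg_mem_domain h, neg_mem_domain⟩

lemma neg_mem_regular {z : ℂ} (hz : z ∈ regular D) : -z ∈ regular D := by
  have hform : ∀ (c : ℤ × ℂ × ℤ) (w : ℂ), form (c.1, -c.2.1, c.2.2) w = form c (-w) := by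
    intro c w; simp [form]
  refine ⟨neg_mem_domain hz.1, fun c hc h0 => ?_⟩
  rw [← hform] at h0
  refine hz.2 (c.1, -c.2.1, c.2.2) ⟨⟨(intRing D).neg_mem hc.1.1, ?_, ?_, hc.1.2.2.2⟩,
    z, hz.1, h0⟩ h0
  · simpa using hc.1.2.1
  · simpa using hc.1.2.2.1

lemma transfer_comp_neg {f : ℂ → ℝ} (hf : ∀ z, f (-z) = f z) (z : ℂ) :
    transfer D f (-z) = transfer D f z := by
  rw [transfer, transfer, ← (Equiv.neg (intRing D)).tsum_eq]
  refine tsum_congr fun a => ?_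
  have e : (-z + ((-a : intRing D) : ℂ))⁻¹ = -(z + (a : ℂ))⁻¹ := by
    rw [← inv_neg]; congr 1; push_cast; ring
  rw [Equiv.neg_apply, e]
  by_cases h : (z + (a : ℂ))⁻¹ ∈ domain D
  · rw [weighted, Set.indicator_of_mem h, Set.indicator_of_mem (neg_mem_domain h), norm_neg, hf]
  · rw [weighted, Set.indicator_of_notMem h,
      Set.indicator_of_notMem (mt neg_mem_domain_iff.1 h)]

/-- The density is the limit of iterates of a constant, and the transfer operator preserves
evenness. -/
lemma density_even {f : ℂ → ℝ} {n : ℕ} {b : ℕ → ℝ}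
    (hb : Tendsto b atTop (𝓝 0)) (h : ∀ g, InCone D 44 g → mass D g = 1 →
      ∀ k, ∀ z ∈ regular D, |(transfer D)^[n * k] g z - f z| ≤ b k) {z : ℂ}
    (hz : z ∈ regular D) : f (-z) = f z := by
  have hv := volume_real_regular_pos (D := D)
  set g₀ : ℂ → ℝ := fun _ => (volume.real (regular D))⁻¹ with hg₀
  have hc₀ : InCone D 44 g₀ := inCone_const D (by norm_num) (inv_pos.2 hv).le
  have hm₀ : mass D g₀ = 1 := by rw [hg₀, mass_const, mul_inv_cancel₀ hv.ne']
  have hev : ∀ m : ℕ, ∀ z, (transfer D)^[m] g₀ (-z) = (transfer D)^[m] g₀ z := by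
    intro m
    induction m with
    | zero => exact fun _ => rfl
    | succ m ih =>
      intro z
      rw [Function.iterate_succ_apply']
      exact transfer_comp_neg ih z
  have lim : ∀ w ∈ regular D, Tendsto (fun k => (transfer D)^[n * k] g₀ w) atTop (𝓝 (f w)) := by
    intro w hw
    rw [tendsto_iff_norm_sub_tendsto_zero]
    exact squeeze_zero (fun _ => norm_nonneg _) (fun k => h g₀ hc₀ hm₀ k w hw) hb
  have h1 := lim _ (neg_mem_regular hz)
  simp only [hev] at h1
  exact tendsto_nhds_unique h1 (lim z hz)

lemma neg_mem_regular_iff {z : ℂ} : -z ∈ regular D ↔ z ∈ regular D :=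
  ⟨fun h => by simpa using neg_mem_regular h, neg_mem_regular⟩

lemma measurePreserving_neg {f : ℂ → ℝ} (hf : InCone D 44 f)
    (he : ∀ z ∈ regular D, f (-z) = f z) :
    MeasurePreserving (fun z : ℂ => -z) (densityMeasure D f) (densityMeasure D f) := by
  refine ⟨measurable_neg, ?_⟩
  ext E hE
  rw [Measure.map_apply measurable_neg hE]
  have key : ∀ A, MeasurableSet A → densityMeasure D f A =
      ∫⁻ z, (regular D).indicator (fun z => ENNReal.ofReal (f z) * A.indicator 1 z) z := by
    intro A hA
    rw [← lintegral_indicator_one hA, lintegral_densityMeasure hf (measurable_one.indicator hA),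
      lintegral_indicator measurableSet_regular]
  rw [key _ hE, key _ (measurable_neg hE), ← lintegral_neg_eq_self]
  refine lintegral_congr fun z => ?_
  by_cases hz : z ∈ regular D
  · rw [Set.indicator_of_mem hz, Set.indicator_of_mem (neg_mem_regular hz), he z hz]
    congr 1
    have hiff : -z ∈ (fun z : ℂ => -z) ⁻¹' E ↔ z ∈ E := by simp
    by_cases hzE : z ∈ E
    · rw [Set.indicator_of_mem hzE, Set.indicator_of_mem (hiff.2 hzE)]; rfl
    · rw [Set.indicator_of_notMem hzE, Set.indicator_of_notMem (mt hiff.1 hzE)]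
  · rw [Set.indicator_of_notMem hz, Set.indicator_of_notMem (mt neg_mem_regular_iff.1 hz)]

lemma densityMeasure_compl_regular (f : ℂ → ℝ) : ∀ᵐ z ∂(densityMeasure D f), z ∈ regular D := by
  have : densityMeasure D f ≪ volume.restrict (regular D) := withDensity_absolutelyContinuous _ _
  exact this (ae_restrict_mem measurableSet_regular)

/-- The strict domain is not symmetric on its boundary, so oddness of the integer part is obtained
through the regular set. -/
lemma intPart_neg {w : ℂ} (h : w - intPart D w ∈ regular D) : intPart D (-w) = -intPart D w := by
  refine intPart_eq (neg_mem (intPart_mem w)) (regular_subset_strictDomain ?_)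
  have : -w - -intPart D w = -(w - intPart D w) := by ring
  rw [this]
  exact neg_mem_regular h

omit hD in
lemma hurwitzMap_of_ne_zero {z : ℂ} (hz : z ≠ 0) : hurwitzMap D z = 1 / z - intPart D (1 / z) :=
  if_neg hz

lemma intPart_one_div_neg {z : ℂ} (hz : z ∈ regular D) (hG : hurwitzMap D z ∈ regular D) :
    intPart D (1 / -z) = -intPart D (1 / z) ∧ hurwitzMap D (-z) = -hurwitzMap D z := by
  have h0 := regular_ne_zero hz
  rw [hurwitzMap_of_ne_zero h0] at hG
  have h1 : intPart D (1 / -z) = -intPart D (1 / z) := by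
    rw [one_div_neg_eq_neg_one_div]
    exact intPart_neg hG
  refine ⟨h1, ?_⟩
  rw [hurwitzMap_of_ne_zero h0, hurwitzMap_of_ne_zero (neg_ne_zero.2 h0), h1,
    one_div_neg_eq_neg_one_div]
  ring

/-- The point and its first two images are regular almost everywhere, by invariance; that suffices
for both digits to change sign. -/
lemma period_neg_ae {f : ℂ → ℝ}
    (hμ : MeasurePreserving (hurwitzMap D) (densityMeasure D f) (densityMeasure D f)) :
    ∀ᵐ z ∂(densityMeasure D f), period D (-z) = -period D z := by
  have h1 := densityMeasure_compl_regular (D := D) f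
  have h2 := hμ.quasiMeasurePreserving.ae h1
  have h3 := hμ.quasiMeasurePreserving.ae h2
  filter_upwards [h1, h2, h3] with z hz1 hz2 hz3
  obtain ⟨e1, e2⟩ := intPart_one_div_neg hz1 hz2
  obtain ⟨e3, -⟩ := intPart_one_div_neg hz2 hz3
  rw [period, period, e2, e1, e3]
  simp
  ring

/-- The size of the first digit. -/
def digitSize (D : ℕ) (z : ℂ) : ℝ := 1 + ‖intPart D (1 / z)‖

omit hD in
lemma one_le_digitSize (z : ℂ) : 1 ≤ digitSize D z := by
  have := norm_nonneg (intPart D (1 / z)); unfold digitSize; linarith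

lemma measurable_digit : Measurable fun z => intPart D (1 / z) :=
  measurable_intPart.comp (measurable_const.div measurable_id)

lemma measurable_digitSize : Measurable (digitSize D) :=
  measurable_digit.norm.const_add 1

/-- The branch weight |a|⁻⁴ times |a|^{3/2} leaves exponent −5/2, which is summable over a plane
lattice. With an arbitrary H and the Lebesgue integral on the right, the bound can be applied twice
in a row. -/
lemma lintegral_digitSize_le {f : ℂ → ℝ} (hf : InCone D 44 f) {M : ℝ} (hM0 : 0 ≤ M)
    (hM : ∀ z ∈ regular D, |f z| ≤ M) :
    ∃ W < ∞, ∀ H : ℂ → ℝ≥0∞, Measurable H →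
      ∫⁻ z, ENNReal.ofReal (digitSize D z ^ (3 / 2 : ℝ)) * H (hurwitzMap D z) ∂(densityMeasure D f)
        ≤ W * ∫⁻ z in regular D, H z := by
  have hs : Summable fun a : intRing D => M * (81 * (1 + ‖(a : ℂ)‖) ^ (-(5 / 2) : ℝ)) :=
    ((summable_decay (by norm_num)).mul_left 81).mul_left M
  refine ⟨∑' a : intRing D, ENNReal.ofReal (M * (81 * (1 + ‖(a : ℂ)‖) ^ (-(5 / 2) : ℝ))),
    hs.tsum_ofReal_lt_top, fun H hH => ?_⟩
  have hm : Measurable fun z => ENNReal.ofReal (digitSize D z ^ (3 / 2 : ℝ)) * H (hurwitzMap D z) :=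
    (measurable_digitSize.pow_const _).ennreal_ofReal.mul (hH.comp measurable_hurwitzMap)
  rw [lintegral_densityMeasure_branches hf hm, ← lintegral_const_mul _ hH]
  refine setLIntegral_mono (hH.const_mul _) fun z hz => ?_
  rw [← ENNReal.tsum_mul_right]
  refine ENNReal.tsum_le_tsum fun a => ?_
  obtain ⟨h1, h2⟩ := hurwitzMap_inverse_branch hz a.2
  rw [h1, digitSize, h2, ← mul_assoc, ← ENNReal.ofReal_mul
    (weighted_branch_nonneg hf.nonneg hz a.2)]
  refine mul_le_mul_left ?_ _
  refine ENNReal.ofReal_le_ofReal ?_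
  have h3 := (le_abs_self _).trans (abs_weighted_le hM0 hM hz a.2)
  have h0 : 0 < 1 + ‖(a : ℂ)‖ := by positivity
  calc weighted D f (z + a)⁻¹ * (1 + ‖(a : ℂ)‖) ^ (3 / 2 : ℝ) ≤
      M * decay a * (1 + ‖(a : ℂ)‖) ^ (3 / 2 : ℝ) := by gcongr
    _ = M * (81 * ((1 + ‖(a : ℂ)‖) ^ (-4 : ℝ) * (1 + ‖(a : ℂ)‖) ^ (3 / 2 : ℝ))) := by
      rw [decay]; ring
    _ = _ := by rw [← Real.rpow_add h0]; norm_num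

/-- The dominating function in all error terms. -/
def moment (D : ℕ) (z : ℂ) : ℝ :=
  digitSize D z ^ (3 / 2 : ℝ) * digitSize D (hurwitzMap D z) ^ (3 / 2 : ℝ)

lemma measurable_moment : Measurable (moment D) :=
  (measurable_digitSize.pow_const _).mul
    ((measurable_digitSize.pow_const _).comp measurable_hurwitzMap)

lemma integrable_moment {f : ℂ → ℝ} (hf : InCone D 44 f) :
    Integrable (moment D) (densityMeasure D f) := by
  obtain ⟨M, hM⟩ := exists_bound_of_inCone (by norm_num) hf
  have hne : (regular D).Nonempty := by
    by_contra h
    rw [Set.not_nonempty_iff_eq_empty] at h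
    have := volume_regular_pos (D := D)
    simp [h] at this
  obtain ⟨w, hw⟩ := hne
  obtain ⟨W, hW, h⟩ := lintegral_digitSize_le hf ((abs_nonneg _).trans (hM w hw)) hM
  have hone : InCone D 44 fun _ => 1 := inCone_const D (by norm_num) zero_le_one
  obtain ⟨W', hW', h'⟩ := lintegral_digitSize_le hone zero_le_one (by simp)
  have hmeas : Measurable fun z => ENNReal.ofReal (digitSize D z ^ (3 / 2 : ℝ)) :=
    (measurable_digitSize.pow_const _).ennreal_ofReal
  have h1 := h _ hmeas
  have h2 := h' 1 measurable_one
  simp only [Pi.one_apply, mul_one] at h2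
  rw [lintegral_densityMeasure hone hmeas] at h2
  simp only [ENNReal.ofReal_one, one_mul] at h2
  have hfin : W * (W' * ∫⁻ z in regular D, 1) < ∞ := by
    refine ENNReal.mul_lt_top hW (ENNReal.mul_lt_top hW' ?_)
    simpa using volume_regular_lt_top
  refine ⟨measurable_moment.aestronglyMeasurable, ?_⟩
  rw [hasFiniteIntegral_iff_ofReal (ae_of_all _ fun z => ?_)]
  · refine lt_of_le_of_lt ?_ hfin
    refine le_trans (le_of_eq ?_) (h1.trans (by gcongr))
    refine lintegral_congr fun z => ?_
    have := one_le_digitSize (D := D) z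
    rw [moment, ENNReal.ofReal_mul (by positivity)]
  · have := one_le_digitSize (D := D) z
    have := one_le_digitSize (D := D) (hurwitzMap D z)
    show 0 ≤ moment D z
    unfold moment
    positivity

end Symmetry

/-! ### Expansions of cosine integrals, and reduction of the period to 1/z. -/

section Expansion

lemma one_sub_cos_le_rpow (a : ℝ) : 1 - Real.cos a ≤ 2 * |a| ^ (3 / 2 : ℝ) := by
  have h0 := abs_nonneg a
  rcases le_total |a| 1 with h | h
  · have h1 := Real.one_sub_sq_div_two_le_cos (x := a)
    have h2 : |a| ^ (2 : ℝ) ≤ |a| ^ (3 / 2 : ℝ) :=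
      Real.rpow_le_rpow_of_exponent_ge' h0 h (by norm_num) (by norm_num)
    rw [Real.rpow_two, sq_abs] at h2
    nlinarith [sq_nonneg a]
  · have h1 := Real.neg_one_le_cos a
    have h2 := Real.one_le_rpow h (by norm_num : (0 : ℝ) ≤ 3 / 2)
    linarith

lemma one_sub_cos_le_abs (a : ℝ) : 1 - Real.cos a ≤ |a| := by
  have h0 := abs_nonneg a
  rcases le_total |a| 2 with h | h
  · have h1 := Real.one_sub_sq_div_two_le_cos (x := a)
    have := sq_abs a
    nlinarith
  · linarith [Real.neg_one_le_cos a]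

lemma abs_sin_sub_le (a : ℝ) : |Real.sin a - a| ≤ 2 * |a| ^ (3 / 2 : ℝ) := by
  have h0 := abs_nonneg a
  rcases le_total |a| 1 with h | h
  · have h1 := Real.sin_bound h
    have h2 : |Real.sin a - a| ≤ |a| ^ 2 := by
      have e : Real.sin a - a = (Real.sin a - (a - a ^ 3 / 6)) - a ^ 3 / 6 := by ring
      have e3 : |a ^ 3 / 6| = |a| ^ 3 / 6 := by rw [abs_div, abs_pow]; norm_num
      rw [e]
      refine (abs_sub _ _).trans ?_
      rw [e3]
      have k3 : |a| ^ 3 ≤ |a| ^ 2 := pow_le_pow_of_le_one h0 h (by norm_num)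
      have k4 : |a| ^ 5 ≤ |a| ^ 2 := pow_le_pow_of_le_one h0 h (by norm_num)
      have := sq_nonneg |a|
      linarith
    have h3 : |a| ^ (2 : ℝ) ≤ |a| ^ (3 / 2 : ℝ) :=
      Real.rpow_le_rpow_of_exponent_ge' h0 h (by norm_num) (by norm_num)
    rw [Real.rpow_two] at h3
    have := Real.rpow_nonneg h0 (3 / 2)
    linarith
  · have h1 : |a| ^ (1 : ℝ) ≤ |a| ^ (3 / 2 : ℝ) := Real.rpow_le_rpow_of_exponent_le h (by norm_num)
    rw [Real.rpow_one] at h1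
    calc |Real.sin a - a| ≤ |Real.sin a| + |a| := abs_sub _ _
      _ ≤ 1 + |a| := by gcongr; exact Real.abs_sin_le_one a
      _ ≤ _ := by linarith

lemma abs_one_sub_cos_sub_le (b : ℝ) :
    |1 - Real.cos b - b ^ 2 / 2| ≤ 3 * |b| ^ (5 / 2 : ℝ) := by
  have h0 := abs_nonneg b
  have hs := sq_abs b
  rcases le_total |b| 1 with h | h
  · have h1 := Real.cos_bound h
    have h2 : |b| ^ (4 : ℝ) ≤ |b| ^ (5 / 2 : ℝ) :=
      Real.rpow_le_rpow_of_exponent_ge' h0 h (by norm_num) (by norm_num)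
    have h3 : |b| ^ (4 : ℝ) = |b| ^ 4 := by norm_cast
    rw [h3] at h2
    have e : 1 - Real.cos b - b ^ 2 / 2 = -(Real.cos b - (1 - b ^ 2 / 2)) := by ring
    rw [e, abs_neg]
    have := Real.rpow_nonneg h0 (5 / 2)
    linarith
  · have h1 : |b| ^ (2 : ℝ) ≤ |b| ^ (5 / 2 : ℝ) := Real.rpow_le_rpow_of_exponent_le h (by norm_num)
    rw [Real.rpow_two, hs] at h1
    have h2 := Real.one_le_rpow h (by norm_num : (0 : ℝ) ≤ 5 / 2)
    have h3 := Real.neg_one_le_cos b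
    have h4 := Real.cos_le_one b
    rw [abs_le]
    constructor <;> nlinarith [sq_nonneg b]

/-- With a = tx and b = ty the left side is −(1−cos a)(1−cos b) − (sin a − a) sin b − a(sin b − b).
Each term is bounded by a 3/2-power of one variable times the first power of the other, so t appears
to the power 5/2. -/
lemma abs_cos_product_le {x y u v : ℝ} (hx : |x| ≤ u) (hy : |y| ≤ v) (hu : 1 ≤ u) (hv : 1 ≤ v)
    (t : ℝ) :
    |(1 - Real.cos (t * (x - y))) - (1 - Real.cos (t * x)) - (1 - Real.cos (t * y)) + t ^ 2 * (x * y)|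
      ≤ 6 * |t| ^ (5 / 2 : ℝ) * (u ^ (3 / 2 : ℝ) * v ^ (3 / 2 : ℝ)) := by
  have hmon : ∀ {w r : ℝ}, |w| ≤ r → 1 ≤ r → |w| ≤ r ^ (3 / 2 : ℝ) ∧
      |w| ^ (3 / 2 : ℝ) ≤ r ^ (3 / 2 : ℝ) := by
    intro w r h1 h2
    refine ⟨h1.trans ?_, Real.rpow_le_rpow (abs_nonneg _) h1 (by norm_num)⟩
    have := Real.rpow_le_rpow_of_exponent_le h2 (show (1 : ℝ) ≤ 3 / 2 by norm_num)
    rwa [Real.rpow_one] at this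
  obtain ⟨x1, x2⟩ := hmon hx hu
  obtain ⟨y1, y2⟩ := hmon hy hv
  set a := t * x with ha
  set b := t * y with hb
  have e1 : (1 - Real.cos (t * (x - y))) - (1 - Real.cos a) - (1 - Real.cos b) + t ^ 2 * (x * y) =
      -((1 - Real.cos a) * (1 - Real.cos b)) - (Real.sin a - a) * Real.sin b
        - a * (Real.sin b - b) := by
    rw [mul_sub, Real.cos_sub, ← ha, ← hb, ha, hb]; ring
  have hta : |a| ^ (3 / 2 : ℝ) = |t| ^ (3 / 2 : ℝ) * |x| ^ (3 / 2 : ℝ) := by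
    rw [ha, abs_mul, Real.mul_rpow (abs_nonneg _) (abs_nonneg _)]
  have htb : |b| ^ (3 / 2 : ℝ) = |t| ^ (3 / 2 : ℝ) * |y| ^ (3 / 2 : ℝ) := by
    rw [hb, abs_mul, Real.mul_rpow (abs_nonneg _) (abs_nonneg _)]
  have ht : |t| ^ (3 / 2 : ℝ) * |t| = |t| ^ (5 / 2 : ℝ) := by
    rcases eq_or_ne t 0 with rfl | h
    · norm_num
    · nth_rewrite 2 [← Real.rpow_one |t|]
      rw [← Real.rpow_add (abs_pos.2 h)]; norm_num
  have hu0 : 0 ≤ u ^ (3 / 2 : ℝ) := by positivity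
  have hA : |a| ^ (3 / 2 : ℝ) * |b| ≤
      |t| ^ (5 / 2 : ℝ) * (u ^ (3 / 2 : ℝ) * v ^ (3 / 2 : ℝ)) := by
    rw [hta, hb, abs_mul, ← ht]
    calc _ = |t| ^ (3 / 2 : ℝ) * |t| * (|x| ^ (3 / 2 : ℝ) * |y|) := by ring
      _ ≤ _ := by gcongr
  have hB : |a| * |b| ^ (3 / 2 : ℝ) ≤
      |t| ^ (5 / 2 : ℝ) * (u ^ (3 / 2 : ℝ) * v ^ (3 / 2 : ℝ)) := by
    rw [htb, ha, abs_mul, ← ht]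
    calc _ = |t| ^ (3 / 2 : ℝ) * |t| * (|x| * |y| ^ (3 / 2 : ℝ)) := by ring
      _ ≤ _ := by gcongr
  have hsb : |Real.sin b| ≤ |b| := Real.abs_sin_le_abs
  have ca := Real.cos_le_one a
  have cb := Real.cos_le_one b
  rw [e1]
  calc _ ≤ |-((1 - Real.cos a) * (1 - Real.cos b)) - (Real.sin a - a) * Real.sin b|
        + |a * (Real.sin b - b)| := abs_sub _ _
    _ ≤ |-((1 - Real.cos a) * (1 - Real.cos b))| + |(Real.sin a - a) * Real.sin b|
        + |a * (Real.sin b - b)| := by gcongr; exact abs_sub _ _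
    _ = (1 - Real.cos a) * (1 - Real.cos b) + |Real.sin a - a| * |Real.sin b|
        + |a| * |Real.sin b - b| := by
      rw [abs_neg, abs_mul, abs_mul, abs_mul, abs_of_nonneg (by linarith : 0 ≤ 1 - Real.cos a),
        abs_of_nonneg (by linarith : 0 ≤ 1 - Real.cos b)]
    _ ≤ (2 * |a| ^ (3 / 2 : ℝ)) * |b| + (2 * |a| ^ (3 / 2 : ℝ)) * |b|
        + |a| * (2 * |b| ^ (3 / 2 : ℝ)) := by
      have k1 := one_sub_cos_le_rpow a
      have k2 := one_sub_cos_le_abs b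
      have k3 := abs_sin_sub_le a
      have k4 := abs_sin_sub_le b
      gcongr
    _ ≤ _ := by linarith

/-- Expansions `F(t) = C t² log|t| + C' t² + O(|t|^{5/2})` near zero. -/
def HasExpansion (F : ℝ → ℝ) (C C' : ℝ) : Prop :=
  ∃ K, ∀ᶠ t in 𝓝[≠] (0 : ℝ),
    |F t - (C * t ^ 2 * Real.log |t| + C' * t ^ 2)| ≤ K * |t| ^ (5 / 2 : ℝ)

lemma HasExpansion.add {F G : ℝ → ℝ} {C C' E E' : ℝ} (hF : HasExpansion F C C')
    (hG : HasExpansion G E E') : HasExpansion (fun t => F t + G t) (C + E) (C' + E') := by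
  obtain ⟨K, hK⟩ := hF
  obtain ⟨L, hL⟩ := hG
  refine ⟨K + L, ?_⟩
  filter_upwards [hK, hL] with t h1 h2
  have e : F t + G t - ((C + E) * t ^ 2 * Real.log |t| + (C' + E') * t ^ 2) =
      (F t - (C * t ^ 2 * Real.log |t| + C' * t ^ 2)) +
      (G t - (E * t ^ 2 * Real.log |t| + E' * t ^ 2)) := by ring
  rw [e, add_mul]
  exact (abs_add_le _ _).trans (add_le_add h1 h2)

lemma HasExpansion.const_mul {F : ℝ → ℝ} {C C' : ℝ} (hF : HasExpansion F C C') (a : ℝ) :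
    HasExpansion (fun t => a * F t) (a * C) (a * C') := by
  obtain ⟨K, hK⟩ := hF
  refine ⟨|a| * K, ?_⟩
  filter_upwards [hK] with t h1
  have e : a * F t - (a * C * t ^ 2 * Real.log |t| + a * C' * t ^ 2) =
      a * (F t - (C * t ^ 2 * Real.log |t| + C' * t ^ 2)) := by ring
  rw [e, abs_mul]
  exact (mul_le_mul_of_nonneg_left h1 (abs_nonneg a)).trans_eq (by ring)

lemma hasExpansion_of_quadratic {F : ℝ → ℝ} {C K : ℝ}
    (h : ∀ t, |F t - C * t ^ 2| ≤ K * |t| ^ (5 / 2 : ℝ)) : HasExpansion F 0 C :=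
  ⟨K, Eventually.of_forall fun t => by simpa using h t⟩

section Abstract

variable {Ω : Type*} [MeasurableSpace Ω] {μ : Measure Ω} [IsFiniteMeasure μ]

lemma integrable_one_sub_cos {x : Ω → ℝ} (hx : Measurable x) (t : ℝ) :
    Integrable (fun ω => 1 - Real.cos (t * x ω)) μ := by
  refine Integrable.of_bound (Measurable.aestronglyMeasurable (by fun_prop)) 2
    (ae_of_all _ fun ω => ?_)
  have h1 := Real.neg_one_le_cos (t * x ω)
  have h2 := Real.cos_le_one (t * x ω)
  rw [Real.norm_eq_abs, abs_le]
  constructor <;> linarith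

/-- No second moment of x or y is required: only the mixed moment ∫ x y enters, as the coefficient
of t². -/
lemma exists_integral_cos_sub {x y u v : Ω → ℝ} (hx : Measurable x) (hy : Measurable y)
    (hxu : ∀ᵐ ω ∂μ, |x ω| ≤ u ω) (hyv : ∀ᵐ ω ∂μ, |y ω| ≤ v ω) (hu : ∀ ω, 1 ≤ u ω)
    (hv : ∀ ω, 1 ≤ v ω)
    (hi : Integrable (fun ω => u ω ^ (3 / 2 : ℝ) * v ω ^ (3 / 2 : ℝ)) μ) :
    ∃ E, HasExpansion (fun t => (∫ ω, (1 - Real.cos (t * (x ω - y ω))) ∂μ)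
      + -1 * (∫ ω, (1 - Real.cos (t * x ω)) ∂μ) + -1 * ∫ ω, (1 - Real.cos (t * y ω)) ∂μ) 0 E := by
  have hxy : Integrable (fun ω => x ω * y ω) μ := by
    refine hi.mono' (hx.mul hy).aestronglyMeasurable ?_
    filter_upwards [hxu, hyv] with ω h1 h2
    rw [norm_mul, Real.norm_eq_abs, Real.norm_eq_abs]
    have k1 := Real.rpow_le_rpow_of_exponent_le (hu ω) (show (1 : ℝ) ≤ 3 / 2 by norm_num)
    have k2 := Real.rpow_le_rpow_of_exponent_le (hv ω) (show (1 : ℝ) ≤ 3 / 2 by norm_num)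
    rw [Real.rpow_one] at k1 k2
    have := hu ω
    gcongr
    · exact h1.trans k1
    · exact h2.trans k2
  refine ⟨-∫ ω, x ω * y ω ∂μ, hasExpansion_of_quadratic
    (K := ∫ ω, 6 * (u ω ^ (3 / 2 : ℝ) * v ω ^ (3 / 2 : ℝ)) ∂μ) fun t => ?_⟩
  have i1 : Integrable (fun ω => 1 - Real.cos (t * (x ω - y ω))) μ :=
    integrable_one_sub_cos (hx.sub hy) t
  have i2 := integrable_one_sub_cos (μ := μ) hx t
  have i3 := integrable_one_sub_cos (μ := μ) hy t
  have i12 : Integrable (fun ω => 1 - Real.cos (t * (x ω - y ω)) - (1 - Real.cos (t * x ω))) μ :=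
    i1.sub i2
  have i123 : Integrable (fun ω => 1 - Real.cos (t * (x ω - y ω)) - (1 - Real.cos (t * x ω))
      - (1 - Real.cos (t * y ω))) μ := i12.sub i3
  have e : (∫ ω, (1 - Real.cos (t * (x ω - y ω))) ∂μ)
      + -1 * (∫ ω, (1 - Real.cos (t * x ω)) ∂μ) + -1 * (∫ ω, (1 - Real.cos (t * y ω)) ∂μ)
      - (-∫ ω, x ω * y ω ∂μ) * t ^ 2 =
      ∫ ω, ((1 - Real.cos (t * (x ω - y ω))) - (1 - Real.cos (t * x ω))
        - (1 - Real.cos (t * y ω)) + t ^ 2 * (x ω * y ω)) ∂μ := by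
    rw [integral_add i123 (hxy.const_mul _), integral_sub i12 i3,
      integral_sub i1 i2, integral_const_mul]
    ring
  rw [e, ← Real.norm_eq_abs, ← integral_mul_const]
  refine norm_integral_le_of_norm_le ((hi.const_mul 6).mul_const _) ?_
  filter_upwards [hxu, hyv] with ω h1 h2
  refine (abs_cos_product_le h1 h2 (hu ω) (hv ω) t).trans (le_of_eq (by ring))

/-- A weighted moment of order 5/2 is enough for the Taylor expansion 1 − cos b = b²/2 +
O(|b|^{5/2}), so no logarithm arises. The weight e may change sign. -/
lemma exists_integral_mul_cos {Ω : Type*} [MeasurableSpace Ω] {μ : Measure Ω} {e x : Ω → ℝ}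
    (he : Integrable e μ) (hx : Measurable x)
    (h : Integrable (fun ω => |e ω| * |x ω| ^ (5 / 2 : ℝ)) μ) :
    ∃ E, HasExpansion (fun t => ∫ ω, e ω * (1 - Real.cos (t * x ω)) ∂μ) 0 E := by
  have h0 : ∀ t : ℝ, Integrable (fun ω => e ω * (1 - Real.cos (t * x ω))) μ := fun t => by
    refine (he.norm.mul_const 2).mono' (he.aestronglyMeasurable.mul
      (Measurable.aestronglyMeasurable (by fun_prop))) (ae_of_all _ fun ω => ?_)
    have h1 := Real.neg_one_le_cos (t * x ω)
    have h2 := Real.cos_le_one (t * x ω)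
    rw [norm_mul]
    gcongr
    rw [Real.norm_eq_abs, abs_le]
    constructor <;> linarith
  have h2 : Integrable (fun ω => e ω * x ω ^ 2) μ := by
    refine (he.norm.add h).mono' (he.aestronglyMeasurable.mul
      (hx.pow_const 2).aestronglyMeasurable) (ae_of_all _ fun ω => ?_)
    have h1 : |x ω| ^ 2 ≤ 1 + |x ω| ^ (5 / 2 : ℝ) := by
      have h0 := abs_nonneg (x ω)
      have k0 := Real.rpow_nonneg h0 (5 / 2)
      rcases le_total |x ω| 1 with h | h
      · nlinarith
      · have := Real.rpow_le_rpow_of_exponent_le h (show (2 : ℝ) ≤ 5 / 2 by norm_num)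
        rw [Real.rpow_two] at this
        linarith
    have e1 : ‖e ω * x ω ^ 2‖ = |e ω| * |x ω| ^ 2 := by
      rw [norm_mul, norm_pow, Real.norm_eq_abs, Real.norm_eq_abs]
    rw [e1]
    refine (mul_le_mul_of_nonneg_left h1 (abs_nonneg _)).trans_eq ?_
    simp only [Pi.add_apply, Real.norm_eq_abs]
    ring
  refine ⟨(∫ ω, e ω * x ω ^ 2 ∂μ) / 2, hasExpansion_of_quadratic
    (K := ∫ ω, 3 * (|e ω| * |x ω| ^ (5 / 2 : ℝ)) ∂μ) fun t => ?_⟩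
  have e1 : (∫ ω, e ω * (1 - Real.cos (t * x ω)) ∂μ) - (∫ ω, e ω * x ω ^ 2 ∂μ) / 2 * t ^ 2 =
      ∫ ω, e ω * (1 - Real.cos (t * x ω) - (t * x ω) ^ 2 / 2) ∂μ := by
    have : ∀ ω, e ω * (1 - Real.cos (t * x ω) - (t * x ω) ^ 2 / 2) =
        e ω * (1 - Real.cos (t * x ω)) - (t ^ 2 / 2) * (e ω * x ω ^ 2) := fun ω => by ring
    simp only [this]
    rw [integral_sub (h0 t) (h2.const_mul _), integral_const_mul]
    ring
  rw [e1, ← Real.norm_eq_abs, ← integral_mul_const]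
  refine norm_integral_le_of_norm_le ((h.const_mul 3).mul_const _) (ae_of_all _ fun ω => ?_)
  have h1 := abs_one_sub_cos_sub_le (t * x ω)
  rw [norm_mul, Real.norm_eq_abs, Real.norm_eq_abs]
  calc _ ≤ |e ω| * (3 * |t * x ω| ^ (5 / 2 : ℝ)) := by gcongr
    _ = _ := by
      rw [abs_mul, Real.mul_rpow (abs_nonneg _) (abs_nonneg _)]; ring

end Abstract

variable {D : ℕ} [hD : Fact (D = 2 ∨ D = 7 ∨ D = 11)]

/-- The constant `2 / √D`. -/
def scale (D : ℕ) : ℝ := 2 / Real.sqrt D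

lemma scale_pos : 0 < scale D := by
  have : (0 : ℝ) < D := by rcases hD.out with rfl | rfl | rfl <;> norm_num
  unfold scale
  positivity

lemma scale_le : scale D ≤ 2 := by
  have : (1 : ℝ) ≤ D := by rcases hD.out with rfl | rfl | rfl <;> norm_num
  have h1 : 1 ≤ Real.sqrt D := Real.one_le_sqrt.2 this
  unfold scale
  rw [div_le_iff₀ (by linarith)]
  linarith

/-- The first digit contribution to the period function. -/
def digitHeight (D : ℕ) (z : ℂ) : ℝ := scale D * (intPart D (1 / z)).im

lemma measurable_digitHeight : Measurable (digitHeight D) :=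
  (measurable_im.comp measurable_digit).const_mul _

omit hD in
lemma period_eq (z : ℂ) : period D z = digitHeight D z - digitHeight D (hurwitzMap D z) := by
  rw [period, digitHeight, digitHeight, sub_im, scale]; ring

lemma abs_digitHeight_le (z : ℂ) : |digitHeight D z| ≤ 2 * digitSize D z := by
  have h1 := abs_im_le_norm (intPart D (1 / z))
  have h2 := scale_le (D := D)
  have h3 := scale_pos (D := D)
  rw [digitHeight, digitSize, abs_mul, abs_of_pos h3]
  have := abs_nonneg (intPart D (1 / z)).im
  nlinarith

/-- Two splittings are used: the period is φ − φ∘𝒢, and φ = p − d with p from 1/z and d from 𝒢(z),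
bounded by 2. By invariance φ and φ∘𝒢 have the same law, which gives the factor 2. -/
lemma exists_expansion_period {f : ℂ → ℝ} (hf : InCone D 44 f) (hm : mass D f = 1)
    (hμ : MeasurePreserving (hurwitzMap D) (densityMeasure D f) (densityMeasure D f)) {C C' : ℝ}
    (h : HasExpansion
      (fun t => ∫ z, (1 - Real.cos (t * (scale D * (1 / z).im))) ∂(densityMeasure D f)) C C') :
    ∃ E, HasExpansion (fun t => ∫ z, (1 - Real.cos (t * period D z)) ∂(densityMeasure D f))
      (2 * C) E := by
  have hprob := isProbabilityMeasure_densityMeasure hf hm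
  set μ := densityMeasure D f with hμdef
  have hreg : ∀ᵐ z ∂μ, z ∈ regular D := densityMeasure_compl_regular f
  have hregG : ∀ᵐ z ∂μ, hurwitzMap D z ∈ regular D := hμ.quasiMeasurePreserving.ae hreg
  have hmom : Integrable (moment D) μ := integrable_moment hf
  have hG := measurable_hurwitzMap (D := D)
  have hX := measurable_digitSize (D := D)
  have hφ := measurable_digitHeight (D := D)
  have hX1 : ∀ z, 1 ≤ digitSize D z := one_le_digitSize
  obtain ⟨E₁, h1⟩ := exists_integral_cos_sub (μ := μ) (x := digitHeight D)
    (y := fun z => digitHeight D (hurwitzMap D z)) (u := fun z => 2 * digitSize D z)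
    (v := fun z => 2 * digitSize D (hurwitzMap D z)) hφ (hφ.comp hG)
    (ae_of_all _ abs_digitHeight_le) (ae_of_all _ fun z => abs_digitHeight_le _)
    (fun z => by linarith [hX1 z]) (fun z => by linarith [hX1 (hurwitzMap D z)]) (by
      refine (hmom.const_mul (2 ^ (3 / 2 : ℝ) * 2 ^ (3 / 2 : ℝ))).congr (ae_of_all _ fun z => ?_)
      have := hX1 z
      have := hX1 (hurwitzMap D z)
      simp only [moment]
      rw [Real.mul_rpow (by norm_num) (by linarith), Real.mul_rpow (by norm_num) (by linarith)]
      ring)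
  set p : ℂ → ℝ := fun z => scale D * (1 / z).im with hp
  have hpm : Measurable p :=
    (measurable_im.comp (measurable_const.div measurable_id)).const_mul _
  set d : ℂ → ℝ := fun z => scale D * (hurwitzMap D z).im with hd
  have hdm : Measurable d := (measurable_im.comp hG).const_mul _
  have hpd : ∀ᵐ z ∂μ, p z - d z = digitHeight D z := by
    filter_upwards [hreg] with z hz
    simp only [hp, hd, digitHeight]
    rw [hurwitzMap_of_ne_zero (regular_ne_zero hz), sub_im]
    ring
  have hd2 : ∀ᵐ z ∂μ, |d z| ≤ 2 := by
    filter_upwards [hregG] with z hz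
    have k1 := (abs_im_le_norm (hurwitzMap D z)).trans (norm_le_of_mem_domain hz.1)
    have k2 := scale_le (D := D)
    have k3 := scale_pos (D := D)
    simp only [hd]
    rw [abs_mul, abs_of_pos k3]
    have := abs_nonneg (hurwitzMap D z).im
    nlinarith
  have hp4 : ∀ᵐ z ∂μ, |p z| ≤ 4 * digitSize D z := by
    filter_upwards [hpd, hd2] with z h1 h2
    have e : p z = digitHeight D z + d z := by linarith
    rw [e]
    refine (abs_add_le _ _).trans ?_
    have := abs_digitHeight_le (D := D) z
    linarith [hX1 z]
  obtain ⟨E₂, h2⟩ := exists_integral_cos_sub (μ := μ) (x := p) (y := d)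
    (u := fun z => 4 * digitSize D z) (v := fun _ => 2) hpm hdm hp4 hd2
    (fun z => by linarith [hX1 z]) (fun _ => by norm_num) (by
      refine (hmom.const_mul (4 ^ (3 / 2 : ℝ) * 2 ^ (3 / 2 : ℝ))).mono'
        (((hX.const_mul 4).pow_const _).mul_const _).aestronglyMeasurable (ae_of_all _ fun z => ?_)
      have k1 := hX1 z
      have k2 := Real.one_le_rpow (hX1 (hurwitzMap D z)) (by norm_num : (0 : ℝ) ≤ 3 / 2)
      rw [Real.norm_of_nonneg (by positivity), Real.mul_rpow (by norm_num) (by linarith), moment]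
      have k3 : 0 ≤ (4 : ℝ) ^ (3 / 2 : ℝ) * 2 ^ (3 / 2 : ℝ) * digitSize D z ^ (3 / 2 : ℝ) := by
        positivity
      nlinarith)
  obtain ⟨E₃, h3⟩ := exists_integral_mul_cos (μ := μ) (e := fun _ => 1) (x := d)
    (integrable_const 1) hdm (by
      refine Integrable.of_bound (Measurable.aestronglyMeasurable (by fun_prop)) (2 ^ (5 / 2 : ℝ)) ?_
      filter_upwards [hd2] with z hz
      rw [abs_one, one_mul, Real.norm_of_nonneg (Real.rpow_nonneg (abs_nonneg _) _)]
      exact Real.rpow_le_rpow (abs_nonneg _) hz (by norm_num))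
  have e1 : ∀ t : ℝ, ∫ z, (1 - Real.cos (t * (p z - d z))) ∂μ =
      ∫ z, (1 - Real.cos (t * digitHeight D z)) ∂μ := fun t => by
    refine integral_congr_ae ?_
    filter_upwards [hpd] with z hz
    rw [hz]
  have e2 : ∀ t : ℝ, ∫ z, (1 - Real.cos (t * digitHeight D (hurwitzMap D z))) ∂μ =
      ∫ z, (1 - Real.cos (t * digitHeight D z)) ∂μ := fun t => by
    have hmeas : Measurable fun z => 1 - Real.cos (t * digitHeight D z) := by fun_prop
    have := integral_map hG.aemeasurable (μ := μ) (f := fun z => 1 - Real.cos (t * digitHeight D z))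
      hmeas.aestronglyMeasurable
    rw [hμ.map_eq] at this
    exact this.symm
  simp only [one_mul] at h3
  have h4 := (h2.add h).add h3
  have h5 := h1.add (h4.const_mul 2)
  refine ⟨E₁ + 2 * (E₂ + C' + E₃), ?_⟩
  convert h5 using 1
  · funext t
    simp only [e1, e2, period_eq]
    ring
  · ring

/-- The characteristic function is the real cosine integral. -/
lemma integral_exp_period {f : ℂ → ℝ} (hf : InCone D 44 f)
    (he : ∀ z ∈ regular D, f (-z) = f z)
    (hμ : IsInvariantMeasure D (densityMeasure D f)) (t : ℝ) :
    ∫ z in domain D, (exp (I * t * period D z) - 1) ∂(densityMeasure D f) =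
      ((-∫ z, (1 - Real.cos (t * period D z)) ∂(densityMeasure D f) : ℝ) : ℂ) := by
  have hprob := hμ.isProbabilityMeasure
  have hmp := hμ.measurePreserving
  set μ := densityMeasure D f with hμdef
  have hres : μ.restrict (domain D) = μ := by
    refine Measure.restrict_eq_self_of_ae_mem ?_
    filter_upwards [densityMeasure_compl_regular (D := D) f] with z hz using hz.1
  have hΨ : Measurable (period D) := by
    have : period D = fun z => digitHeight D z - digitHeight D (hurwitzMap D z) :=
      funext period_eq
    rw [this]
    exact measurable_digitHeight.sub (measurable_digitHeight.comp measurable_hurwitzMap)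
  -- The measure is even and the period is odd almost everywhere.
  have hsin : ∫ z, Real.sin (t * period D z) ∂μ = 0 := by
    have hneg := measurePreserving_neg hf he
    have h1 := integral_map measurable_neg.aemeasurable (μ := μ)
      (f := fun z => Real.sin (t * period D z)) (Measurable.aestronglyMeasurable (by fun_prop))
    rw [hneg.map_eq] at h1
    have h2 : ∫ z, Real.sin (t * period D (-z)) ∂μ = -∫ z, Real.sin (t * period D z) ∂μ := by
      rw [← integral_neg]
      refine integral_congr_ae ?_
      filter_upwards [period_neg_ae hmp] with z hz
      rw [hz, mul_neg, Real.sin_neg]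
    rw [h2] at h1
    linarith
  have hc : Integrable (fun z => Real.cos (t * period D z) - 1) μ := by
    have := (integrable_one_sub_cos (μ := μ) hΨ t).neg
    refine this.congr (ae_of_all _ fun z => ?_)
    simp
  have hs : Integrable (fun z => Real.sin (t * period D z)) μ :=
    Integrable.of_bound (Measurable.aestronglyMeasurable (by fun_prop)) 1
      (ae_of_all _ fun z => Real.abs_sin_le_one _)
  have e : ∀ z, exp (I * t * period D z) - 1 =
      ((Real.cos (t * period D z) - 1 : ℝ) : ℂ) + ((Real.sin (t * period D z) : ℝ) : ℂ) * I := by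
    intro z
    have : I * t * period D z = ((t * period D z : ℝ) : ℂ) * I := by push_cast; ring
    rw [this, exp_mul_I]
    push_cast
    ring
  rw [hres]
  simp only [e]
  have i1 : Integrable (fun z => ((Real.cos (t * period D z) - 1 : ℝ) : ℂ)) μ := hc.ofReal
  have i2 : Integrable (fun z => ((Real.sin (t * period D z) : ℝ) : ℂ)) μ := hs.ofReal
  rw [integral_add i1 (i2.mul_const I), integral_mul_const, integral_complex_ofReal,
    integral_complex_ofReal, hsin, ofReal_zero, zero_mul, add_zero, ← integral_neg]
  congr 2
  funext z
  ring

end Expansion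

/-! ### Behaviour of the density near zero. -/

section DirectionalLimit

variable {D : ℕ} [hD : Fact (D = 2 ∨ D = 7 ∨ D = 11)]

/-- The points close to the tangent line at zero of some form vanishing at zero. -/
def Tangential (D : ℕ) (z : ℂ) : Prop :=
  ∃ c ∈ forms D, c.2.2 = 0 ∧ |(c.2.1 * z).re| ≤ 10 * ‖z‖ ^ 2

omit hD in
lemma not_tangential_smul {z : ℂ} (hz : ¬Tangential D z) {r : ℝ} (h0 : 0 < r) (h1 : r ≤ 1) :
    ¬Tangential D (r * z) := by
  rintro ⟨c, hc, hC, h⟩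
  refine hz ⟨c, hc, hC, ?_⟩
  have e : c.2.1 * (r * z) = r * (c.2.1 * z) := by ring
  rw [e, re_ofReal_mul, abs_mul, abs_of_pos h0, norm_mul, norm_real, Real.norm_of_nonneg h0.le] at h
  have h3 : r * |(c.2.1 * z).re| ≤ r * (10 * ‖z‖ ^ 2) := by
    refine h.trans ?_
    have : 0 ≤ r * (1 - r) * ‖z‖ ^ 2 :=
      mul_nonneg (mul_nonneg h0.le (by linarith)) (sq_nonneg _)
    nlinarith
  exact le_of_mul_le_mul_left h3 h0

/-- For |z| ≤ 1/50 and C ≠ 0 the constant term dominates, as 20|z|² + 44|z| < 1 ≤ |C|. For C = 0 the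
linear part exceeds 20|z|² ≥ |A||z|² because z is not tangential. -/
lemma form_sign_near_zero {z : ℂ} (hz : ‖z‖ ≤ 1 / 50) (ht : ¬Tangential D z)
    {c : ℤ × ℂ × ℤ} (hc : c ∈ forms D) : form c z ≠ 0 ∧
    (0 < form c z ↔ 0 < if c.2.2 = 0 then (c.2.1 * z).re else c.2.2) := by
  obtain ⟨A, B, C⟩ := c
  obtain ⟨w, hw, hw0⟩ := hc.2
  obtain ⟨-, hB⟩ := abs_coeff_le hc.1 hw hw0
  have hA := hc.1.2.2.2
  have hn := norm_nonneg z
  simp only at hA hB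
  have hA2 : |(A : ℝ) * ‖z‖ ^ 2| ≤ 20 * ‖z‖ ^ 2 := by
    rw [abs_mul, abs_of_nonneg (sq_nonneg ‖z‖)]
    gcongr
  simp only [form, normSq_eq_norm_sq]
  by_cases hC : C = 0
  · have h1 : 10 * ‖z‖ ^ 2 < |(B * z).re| := by
      by_contra h
      exact ht ⟨_, hc, hC, not_lt.1 h⟩
    subst hC
    simp only [if_true, Int.cast_zero, add_zero]
    rw [abs_le] at hA2
    rcases lt_abs.1 h1 with h | h
    · exact ⟨by linarith, by constructor <;> intro <;> nlinarith⟩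
    · exact ⟨by linarith, by constructor <;> intro <;> nlinarith⟩
  · have h1 : |(B * z).re| ≤ 22 * ‖z‖ := by
      refine (abs_re_le_norm _).trans ?_
      rw [norm_mul]
      gcongr
    simp only [if_neg hC]
    rw [abs_le] at hA2 h1
    have h2 : ‖z‖ ^ 2 ≤ 1 / 2500 := by nlinarith
    rcases lt_or_gt_of_ne hC with h | h
    · have h' : (C : ℝ) ≤ -1 := by exact_mod_cast Int.le_sub_one_of_lt h
      refine ⟨by linarith, ?_⟩
      constructor <;> intro <;> linarith
    · have h' : (1 : ℝ) ≤ C := by exact_mod_cast h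
      refine ⟨by linarith, ?_⟩
      constructor <;> intro <;> linarith

lemma mem_regular_of_not_tangential {z : ℂ} (hz : ‖z‖ ≤ 1 / 50) (ht : ¬Tangential D z) :
    z ∈ regular D :=
  ⟨mem_domain_of_norm_le (hz.trans (by norm_num)), fun _ hc => (form_sign_near_zero hz ht hc).1⟩

lemma norm_smul_le_of_le_one {z : ℂ} {r : ℝ} (h0 : 0 < r) (h1 : r ≤ 1) :
    ‖(r : ℂ) * z‖ ≤ ‖z‖ := by
  rw [norm_mul, norm_real, Real.norm_of_nonneg h0.le]
  exact mul_le_of_le_one_left (norm_nonneg z) h1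

lemma sameCell_smul {z : ℂ} (hz : ‖z‖ ≤ 1 / 50) (ht : ¬Tangential D z) {r : ℝ} (h0 : 0 < r)
    (h1 : r ≤ 1) : SameCell D z (r * z) := by
  intro c hc
  rw [(form_sign_near_zero hz ht hc).2, (form_sign_near_zero
    ((norm_smul_le_of_le_one h0 h1).trans hz) (not_tangential_smul ht h0 h1) hc).2]
  split_ifs with h
  · have e : c.2.1 * (r * z) = r * (c.2.1 * z) := by ring
    rw [e, re_ofReal_mul]
    exact (mul_pos_iff_of_pos_left h0).symm
  · rfl

lemma InCone.abs_sub_le {f : ℂ → ℝ} (hf : InCone D 44 f) {M : ℝ}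
    (hM : ∀ z ∈ regular D, f z ≤ M) {z z' : ℂ} (hz : z ∈ regular D) (hz' : z' ∈ regular D)
    (h : SameCell D z z') : |f z - f z'| ≤ 44 * Real.exp 88 * M * ‖z - z'‖ := by
  have key : ∀ z z', z ∈ regular D → z' ∈ regular D → SameCell D z z' →
      f z - f z' ≤ 44 * Real.exp 88 * M * ‖z - z'‖ := by
    intro z z' hz hz' h
    have h1 := hf.le_exp z hz z' hz' h
    have h2 := norm_sub_le_of_mem_domain hz.1 hz'.1
    have h3 := hM z' hz'
    have h4 := hf.nonneg z' hz'
    have h5 := norm_nonneg (z - z')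
    set a := 44 * ‖z - z'‖ with ha
    -- e^a − 1 ≤ a e^a, and a ≤ 88.
    have h6 : Real.exp a - 1 ≤ a * Real.exp 88 := by
      have k1 := Real.add_one_le_exp (-a)
      have k2 : Real.exp a * Real.exp (-a) = 1 := by rw [← Real.exp_add]; simp
      have k3 : Real.exp a ≤ Real.exp 88 := Real.exp_le_exp.2 (by linarith)
      have k4 := Real.exp_pos a
      have k5 : 0 ≤ a := by positivity
      nlinarith
    calc f z - f z' ≤ (Real.exp a - 1) * f z' := by linarith
      _ ≤ a * Real.exp 88 * f z' := by gcongr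
      _ ≤ a * Real.exp 88 * M := by gcongr
      _ = _ := by rw [ha]; ring
  rw [abs_le]
  have k1 := key z z' hz hz' h
  have k2 := key z' z hz' hz h.symm
  rw [norm_sub_rev] at k2
  constructor <;> linarith

lemma limsup_mem_Icc {u : ℕ → ℝ} {a b : ℝ} (h : ∀ᶠ n in atTop, u n ∈ Set.Icc a b) :
    limsup u atTop ∈ Set.Icc a b := by
  have hb : IsBoundedUnder (· ≤ ·) atTop u := ⟨b, by
    rw [eventually_map]; exact h.mono fun n hn => hn.2⟩
  have ha : IsBoundedUnder (· ≥ ·) atTop u := ⟨a, by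
    rw [eventually_map]; exact h.mono fun n hn => hn.1⟩
  exact ⟨le_limsup_of_frequently_le (h.mono fun n hn => hn.1).frequently hb,
    limsup_le_of_le ha.isCoboundedUnder_le (h.mono fun n hn => hn.2)⟩

/-- Near zero, a density in the cone is close to a function of the direction only. -/
lemma exists_directional_limit {f : ℂ → ℝ} (hf : InCone D 44 f) {δ M : ℝ} (hδM : δ ≤ M)
    (hM : ∀ z ∈ regular D, f z ∈ Set.Icc δ M) :
    ∃ g : ℂ → ℝ, Measurable g ∧ (∀ z, g z ∈ Set.Icc δ M) ∧
      (∀ z, ∀ r : ℝ, 0 < r → g (r * z) = g z) ∧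
      ∃ K : ℝ, ∀ z, z ≠ 0 → ‖z‖ ≤ 1 / 50 → ¬Tangential D z → |f z - g z| ≤ K * ‖z‖ := by
  classical
  set F : ℂ → ℝ := fun z => (regular D).indicator f z + (regular D)ᶜ.indicator (fun _ => δ) z
    with hF
  have hFm : Measurable F :=
    hf.measurable_indicator.add (measurable_const.indicator measurableSet_regular.compl)
  have hFr : ∀ z ∈ regular D, F z = f z := fun z hz => by simp [hF, hz]
  have hFb : ∀ z, F z ∈ Set.Icc δ M := fun z => by
    by_cases hz : z ∈ regular D
    · rw [hFr z hz]; exact hM z hz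
    · simp [hF, hz, hδM]
  -- These points depend only on the direction of z and tend to 0. The limsup of f along them is
  -- measurable and defined everywhere; for non-tangential z the ray eventually stays in the cell of
  -- z.
  set ray : ℂ → ℕ → ℂ := fun z n => z / ((100 * ‖z‖ * (n + 1) : ℝ) : ℂ) with hray
  refine ⟨fun z => limsup (fun n => F (ray z n)) atTop, ?_, fun z => ?_, fun z r hr => ?_,
    44 * Real.exp 88 * M, fun z hz0 hz ht => ?_⟩
  · exact Measurable.limsup fun n => hFm.comp (by fun_prop)
  · exact limsup_mem_Icc (Eventually.of_forall fun n => hFb _)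
  · have : ray (r * z) = ray z := by
      funext n
      simp only [hray]
      rw [norm_mul, norm_real, Real.norm_of_nonneg hr.le]
      have hr' : (r : ℂ) ≠ 0 := ofReal_ne_zero.2 hr.ne'
      have e : ((100 * (r * ‖z‖) * (n + 1) : ℝ) : ℂ) = r * ((100 * ‖z‖ * (n + 1) : ℝ) : ℂ) := by
        push_cast; ring
      rw [e, mul_div_mul_left _ _ hr']
    simp only [this]
  · have hzp : 0 < ‖z‖ := norm_pos_iff.2 hz0
    have hM0 : 0 ≤ M := (hf.nonneg z (mem_regular_of_not_tangential hz ht)).trans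
      (hM z (mem_regular_of_not_tangential hz ht)).2
    have hev : ∀ᶠ n : ℕ in atTop, F (ray z n) ∈
        Set.Icc (f z - 44 * Real.exp 88 * M * ‖z‖) (f z + 44 * Real.exp 88 * M * ‖z‖) := by
      obtain ⟨N, hN⟩ := exists_nat_ge (1 / (100 * ‖z‖))
      filter_upwards [eventually_ge_atTop N] with n hn
      set r : ℝ := 1 / (100 * ‖z‖ * (n + 1)) with hr
      have hr0 : 0 < r := by positivity
      have hr1 : r ≤ 1 := by
        rw [hr, div_le_one (by positivity)]
        rw [div_le_iff₀ (by positivity)] at hN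
        have : (N : ℝ) ≤ n := by exact_mod_cast hn
        nlinarith
      have e : ray z n = r * z := by
        simp only [hray, hr]; push_cast; ring
      have hz' := (norm_smul_le_of_le_one (z := z) hr0 hr1).trans hz
      have hreg := mem_regular_of_not_tangential hz ht
      have hreg' := mem_regular_of_not_tangential hz' (not_tangential_smul ht hr0 hr1)
      have k := hf.abs_sub_le (fun z hz => (hM z hz).2) hreg hreg' (sameCell_smul hz ht hr0 hr1)
      have k2 : ‖z - r * z‖ ≤ ‖z‖ := by
        have : z - r * z = ((1 - r : ℝ) : ℂ) * z := by push_cast; ring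
        rw [this, norm_mul, norm_real, Real.norm_of_nonneg (by linarith)]
        nlinarith
      have k3 : 44 * Real.exp 88 * M * ‖z - r * z‖ ≤ 44 * Real.exp 88 * M * ‖z‖ := by gcongr
      rw [e, hFr _ hreg']
      rw [abs_le] at k
      constructor <;> linarith
    have := limsup_mem_Icc hev
    rw [abs_le]
    constructor <;> linarith [this.1, this.2]

/-! ### Integrable majorants for the singular error terms. -/

section Weights

lemma integrableOn_abs_rpow {s : ℝ} (hs : -1 < s) :
    IntegrableOn (fun x : ℝ => |x| ^ s) (Set.Ioo (-1) 1) := by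
  have h1 : IntegrableOn (fun x : ℝ => |x| ^ s) (Set.Ioo 0 1) := by
    have := (intervalIntegral.intervalIntegrable_rpow' (a := 0) (b := 1) hs).1
    exact (this.mono_set Set.Ioo_subset_Ioc_self).congr_fun
      (fun x hx => by rw [abs_of_pos hx.1]) measurableSet_Ioo
  have h2 : IntegrableOn (fun x : ℝ => |x| ^ s) (Set.Ioo (-1) 0) := by
    have := ((Measure.measurePreserving_neg (volume : Measure ℝ)).integrableOn_comp_preimage
      (Homeomorph.neg ℝ).measurableEmbedding (f := fun x : ℝ => |x| ^ s) (s := Set.Ioo 0 1)).2 h1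
    simpa [Function.comp_def] using this
  have h0 : IntegrableOn (fun x : ℝ => |x| ^ s) {0} :=
    integrableOn_singleton (by simp) (by simp)
  refine ((h2.union h0).union h1).mono_set ?_
  intro x hx
  rcases lt_trichotomy x 0 with h | h | h
  · exact Or.inl (Or.inl ⟨hx.1, h⟩)
  · exact Or.inl (Or.inr h)
  · exact Or.inr ⟨h, hx.2⟩

/-- The singular weight along the coordinate axes rotated by `u`. -/
def axisWeight (u z : ℂ) : ℝ := |(u * z).re| ^ (-(7 / 8) : ℝ) * |(u * z).im| ^ (-(7 / 8) : ℝ)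

lemma axisWeight_nonneg (u z : ℂ) : 0 ≤ axisWeight u z := by
  unfold axisWeight; positivity

lemma integrableOn_axisWeight {u : ℂ} (hu : ‖u‖ = 1) :
    IntegrableOn (axisWeight u) (Metric.ball 0 1) := by
  have h1 : IntegrableOn (axisWeight 1) (Metric.ball 0 1) := by
    have hi := integrableOn_abs_rpow (s := -(7 / 8)) (by norm_num)
    have h2 : IntegrableOn (fun p : ℝ × ℝ => |p.1| ^ (-(7 / 8) : ℝ) * |p.2| ^ (-(7 / 8) : ℝ))
        (Set.Ioo (-1) 1 ×ˢ Set.Ioo (-1) 1) := by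
      rw [IntegrableOn, Measure.volume_eq_prod, ← Measure.prod_restrict]
      exact Integrable.mul_prod hi hi
    have h3 := (volume_preserving_equiv_real_prod.integrableOn_comp_preimage
      measurableEquivRealProd.measurableEmbedding).2 h2
    refine (h3.congr_fun (g := axisWeight 1) (fun z _ => ?_) ?_).mono_set ?_
    · simp [axisWeight]
    · exact measurableEquivRealProd.measurable (measurableSet_Ioo.prod measurableSet_Ioo)
    · intro z hz
      rw [mem_ball_zero_iff] at hz
      have a1 := abs_lt.1 ((abs_re_le_norm z).trans_lt hz)
      have a2 := abs_lt.1 ((abs_im_le_norm z).trans_lt hz)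
      exact ⟨a1, a2⟩
  set c : Circle := ⟨u, mem_sphere_zero_iff_norm.2 hu⟩
  have h4 := ((rotation c).measurePreserving.integrableOn_comp_preimage
    (rotation c).toHomeomorph.measurableEmbedding).2 h1
  have e1 : (rotation c) ⁻¹' Metric.ball 0 1 = Metric.ball (0 : ℂ) 1 := by
    ext z
    rw [Set.mem_preimage, mem_ball_zero_iff, mem_ball_zero_iff, LinearIsometryEquiv.norm_map]
  rw [e1] at h4
  refine h4.congr_fun (fun z _ => ?_) Metric.isOpen_ball.measurableSet
  change axisWeight 1 (rotation c z) = _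
  rw [rotation_apply]
  simp [axisWeight, c]

/-- The axes must be excluded, because `0 ^ (-(7/8))` is 0 by convention and the weight vanishes
there. -/
lemma axisWeight_ge {u z : ℂ} (hu : ‖u‖ = 1) (hr : (u * z).re ≠ 0) (hi : (u * z).im ≠ 0)
    (hz : ‖z‖ ≤ 1) : ‖z‖ ^ (-(3 / 2) : ℝ) ≤ axisWeight u z := by
  have hn : ‖u * z‖ = ‖z‖ := by rw [norm_mul, hu, one_mul]
  have h1 := abs_re_le_norm (u * z)
  have h2 := abs_im_le_norm (u * z)
  rw [hn] at h1 h2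
  have p1 := abs_pos.2 hr
  have p2 := abs_pos.2 hi
  have hz0 : 0 < ‖z‖ := p1.trans_le h1
  calc ‖z‖ ^ (-(3 / 2) : ℝ) ≤ ‖z‖ ^ (-(7 / 8) + -(7 / 8) : ℝ) :=
        Real.rpow_le_rpow_of_exponent_ge hz0 hz (by norm_num)
    _ = ‖z‖ ^ (-(7 / 8) : ℝ) * ‖z‖ ^ (-(7 / 8) : ℝ) := Real.rpow_add hz0 _ _
    _ ≤ _ := by
      unfold axisWeight
      have k1 := Real.rpow_le_rpow_of_nonpos p1 h1 (by norm_num : (-(7 / 8) : ℝ) ≤ 0)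
      have k2 := Real.rpow_le_rpow_of_nonpos p2 h2 (by norm_num : (-(7 / 8) : ℝ) ≤ 0)
      gcongr

/-- The thin coordinate contributes |z|^{-7/4} and the other one |z|^{-7/8}, in total −21/8 ≤ −5/2.
The exponent 7/8 is at least 5/6 for this purpose and below 1 for integrability. -/
lemma axisWeight_ge_of_tangential {u z : ℂ} (hu : ‖u‖ = 1) (hr : (u * z).re ≠ 0)
    (hi : (u * z).im ≠ 0) (hz : ‖z‖ ≤ 1) (ht : |(u * z).re| ≤ 10 * ‖z‖ ^ 2) :
    ‖z‖ ^ (-(5 / 2) : ℝ) ≤ 10 * axisWeight u z := by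
  have hn : ‖u * z‖ = ‖z‖ := by rw [norm_mul, hu, one_mul]
  have h2 := abs_im_le_norm (u * z)
  rw [hn] at h2
  have p1 := abs_pos.2 hr
  have p2 := abs_pos.2 hi
  have hz0 : 0 < ‖z‖ := p2.trans_le h2
  have k1 := Real.rpow_le_rpow_of_nonpos p1 ht (by norm_num : (-(7 / 8) : ℝ) ≤ 0)
  have k2 := Real.rpow_le_rpow_of_nonpos p2 h2 (by norm_num : (-(7 / 8) : ℝ) ≤ 0)
  have e : (10 * ‖z‖ ^ 2) ^ (-(7 / 8) : ℝ) = 10 ^ (-(7 / 8) : ℝ) * ‖z‖ ^ (-(7 / 4) : ℝ) := by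
    rw [Real.mul_rpow (by norm_num) (sq_nonneg _), ← Real.rpow_natCast_mul hz0.le]
    norm_num
  have h10 : (1 : ℝ) ≤ 10 * 10 ^ (-(7 / 8) : ℝ) := by
    have : (10 : ℝ) * 10 ^ (-(7 / 8) : ℝ) = 10 ^ (1 + -(7 / 8) : ℝ) := by
      rw [Real.rpow_add (by norm_num), Real.rpow_one]
    rw [this]
    exact Real.one_le_rpow (by norm_num) (by norm_num)
  calc ‖z‖ ^ (-(5 / 2) : ℝ) ≤ ‖z‖ ^ (-(7 / 4) + -(7 / 8) : ℝ) :=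
        Real.rpow_le_rpow_of_exponent_ge hz0 hz (by norm_num)
    _ = ‖z‖ ^ (-(7 / 4) : ℝ) * ‖z‖ ^ (-(7 / 8) : ℝ) := Real.rpow_add hz0 _ _
    _ ≤ (10 * 10 ^ (-(7 / 8) : ℝ)) * (‖z‖ ^ (-(7 / 4) : ℝ) * ‖z‖ ^ (-(7 / 8) : ℝ)) :=
      le_mul_of_one_le_left (by positivity) h10
    _ = 10 * (10 ^ (-(7 / 8) : ℝ) * ‖z‖ ^ (-(7 / 4) : ℝ) * ‖z‖ ^ (-(7 / 8) : ℝ)) := by ring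
    _ ≤ _ := by
      rw [← e]
      unfold axisWeight
      gcongr

lemma ae_axis_ne_zero {u : ℂ} (hu : ‖u‖ = 1) :
    ∀ᵐ z : ℂ, (u * z).re ≠ 0 ∧ (u * z).im ≠ 0 := by
  have key : ∀ v : ℂ, ‖v‖ = 1 → ∀ᵐ z : ℂ, (v * z).re ≠ 0 := fun v hv => by
    have h := volume_form_zero (c := (0, v, 0)) (by simp [normSq_eq_norm_sq, hv])
    rw [ae_iff]
    convert h using 3
    ext z
    simp [form]
  filter_upwards [key u hu, key (-I * u) (by simp [hu])] with z h1 h2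
  refine ⟨h1, ?_⟩
  have e : (-I * u * z).re = (u * z).im := by
    rw [mul_assoc]; simp
  rwa [e] at h2

end Weights

end DirectionalLimit

/-! ### The radial integral and the logarithm. -/

section RadialIntegral

section Radial

lemma abs_mul_one_sub_cos_inv_sub_le {u : ℝ} (hu : 0 < u) :
    |u * (1 - Real.cos (1 / u)) - 1 / 2 * u⁻¹| ≤ 3 * u ^ (-(3 / 2) : ℝ) := by
  have h := abs_one_sub_cos_sub_le (1 / u)
  have e : u * (1 - Real.cos (1 / u)) - 1 / 2 * u⁻¹ =
      u * (1 - Real.cos (1 / u) - (1 / u) ^ 2 / 2) := by field_simp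
  have e2 : u * |1 / u| ^ (5 / 2 : ℝ) = u ^ (-(3 / 2) : ℝ) := by
    rw [abs_of_pos (by positivity), one_div, Real.inv_rpow hu.le, ← Real.rpow_neg hu.le]
    nth_rewrite 1 [← Real.rpow_one u]
    rw [← Real.rpow_add hu]
    norm_num
  rw [e, abs_mul, abs_of_pos hu, ← e2]
  calc _ ≤ u * (3 * |1 / u| ^ (5 / 2 : ℝ)) := by gcongr
    _ = _ := by ring

/-- The asymptotic behavior of the radial integral. -/
lemma exists_radial_expansion {R : ℝ} (hR : 0 < R) : ∃ c K : ℝ, ∀ τ, 0 < τ → τ ≤ R →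
    |(∫ r in (0 : ℝ)..R, r * (1 - Real.cos (τ / r))) - τ ^ 2 * (-(1 / 2) * Real.log τ + c)| ≤
      K * τ ^ (5 / 2 : ℝ) := by
  set H : ℝ → ℝ := fun u => u * (1 - Real.cos (1 / u)) with hH
  have hHm : Measurable H := by fun_prop
  have hHi : ∀ a b, IntervalIntegrable H volume a b := fun a b => by
    have h2 : IntervalIntegrable (fun u : ℝ => 2 * |u|) volume a b :=
      (by fun_prop : Continuous fun u : ℝ => 2 * |u|).intervalIntegrable a b
    refine h2.mono_fun hHm.aestronglyMeasurable (ae_of_all _ fun u => ?_)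
    have k1 := Real.neg_one_le_cos (1 / u)
    have k2 := Real.cos_le_one (1 / u)
    change ‖H u‖ ≤ ‖2 * |u|‖
    rw [Real.norm_of_nonneg (by positivity : (0 : ℝ) ≤ 2 * |u|), Real.norm_eq_abs, abs_mul,
      abs_of_nonneg (by linarith : 0 ≤ 1 - Real.cos (1 / u))]
    nlinarith [abs_nonneg u]
  -- After r = τu the integral becomes τ² ∫₀^{R/τ} H. Since H(u) = 1/(2u) + O(u^{-3/2}), the leading
  -- term yields the logarithm, and the remainder d is integrable at infinity with tail O(X^{-1/2}).
  set d : ℝ → ℝ := fun u => H u - 1 / 2 * u⁻¹ with hd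
  have hdm : Measurable d := by fun_prop
  have hdi : ∀ X : ℝ, 0 < X → IntegrableOn d (Set.Ioi X) := fun X hX => by
    refine ((integrableOn_Ioi_rpow_of_lt (a := -(3 / 2)) (by norm_num) hX).const_mul 3).mono'
      hdm.aestronglyMeasurable ?_
    filter_upwards [ae_restrict_mem measurableSet_Ioi] with u hu
    exact abs_mul_one_sub_cos_inv_sub_le (hX.trans hu)
  have htail : ∀ X : ℝ, 0 < X → |∫ u in Set.Ioi X, d u| ≤ 6 * X ^ (-(1 / 2) : ℝ) := fun X hX => by
    have h1 : |∫ u in Set.Ioi X, d u| ≤ ∫ u in Set.Ioi X, 3 * u ^ (-(3 / 2) : ℝ) := by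
      rw [← Real.norm_eq_abs]
      refine norm_integral_le_of_norm_le
        ((integrableOn_Ioi_rpow_of_lt (a := -(3 / 2)) (by norm_num) hX).const_mul 3) ?_
      filter_upwards [ae_restrict_mem measurableSet_Ioi] with u hu
      exact abs_mul_one_sub_cos_inv_sub_le (hX.trans hu)
    rw [integral_const_mul, integral_Ioi_rpow_of_lt (by norm_num) hX] at h1
    refine h1.trans_eq ?_
    norm_num
    ring
  refine ⟨(∫ u in (0 : ℝ)..1, H u) + (∫ u in Set.Ioi 1, d u) + 1 / 2 * Real.log R,
    6 * R ^ (-(1 / 2) : ℝ), fun τ hτ hτR => ?_⟩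
  set X := R / τ with hX
  have hX0 : 0 < X := by positivity
  have e1 : (∫ r in (0 : ℝ)..R, r * (1 - Real.cos (τ / r))) = τ ^ 2 * ∫ u in (0 : ℝ)..X, H u := by
    have : ∀ r : ℝ, r * (1 - Real.cos (τ / r)) = τ * H (r / τ) := fun r => by
      simp only [hH]
      rw [one_div_div]
      field_simp
    simp only [this]
    rw [intervalIntegral.integral_const_mul, intervalIntegral.integral_comp_div _ hτ.ne', zero_div,
      smul_eq_mul]
    ring
  have e2 : ∫ u in (0 : ℝ)..X, H u = (∫ u in (0 : ℝ)..1, H u) + ((∫ u in Set.Ioi 1, d u) -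
      ∫ u in Set.Ioi X, d u) + 1 / 2 * Real.log X := by
    rw [← intervalIntegral.integral_add_adjacent_intervals (hHi 0 1) (hHi 1 X)]
    have hinv : IntervalIntegrable (fun u : ℝ => 1 / 2 * u⁻¹) volume 1 X := by
      refine ContinuousOn.intervalIntegrable (ContinuousOn.mul continuousOn_const
        (continuousOn_inv₀.mono fun x hx => ?_))
      exact (lt_of_lt_of_le (lt_min one_pos hX0) hx.1).ne'
    have h3 : ∫ u in (1 : ℝ)..X, d u = (∫ u in (1 : ℝ)..X, H u) - 1 / 2 * Real.log X := by
      simp only [hd]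
      rw [intervalIntegral.integral_sub (hHi 1 X) hinv, intervalIntegral.integral_const_mul,
        integral_inv_of_pos one_pos hX0, div_one]
    have h4 := intervalIntegral.integral_interval_add_Ioi (hdi 1 one_pos) (hdi X hX0)
    linarith
  have e3 : Real.log X = Real.log R - Real.log τ := Real.log_div hR.ne' hτ.ne'
  have e4 : R ^ (-(1 / 2) : ℝ) * τ ^ (5 / 2 : ℝ) = τ ^ 2 * X ^ (-(1 / 2) : ℝ) := by
    have a1 : τ ^ (5 / 2 : ℝ) = τ ^ 2 * τ ^ (1 / 2 : ℝ) := by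
      rw [← Real.rpow_two, ← Real.rpow_add hτ]; norm_num
    rw [hX, Real.div_rpow hR.le hτ.le, a1, Real.rpow_neg hτ.le, div_inv_eq_mul]
    ring
  have e5 : (∫ r in (0 : ℝ)..R, r * (1 - Real.cos (τ / r))) - τ ^ 2 * (-(1 / 2) * Real.log τ +
      ((∫ u in (0 : ℝ)..1, H u) + (∫ u in Set.Ioi 1, d u) + 1 / 2 * Real.log R)) =
      -(τ ^ 2 * ∫ u in Set.Ioi X, d u) := by
    rw [e1, e2, e3]; ring
  rw [e5, abs_neg, abs_mul, abs_of_nonneg (sq_nonneg τ), mul_assoc, e4]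
  calc _ ≤ τ ^ 2 * (6 * X ^ (-(1 / 2) : ℝ)) := by gcongr; exact htail X hX0
    _ = _ := by ring

/-- The contribution of a density that depends on the direction only. -/
lemma exists_directional_expansion {g : ℂ → ℝ} (hg : Measurable g) {δ M s R : ℝ} (hδ : 0 < δ)
    (hgb : ∀ z, g z ∈ Set.Icc δ M) (hgr : ∀ z, ∀ r : ℝ, 0 < r → g (r * z) = g z) (hs : 0 < s)
    (hR : 0 < R) : ∃ c > 0, ∃ E, HasExpansion (fun t => ∫ z,
      (Metric.ball (0 : ℂ) R).indicator g z * (1 - Real.cos (t * (s * (1 / z).im)))) (-c) E := by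
  obtain ⟨c₀, K, hK⟩ := exists_radial_expansion hR
  set S : Set ℝ := Set.Ioo (-Real.pi) Real.pi with hS
  set γ : ℝ → ℝ := fun θ => g (Real.cos θ + Real.sin θ * I) with hγ
  have hγm : Measurable γ := hg.comp (by fun_prop)
  have hγb : ∀ θ, γ θ ∈ Set.Icc δ M := fun θ => hgb _
  have hM0 : 0 < M := hδ.trans_le ((hgb 0).1.trans (hgb 0).2)
  have hγa : ∀ θ, |γ θ| ≤ M := fun θ => by
    rw [abs_of_nonneg (hδ.le.trans (hγb θ).1)]; exact (hγb θ).2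
  -- In polar coordinates Im(1/z) = −sin θ / r, so the cosine depends on |t| a(θ) / r.
  set a : ℝ → ℝ := fun θ => s * |Real.sin θ| with ha
  have ha0 : ∀ θ, 0 ≤ a θ := fun θ => by positivity
  have has : ∀ θ, a θ ≤ s := fun θ => mul_le_of_le_one_right hs.le (Real.abs_sin_le_one θ)
  have ham : Continuous a := by fun_prop
  have hSfin : volume S < ∞ := by simp [hS]
  have : IsFiniteMeasure (volume.restrict S) := ⟨by simpa using hSfin⟩
  set rad : ℝ → ℝ := fun τ => ∫ r in (0 : ℝ)..R, r * (1 - Real.cos (τ / r)) with hrad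
  set Ψ : ℝ → ℝ × ℝ → ℝ := fun t p => γ p.2 * (p.1 * (1 - Real.cos (|t| * a p.2 / p.1))) with hΨ
  have hΨi : ∀ t, IntegrableOn (Ψ t) (Set.Ioo 0 R ×ˢ S) (volume.prod volume) := fun t => by
    refine Measure.integrableOn_of_bounded (M := M * (R * 2)) ?_ ?_ ?_
    · rw [Measure.prod_prod]
      exact ENNReal.mul_ne_top (by simp) hSfin.ne
    · have h1 : Measurable fun p : ℝ × ℝ => γ p.2 := hγm.comp measurable_snd
      have h2 : Measurable fun p : ℝ × ℝ => a p.2 := ham.measurable.comp measurable_snd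
      exact (h1.mul (by fun_prop)).aestronglyMeasurable
    · filter_upwards [ae_restrict_mem (measurableSet_Ioo.prod measurableSet_Ioo)] with p hp
      have k1 := Real.neg_one_le_cos (|t| * a p.2 / p.1)
      have k2 := Real.cos_le_one (|t| * a p.2 / p.1)
      have hp1 : |p.1| ≤ R := by rw [abs_of_pos hp.1.1]; exact hp.1.2.le
      simp only [hΨ]
      rw [norm_mul, norm_mul, Real.norm_eq_abs, Real.norm_eq_abs, Real.norm_eq_abs,
        abs_of_nonneg (by linarith : 0 ≤ 1 - Real.cos (|t| * a p.2 / p.1))]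
      gcongr
      · exact hγa _
      · linarith
  have hinner : ∀ t θ, ∫ r in Set.Ioo 0 R, Ψ t (r, θ) = γ θ * rad (|t| * a θ) := fun t θ => by
    simp only [hΨ, hrad]
    rw [integral_const_mul, intervalIntegral.integral_of_le hR.le, integral_Ioc_eq_integral_Ioo]
  have hpolar : ∀ t, ∫ z, (Metric.ball (0 : ℂ) R).indicator g z *
      (1 - Real.cos (t * (s * (1 / z).im))) = ∫ θ in S, γ θ * rad (|t| * a θ) := fun t => by
    rw [← Complex.integral_comp_polarCoord_symm]
    have e1 : ∫ p in polarCoord.target, p.1 • ((Metric.ball (0 : ℂ) R).indicator g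
        (Complex.polarCoord.symm p) * (1 - Real.cos (t * (s * (1 / Complex.polarCoord.symm p).im)))) =
        ∫ p in polarCoord.target, (Set.Iio R ×ˢ Set.univ).indicator (Ψ t) p := by
      refine setIntegral_congr_fun polarCoord.open_target.measurableSet fun p hp => ?_
      obtain ⟨r, θ⟩ := p
      have hr : 0 < r := hp.1
      have hn : ‖(Complex.polarCoord.symm (r, θ))‖ = r := by
        rw [Complex.norm_polarCoord_symm]; exact abs_of_pos hr
      by_cases hrR : r < R
      · have m1 : Complex.polarCoord.symm (r, θ) ∈ Metric.ball (0 : ℂ) R := by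
          rw [mem_ball_zero_iff, hn]; exact hrR
        have m2 : (r, θ) ∈ Set.Iio R ×ˢ (Set.univ : Set ℝ) := ⟨hrR, trivial⟩
        simp only [Set.indicator_of_mem m1, Set.indicator_of_mem m2]
        have him : (1 / Complex.polarCoord.symm (r, θ)).im = -(Real.sin θ / r) := by
          rw [one_div, inv_im, normSq_eq_norm_sq, hn, Complex.polarCoord_symm_apply]
          simp only [im_ofReal_mul]
          have : ((Real.cos θ : ℂ) + Real.sin θ * I).im = Real.sin θ := by
            rw [add_im, ofReal_im, im_ofReal_mul, I_im]; ring
          rw [this]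
          field_simp
        have hcos : Real.cos (t * (s * -(Real.sin θ / r))) = Real.cos (|t| * a θ / r) := by
          rw [← Real.cos_abs]
          congr 1
          simp only [ha]
          rw [abs_mul, abs_mul, abs_neg, abs_div, abs_of_pos hs, abs_of_pos hr]
          ring
        rw [him, hcos, Complex.polarCoord_symm_apply, hgr _ _ hr, smul_eq_mul]
        simp only [hΨ, hγ]
        ring
      · have m1 : Complex.polarCoord.symm (r, θ) ∉ Metric.ball (0 : ℂ) R := by
          rw [mem_ball_zero_iff, hn]; exact hrR
        have m2 : (r, θ) ∉ Set.Iio R ×ˢ (Set.univ : Set ℝ) := fun h => hrR h.1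
        simp only [Set.indicator_of_notMem m1, Set.indicator_of_notMem m2, zero_mul, smul_zero]
    rw [e1, setIntegral_indicator (measurableSet_Iio.prod MeasurableSet.univ)]
    have e2 : polarCoord.target ∩ Set.Iio R ×ˢ Set.univ = Set.Ioo 0 R ×ˢ S := by
      ext p
      simp only [polarCoord_target, Set.mem_inter_iff, Set.mem_prod, Set.mem_Ioi, Set.mem_Iio,
        Set.mem_univ, and_true, Set.mem_Ioo, hS]
      tauto
    rw [e2, Measure.volume_eq_prod, ← setIntegral_prod_swap]
    exact (setIntegral_prod (fun z => Ψ t z.swap) (hΨi t).swap).trans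
      (integral_congr_ae (ae_of_all _ fun θ => hinner t θ))
  have hradi : ∀ t, IntegrableOn (fun θ => γ θ * rad (|t| * a θ)) S := fun t => by
    have h1 := hΨi t
    rw [IntegrableOn, ← Measure.prod_restrict] at h1
    exact h1.integral_prod_right.congr (ae_of_all _ fun θ => hinner t θ)
  -- Continuity of x log x at 0 keeps this coefficient bounded near the directions where sin θ
  -- vanishes.
  have hq : Continuous fun x : ℝ => x ^ 2 * c₀ - 1 / 2 * (x * (x * Real.log x)) := by
    have := Real.continuous_mul_log
    fun_prop
  obtain ⟨Q, hQ⟩ := (isCompact_Icc (a := 0) (b := s)).exists_bound_of_continuousOn hq.continuousOn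
  have i1 : IntegrableOn (fun θ => γ θ * a θ ^ 2) S := by
    refine Integrable.of_bound (hγm.mul (ham.measurable.pow_const 2)).aestronglyMeasurable
      (M * s ^ 2) (ae_of_all _ fun θ => ?_)
    rw [norm_mul, norm_pow, Real.norm_eq_abs, Real.norm_eq_abs, abs_of_nonneg (ha0 θ)]
    have := ha0 θ
    gcongr
    · exact hγa θ
    · exact has θ
  have i2 : IntegrableOn (fun θ => γ θ * (a θ ^ 2 * c₀ - 1 / 2 * (a θ * (a θ * Real.log (a θ))))) S
      := by
    refine Integrable.of_bound (hγm.mul (hq.comp ham).measurable).aestronglyMeasurable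
      (M * Q) (ae_of_all _ fun θ => ?_)
    rw [norm_mul, Real.norm_eq_abs]
    gcongr
    · exact hγa θ
    · exact hQ _ ⟨ha0 θ, has θ⟩
  -- The bound g ≥ δ makes the logarithmic coefficient nonzero: the integral is at least δ s² π.
  have hpos : 0 < ∫ θ in S, γ θ * a θ ^ 2 := by
    have h1 : ∫ θ in S, δ * s ^ 2 * Real.sin θ ^ 2 = δ * s ^ 2 * Real.pi := by
      rw [integral_const_mul, hS, ← integral_Ioc_eq_integral_Ioo,
        ← intervalIntegral.integral_of_le (by linarith [Real.pi_pos]), integral_sin_sq]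
      simp
    have h2 : ∫ θ in S, δ * s ^ 2 * Real.sin θ ^ 2 ≤ ∫ θ in S, γ θ * a θ ^ 2 := by
      refine setIntegral_mono ?_ i1 fun θ => ?_
      · refine Integrable.of_bound (Measurable.aestronglyMeasurable (by fun_prop))
          (δ * s ^ 2 * 1) (ae_of_all _ fun θ => ?_)
        rw [Real.norm_of_nonneg (by positivity)]
        gcongr
        exact Real.sin_sq_le_one θ
      · simp only [ha]
        rw [mul_pow, sq_abs, mul_assoc]
        have := (hγb θ).1
        gcongr
    have := Real.pi_pos
    exact lt_of_lt_of_le (by rw [h1]; positivity) h2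
  refine ⟨1 / 2 * ∫ θ in S, γ θ * a θ ^ 2, by positivity,
    ∫ θ in S, γ θ * (a θ ^ 2 * c₀ - 1 / 2 * (a θ * (a θ * Real.log (a θ)))),
    (M * (|K| * s ^ (5 / 2 : ℝ))) * volume.real S, ?_⟩
  have hsmall : ∀ᶠ t in 𝓝[≠] (0 : ℝ), |t| * s ≤ R := by
    have : Tendsto (fun t : ℝ => |t| * s) (𝓝[≠] 0) (𝓝 (|0| * s)) :=
      ((continuous_abs.mul continuous_const).tendsto 0).mono_left nhdsWithin_le_nhds
    rw [abs_zero, zero_mul] at this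
    exact this.eventually_le_const hR
  filter_upwards [hsmall, self_mem_nhdsWithin] with t ht ht0
  have ht0' : 0 < |t| := abs_pos.2 ht0
  rw [hpolar t]
  have e : (∫ θ in S, γ θ * rad (|t| * a θ)) - (-(1 / 2 * ∫ θ in S, γ θ * a θ ^ 2) * t ^ 2 *
      Real.log |t| + (∫ θ in S, γ θ * (a θ ^ 2 * c₀ - 1 / 2 * (a θ * (a θ * Real.log (a θ))))) *
        t ^ 2) = ∫ θ in S, (γ θ * rad (|t| * a θ) - ((-(1 / 2) * t ^ 2 * Real.log |t|) *
        (γ θ * a θ ^ 2) +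
        t ^ 2 * (γ θ * (a θ ^ 2 * c₀ - 1 / 2 * (a θ * (a θ * Real.log (a θ))))))) := by
    have i3 : IntegrableOn (fun θ => (-(1 / 2) * t ^ 2 * Real.log |t|) * (γ θ * a θ ^ 2) +
        t ^ 2 * (γ θ * (a θ ^ 2 * c₀ - 1 / 2 * (a θ * (a θ * Real.log (a θ)))))) S :=
      (i1.const_mul _).add (i2.const_mul _)
    rw [integral_sub (hradi t) i3, integral_add (i1.const_mul _) (i2.const_mul _), integral_const_mul, integral_const_mul]
    ring
  rw [e, ← Real.norm_eq_abs]
  refine (norm_setIntegral_le_of_norm_le_const (C := M * (|K| * (|t| * s) ^ (5 / 2 : ℝ))) hSfin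
    fun θ _ => ?_).trans_eq ?_
  · have e2 : γ θ * rad (|t| * a θ) - ((-(1 / 2) * t ^ 2 * Real.log |t|) * (γ θ * a θ ^ 2) +
        t ^ 2 * (γ θ * (a θ ^ 2 * c₀ - 1 / 2 * (a θ * (a θ * Real.log (a θ)))))) =
        γ θ * (rad (|t| * a θ) - (|t| * a θ) ^ 2 * (-(1 / 2) * Real.log (|t| * a θ) + c₀)) := by
      rcases eq_or_ne (a θ) 0 with h | h
      · rw [h]; ring
      · rw [Real.log_mul ht0'.ne' h, mul_pow |t| (a θ), sq_abs t]; ring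
    rw [e2, norm_mul, Real.norm_eq_abs, Real.norm_eq_abs]
    have hle : |t| * a θ ≤ |t| * s := by have := has θ; gcongr
    have hb : |rad (|t| * a θ) - (|t| * a θ) ^ 2 * (-(1 / 2) * Real.log (|t| * a θ) + c₀)| ≤
        |K| * (|t| * s) ^ (5 / 2 : ℝ) := by
      rcases (ha0 θ).eq_or_lt with h | h
      · simp only [hrad, ← h, mul_zero, zero_div, Real.cos_zero, sub_self,
          intervalIntegral.integral_zero]
        norm_num
        positivity
      · have hpos := mul_pos ht0' h
        refine (hK _ hpos (hle.trans ht)).trans ?_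
        have := le_abs_self K
        gcongr
    gcongr
    exact hγa θ
  · rw [Real.mul_rpow ht0'.le hs.le]
    ring

end Radial

end RadialIntegral

/-! ### Comparison of the invariant density with its directional limit. -/

section Asymptotics

variable {D : ℕ} [hD : Fact (D = 2 ∨ D = 7 ∨ D = 11)]

lemma abs_scale_mul_im_le (z : ℂ) :
    |scale D * (1 / z).im| ^ (5 / 2 : ℝ) ≤ 8 * ‖z‖ ^ (-(5 / 2) : ℝ) := by
  have h1 : |scale D * (1 / z).im| ≤ 2 * ‖z‖⁻¹ := by
    rw [abs_mul, abs_of_pos scale_pos]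
    have k1 := scale_le (D := D)
    have k2 := abs_im_le_norm (1 / z)
    rw [one_div, norm_inv] at k2
    rw [one_div]
    gcongr
  have h8 : (2 : ℝ) ^ (5 / 2 : ℝ) ≤ 8 := by
    calc (2 : ℝ) ^ (5 / 2 : ℝ) ≤ 2 ^ (3 : ℝ) :=
        Real.rpow_le_rpow_of_exponent_le (by norm_num) (by norm_num)
      _ = 8 := by norm_num
  calc |scale D * (1 / z).im| ^ (5 / 2 : ℝ) ≤ (2 * ‖z‖⁻¹) ^ (5 / 2 : ℝ) :=
        Real.rpow_le_rpow (abs_nonneg _) h1 (by norm_num)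
    _ = 2 ^ (5 / 2 : ℝ) * ‖z‖ ^ (-(5 / 2) : ℝ) := by
      rw [Real.mul_rpow (by norm_num) (by positivity), Real.inv_rpow (norm_nonneg z),
        Real.rpow_neg (norm_nonneg z)]
    _ ≤ _ := by gcongr

/-- Three regions occur. Near 0 off the tangential set the difference is O(|z|), leaving |z|^{-3/2};
on the tangential set it is at most 2M and the axis weights of the finitely many tangent lines
dominate |z|^{-5/2}; beyond radius 1/50 the singular factor is bounded. -/
lemma integrable_density_error {f g : ℂ → ℝ} (hf : InCone D 44 f) {M K : ℝ} (hM0 : 0 ≤ M)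
    (hM : ∀ z ∈ regular D, |f z| ≤ M) (hg : Measurable g) (hgM : ∀ z, |g z| ≤ M)
    (hK : ∀ z, z ≠ 0 → ‖z‖ ≤ 1 / 50 → ¬Tangential D z → |f z - g z| ≤ K * ‖z‖) :
    Integrable (fun z => |(regular D).indicator f z - (Metric.ball (0 : ℂ) (1 / 50)).indicator g z| *
      |scale D * (1 / z).im| ^ (5 / 2 : ℝ)) := by
  classical
  set e : ℂ → ℝ := fun z =>
    (regular D).indicator f z - (Metric.ball (0 : ℂ) (1 / 50)).indicator g z with he
  have hem : Measurable e :=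
    hf.measurable_indicator.sub (hg.indicator Metric.isOpen_ball.measurableSet)
  have hpm : Measurable fun z : ℂ => scale D * (1 / z).im :=
    (measurable_im.comp (measurable_const.div measurable_id)).const_mul _
  set T := finite_forms (D := D).toFinset.filter fun c => c.2.2 = 0 with hT
  set u : ℤ × ℂ × ℤ → ℂ := fun c => c.2.1 / (‖c.2.1‖ : ℂ) with hu
  -- When the constant term is 0 the discriminant is |B|², which is at least 1.
  have hB : ∀ c ∈ T, 1 ≤ ‖c.2.1‖ := fun c hc => by
    rw [hT, Finset.mem_filter, Set.Finite.mem_toFinset] at hc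
    have h := hc.1.1.2.1
    rw [hc.2, normSq_eq_norm_sq] at h
    push_cast at h
    nlinarith [norm_nonneg c.2.1]
  have hun : ∀ c ∈ T, ‖u c‖ = 1 := fun c hc => by
    have := hB c hc
    simp only [hu]
    rw [norm_div, norm_real, norm_norm, div_self (by linarith)]
  set W : ℂ → ℝ := fun z => |K| * axisWeight 1 z + 20 * M * ∑ c ∈ T, axisWeight (u c) z with hW
  have hW0 : ∀ z, 0 ≤ W z := fun z => by
    have h1 := axisWeight_nonneg 1 z
    have h2 : 0 ≤ ∑ c ∈ T, axisWeight (u c) z := Finset.sum_nonneg fun c _ => axisWeight_nonneg _ _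
    positivity
  have hWi : IntegrableOn W (Metric.ball 0 1) :=
    ((integrableOn_axisWeight norm_one).const_mul _).add
      ((integrable_finsetSum T fun c hc => integrableOn_axisWeight (hun c hc)).const_mul _)
  have hWi' := (integrable_indicator_iff Metric.isOpen_ball.measurableSet).2 hWi
  have hRi : Integrable ((regular D).indicator fun _ : ℂ => M * (1 / 50) ^ (-(5 / 2) : ℝ)) :=
    (integrable_indicator_iff measurableSet_regular).2
      (integrableOn_const volume_regular_lt_top.ne)
  have hae : ∀ᵐ z : ℂ, ((1 * z).re ≠ 0 ∧ (1 * z).im ≠ 0) ∧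
      ∀ c ∈ T, (u c * z).re ≠ 0 ∧ (u c * z).im ≠ 0 :=
    (ae_axis_ne_zero norm_one).and
      ((Finset.eventually_all T).2 fun c hc => ae_axis_ne_zero (hun c hc))
  refine ((hWi'.add hRi).const_mul 8).mono' (hem.norm.mul (hpm.norm.pow_const _)).aestronglyMeasurable
    ?_
  filter_upwards [hae] with z ⟨hz1, hzT⟩
  have hz0 : z ≠ 0 := fun h => hz1.1 (by simp [h])
  have hzp : 0 < ‖z‖ := norm_pos_iff.2 hz0
  rw [Real.norm_of_nonneg (by positivity)]
  suffices h : |e z| * ‖z‖ ^ (-(5 / 2) : ℝ) ≤ (Metric.ball 0 1).indicator W z +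
      (regular D).indicator (fun _ => M * (1 / 50) ^ (-(5 / 2) : ℝ)) z by
    calc |e z| * |scale D * (1 / z).im| ^ (5 / 2 : ℝ)
        ≤ |e z| * (8 * ‖z‖ ^ (-(5 / 2) : ℝ)) := by gcongr; exact abs_scale_mul_im_le z
      _ = 8 * (|e z| * ‖z‖ ^ (-(5 / 2) : ℝ)) := by ring
      _ ≤ _ := by
        simp only [Pi.add_apply]
        gcongr
  have hR0 : 0 ≤ (regular D).indicator (fun _ : ℂ => M * (1 / 50) ^ (-(5 / 2) : ℝ)) z :=
    Set.indicator_nonneg (fun _ _ => by positivity) z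
  by_cases hzR : ‖z‖ < 1 / 50
  · have hb1 : z ∈ Metric.ball (0 : ℂ) 1 := by rw [mem_ball_zero_iff]; linarith
    have hb2 : z ∈ Metric.ball (0 : ℂ) (1 / 50) := by rw [mem_ball_zero_iff]; exact hzR
    have hz1' : ‖z‖ ≤ 1 := by linarith
    rw [Set.indicator_of_mem hb1]
    suffices h : |e z| * ‖z‖ ^ (-(5 / 2) : ℝ) ≤ W z by linarith
    have h1 := axisWeight_nonneg 1 z
    have h2 : ∀ c ∈ T, 0 ≤ axisWeight (u c) z := fun c _ => axisWeight_nonneg _ _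
    by_cases ht : Tangential D z
    · obtain ⟨c, hc, hC, hle⟩ := ht
      have hcT : c ∈ T := by
        rw [hT, Finset.mem_filter, Set.Finite.mem_toFinset]; exact ⟨hc, hC⟩
      have hle' : |(u c * z).re| ≤ 10 * ‖z‖ ^ 2 := by
        refine le_trans ?_ hle
        have e1 : u c * z = ((‖c.2.1‖⁻¹ : ℝ) : ℂ) * (c.2.1 * z) := by
          simp only [hu]; push_cast; ring
        rw [e1, re_ofReal_mul, abs_mul, abs_of_nonneg (by positivity)]
        exact mul_le_of_le_one_left (abs_nonneg _) (inv_le_one_of_one_le₀ (hB c hcT))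
      have k1 := axisWeight_ge_of_tangential (hun c hcT) (hzT c hcT).1 (hzT c hcT).2 hz1' hle'
      have k2 : |e z| ≤ 2 * M := by
        have k3 : |(regular D).indicator f z| ≤ M := by
          by_cases hr : z ∈ regular D
          · rw [Set.indicator_of_mem hr]; exact hM z hr
          · rw [Set.indicator_of_notMem hr, abs_zero]; exact hM0
        have k4 := hgM z
        simp only [he, Set.indicator_of_mem hb2]
        refine (abs_sub _ _).trans ?_
        linarith
      calc |e z| * ‖z‖ ^ (-(5 / 2) : ℝ) ≤ 2 * M * (10 * axisWeight (u c) z) := by gcongr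
        _ = 20 * M * axisWeight (u c) z := by ring
        _ ≤ 20 * M * ∑ c ∈ T, axisWeight (u c) z := by
          gcongr
          exact Finset.single_le_sum h2 hcT
        _ ≤ W z := le_add_of_nonneg_left (by positivity)
    · have hr := mem_regular_of_not_tangential hzR.le ht
      have k1 := hK z hz0 hzR.le ht
      have k2 := axisWeight_ge (u := 1) norm_one hz1.1 hz1.2 hz1'
      simp only [he, Set.indicator_of_mem hb2, Set.indicator_of_mem hr]
      have e1 : ‖z‖ * ‖z‖ ^ (-(5 / 2) : ℝ) = ‖z‖ ^ (-(3 / 2) : ℝ) := by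
        nth_rewrite 1 [← Real.rpow_one ‖z‖]
        rw [← Real.rpow_add hzp]
        norm_num
      calc |f z - g z| * ‖z‖ ^ (-(5 / 2) : ℝ) ≤ (|K| * ‖z‖) * ‖z‖ ^ (-(5 / 2) : ℝ) := by
            gcongr
            exact k1.trans (by gcongr; exact le_abs_self K)
        _ = |K| * ‖z‖ ^ (-(3 / 2) : ℝ) := by rw [mul_assoc, e1]
        _ ≤ |K| * axisWeight 1 z := by gcongr
        _ ≤ W z := le_add_of_nonneg_right
            (mul_nonneg (by positivity) (Finset.sum_nonneg h2))
  · have hb2 : z ∉ Metric.ball (0 : ℂ) (1 / 50) := by rw [mem_ball_zero_iff]; exact hzR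
    have hW' : 0 ≤ (Metric.ball (0 : ℂ) 1).indicator W z :=
      Set.indicator_nonneg (fun z _ => hW0 z) z
    suffices h : |e z| * ‖z‖ ^ (-(5 / 2) : ℝ) ≤
        (regular D).indicator (fun _ => M * (1 / 50) ^ (-(5 / 2) : ℝ)) z by linarith
    simp only [he, Set.indicator_of_notMem hb2, sub_zero]
    by_cases hr : z ∈ regular D
    · rw [Set.indicator_of_mem hr, Set.indicator_of_mem hr]
      have k1 : ‖z‖ ^ (-(5 / 2) : ℝ) ≤ (1 / 50) ^ (-(5 / 2) : ℝ) :=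
        Real.rpow_le_rpow_of_nonpos (by norm_num) (not_lt.1 hzR) (by norm_num)
      have k2 := hM z hr
      gcongr
    · rw [Set.indicator_of_notMem hr, Set.indicator_of_notMem hr]
      simp

lemma integral_densityMeasure {f : ℂ → ℝ} (hf : InCone D 44 f) (H : ℂ → ℝ) :
    ∫ z, H z ∂(densityMeasure D f) = ∫ z, (regular D).indicator f z * H z := by
  rw [densityMeasure, integral_withDensity_eq_integral_toReal_smul
    hf.measurable_indicator.ennreal_ofReal (ae_of_all _ fun _ => ENNReal.ofReal_lt_top),
    ← integral_indicator measurableSet_regular]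
  refine integral_congr_ae (ae_of_all _ fun z => ?_)
  by_cases hr : z ∈ regular D
  · simp only [Set.indicator_of_mem hr]
    rw [ENNReal.toReal_ofReal (hf.nonneg z hr), smul_eq_mul]
  · simp only [Set.indicator_of_notMem hr, zero_mul]

/-- The cosine integral of the imaginary part of `1 / z` against an invariant density. -/
lemma exists_expansion_im_inv {f : ℂ → ℝ} (hf : InCone D 44 f) {δ : ℝ} (hδ : 0 < δ)
    (hδf : ∀ z ∈ regular D, δ ≤ f z) : ∃ c > 0, ∃ E, HasExpansion
      (fun t => ∫ z, (1 - Real.cos (t * (scale D * (1 / z).im))) ∂(densityMeasure D f)) (-c) E := by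
  obtain ⟨M₀, hM₀⟩ := exists_bound_of_inCone (by norm_num) hf
  set M := max M₀ δ with hMdef
  have hM : ∀ z ∈ regular D, |f z| ≤ M := fun z hz => (hM₀ z hz).trans (le_max_left _ _)
  have hM0 : 0 ≤ M := hδ.le.trans (le_max_right _ _)
  obtain ⟨g, hg, hgb, hgr, K, hK⟩ := exists_directional_limit hf (le_max_right M₀ δ)
    fun z hz => ⟨hδf z hz, (le_abs_self _).trans (hM z hz)⟩
  have hgM : ∀ z, |g z| ≤ M := fun z => by
    rw [abs_of_nonneg (hδ.le.trans (hgb z).1)]; exact (hgb z).2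
  obtain ⟨c, hc, E₁, h1⟩ := exists_directional_expansion hg hδ hgb hgr (scale_pos (D := D))
    (by norm_num : (0 : ℝ) < 1 / 50)
  have hpm : Measurable fun z : ℂ => scale D * (1 / z).im :=
    (measurable_im.comp (measurable_const.div measurable_id)).const_mul _
  have hFi : Integrable ((regular D).indicator f) :=
    (integrable_indicator_iff measurableSet_regular).2 (hf.integrableOn (by norm_num))
  have hGi : Integrable ((Metric.ball (0 : ℂ) (1 / 50)).indicator g) :=
    (integrable_indicator_iff Metric.isOpen_ball.measurableSet).2
      (Measure.integrableOn_of_bounded measure_ball_lt_top.ne hg.aestronglyMeasurable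
        (ae_of_all _ hgM))
  -- The difference between f and the truncated directional density has a finite 5/2-moment, so it
  -- affects only the t² coefficient.
  obtain ⟨E₂, h2⟩ := exists_integral_mul_cos (hFi.sub hGi) hpm
    (integrable_density_error hf hM0 hM hg hgM hK)
  refine ⟨c, hc, E₁ + E₂, ?_⟩
  convert h1.add h2 using 1
  · funext t
    have hcos : ∀ F : ℂ → ℝ, Integrable F →
        Integrable fun z => F z * (1 - Real.cos (t * (scale D * (1 / z).im))) := fun F hF => by
      refine (hF.norm.mul_const 2).mono' (hF.aestronglyMeasurable.mul
        (Measurable.aestronglyMeasurable (by fun_prop))) (ae_of_all _ fun z => ?_)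
      have k1 := Real.neg_one_le_cos (t * (scale D * (1 / z).im))
      have k2 := Real.cos_le_one (t * (scale D * (1 / z).im))
      rw [norm_mul]
      gcongr
      rw [Real.norm_eq_abs, abs_le]
      constructor <;> linarith
    rw [integral_densityMeasure hf, ← integral_add (hcos _ hGi) (hcos _ (hFi.sub hGi))]
    refine integral_congr_ae (ae_of_all _ fun z => ?_)
    simp only [Pi.sub_apply]
    ring
  · ring

/-- An invariant density is bounded below on the regular set. -/
lemma exists_lower_bound {f : ℂ → ℝ} (hf : InCone D 44 f) (hm : mass D f = 1)
    (hL : ∀ z ∈ regular D, transfer D f z = f z) : ∃ δ > 0, ∀ z ∈ regular D, δ ≤ f z := by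
  obtain ⟨n, -, δ, hδ, _, -, h⟩ := exists_doeblin_mass (D := D)
  have hfix : ∀ n : ℕ, ∀ z ∈ regular D, (transfer D)^[n] f z = f z := by
    intro n
    induction n with
    | zero => exact fun _ _ => rfl
    | succ n ih =>
      intro z hz
      rw [Function.iterate_succ_apply', transfer_congr ih hz, hL z hz]
  refine ⟨δ, hδ, fun z hz => ?_⟩
  have := (h f hf).1 z hz
  rwa [hm, mul_one, hfix n z hz] at this

end Asymptotics

end Hurwitz

end

theorem proposition7p1 (D : ℕ) (hD : D = 2 ∨ D = 7 ∨ D = 11) :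
    ∃ μ : Measure ℂ, Hurwitz.IsInvariantMeasure D μ ∧
      (∀ ν : Measure ℂ, Hurwitz.IsInvariantMeasure D ν → ν = μ) ∧
      ∃ C C' : ℝ, 0 < C ∧
        (fun t : ℝ =>
          (∫ z in Hurwitz.domain D, (exp (I * t * Hurwitz.period D z) - 1) ∂μ)
            - ((C * t ^ 2 * Real.log |t| + C' * t ^ 2 : ℝ) : ℂ))
          =O[𝓝[≠] 0] fun t : ℝ => |t| ^ (5 / 2 : ℝ) := by
  have : Fact (D = 2 ∨ D = 7 ∨ D = 11) := ⟨hD⟩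
  obtain ⟨f, hf, hm, hL, n, b, hb, h⟩ := Hurwitz.exists_invariant_density (D := D)
  have hμ := Hurwitz.isInvariantMeasure_densityMeasure hf hm hL
  refine ⟨Hurwitz.densityMeasure D f, hμ, fun ν hν => Hurwitz.eq_densityMeasure hf hm hb h hν, ?_⟩
  have he : ∀ z ∈ Hurwitz.regular D, f (-z) = f z := fun z hz => Hurwitz.density_even hb h hz
  obtain ⟨δ, hδ, hδf⟩ := Hurwitz.exists_lower_bound hf hm hL
  obtain ⟨c, hc, E, hE⟩ := Hurwitz.exists_expansion_im_inv hf hδ hδf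
  obtain ⟨E', hE'⟩ := Hurwitz.exists_expansion_period hf hm hμ.measurePreserving hE
  -- The integral equals −∫(1 − cos tΨ), whose logarithmic coefficient is −2·(−c) = 2c > 0.
  obtain ⟨K, hK⟩ := hE'.const_mul (-1)
  refine ⟨-1 * (2 * -c), -1 * E', by linarith, Asymptotics.IsBigO.of_bound K ?_⟩
  filter_upwards [hK] with t ht
  rw [Hurwitz.integral_exp_period hf he hμ t, ← ofReal_sub, norm_real, Real.norm_eq_abs,
    Real.norm_of_nonneg (Real.rpow_nonneg (abs_nonneg t) _)]
  rwa [neg_one_mul (∫ z, _ ∂_)] at ht
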